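/- Let $k$ be a field and $n\ge 1$ an integer. Let $A=\bigoplus_{i\ge 0}A^i$ be a (graded) commutative differential graded algebra over $k$, with differential of degree $+1$, such that $A^0=k$; thus $A=k\oplus A^+$ with $A^+=\bigoplus_{i>0}A^i$. **The bicomplex $\bar E(n,A)$.** Let $\Lambda(e_{ij})$ be the exterior algebra on generators $e_{ij}$, $1\le i<j\le n$. Let $E(n,A)$ be the quotient of the graded commutative algebra $A^{\otimes n}\otimes\Lambda(e_{ij})$ by the ideal generated by the elements $(e_i(a)-e_j(a))\otimes e_{ij}$, where $a\in A$ and $e_i(a)=1\otimes\cdots\otimes a\otimes\cdots\otimes 1$ with $a$ in position $i$, and let $\bar E(n,A)=E(n,A)/J$, where $J$ is the ideal generated by the products $e_{ir}e_{jr}$. The bidegree $(p,q)$ part is spanned by the products of $p$ generators $e_{ij}$ with elements of $A^{\otimes n}$ of degree $q$; $d'$ is right multiplication by $\sum_{i<j}e_{ij}$, and $d''$ is induced by the differential of $A$: $d''(x\otimes\omega)=(-1)^p\,dx\otimes\omega$ if $\omega$ is a product of $p$ generators. **The bicomplex $C(n,A)$.** Let $\mathcal H$ be the set of graphs $G$ with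 vertices $1,\dots,n$ and edges of the form $(i,j)$, $i<j$, such that no two edges have the same target $j$ and such that the vertex $1$ is isolated. Let $S_1=\{1\},S_2,\dots,S_l$, $l=l(G)$, be the components of $G$, ordered by their smallest vertices, and let $e_G$ be the product of the symbols $e_{ij}$ over the edges of $G$, in lexicographic order. Put $$C(n,A)=\bigoplus_{G\in\mathcal H}A\otimes(A^+)^{\otimes(l(G)-1)}\,e_G .$$ The bidegree $(p,q)$ part is spanned by the homogeneous elements $a_1\otimes\cdots\otimes a_l\,e_G$ where $G$ has $p$ edges and $\sum_i|a_i|=q$. The differential $d''$ is $d''(a\,e_G)=(-1)^{p}(da)\,e_G$, where $p$ is the number of edges of $G$ and $d$ is the tensor product differential, and $$d'(a_1\otimes\cdots\otimes a_l\,e_G)=\sum_{1<i<j\le n}\alpha_{ij}\,e_Ge_{ij},$$ where $e_Ge_{ij}=0$ if $(i,j)$ is an edge of $G$ or $G\cup\{(i,j)\}\notin\mathcal H$, and otherwise, $S_s$ and $S_t$ ($1<s<t$) being the components of $i$ and $j$, $$\begin{aligned}\alpha_{ij}={}&(-1)^{|a_t|(|a_{s+1}|+\cdots+|a_{t-1}|)}\,a_1\otimes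 a_2\otimes\cdots\otimes a_{s-1}\otimes a_sa_t\otimes a_{s+1}\otimes\cdots\widehat{a_t}\cdots\otimes a_l\\&-\varepsilon\,a_1a_s\otimes a_2\otimes\cdots\otimes a_{s-1}\otimes a_t\otimes a_{s+1}\otimes\cdots\widehat{a_t}\cdots\otimes a_l\\&-(-1)^{|a_t|(|a_2|+\cdots+|a_{t-1}|)}\,a_1a_t\otimes a_2\otimes\cdots\otimes a_{s-1}\otimes a_s\otimes a_{s+1}\otimes\cdots\widehat{a_t}\cdots\otimes a_l,\end{aligned}$$ with $\varepsilon=(-1)^{|a_s|(|a_2|+\cdots+|a_{s-1}|)+|a_t|(|a_{s+1}|+\cdots+|a_{t-1}|)}$. The symbols $e_{ij}$ anticommute. **Proposition.** $C(n,A)$ and $\bar E(n,A)$ are bicomplexes: $d'$ and $d''$ have bidegrees $(1,0)$ and $(0,1)$, $d'^2=0$, $d''^2=0$ and $d'd''+d''d'=0$. There exists a quasi-isomorphism of bicomplexes $$\bar\varphi:C(n,A)\xrightarrow{\ \simeq\ }\bar E(n,A),$$ that is, a linear map of bidegree $(0,0)$ that commutes with $d'$ and with $d''$ and induces an isomorphism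 in the cohomology with respect to $d'+d''$. It is natural in $A$, with respect to the morphisms of differential graded algebras. -/

import Mathlib

open scoped TensorProduct DirectSum

universe u v

noncomputable section

/-! ## Connected commutative differential graded algebras -/

/-- A commutative differential graded algebra `A = ⨁_{i ≥ 0} A^i` over `k`, with a differential of
degree `+1` and with `A^0 = k`, so that `A = k ⊕ A⁺`. -/
structure ConnCDGA (k : Type v) [Field k] where
  carrier : Type u
  [ring : Ring carrier]
  [algebra : Algebra k carrier]
  deg : ℕ → Submodule k carrier
  [graded : GradedAlgebra deg]
  d : carrier →ₗ[k] carrier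
  d_mem : ∀ i a, a ∈ deg i → d a ∈ deg (i + 1)
  d_d : ∀ a, d (d a) = 0
  leibniz : ∀ i a b, a ∈ deg i → d (a * b) = d a * b + (-1 : k) ^ i • (a * d b)
  comm : ∀ i j a b, a ∈ deg i → b ∈ deg j → a * b = (-1 : k) ^ (i * j) • (b * a)
  nontrivial : Nontrivial carrier
  deg_zero : deg 0 = 1

namespace ConnCDGA

attribute [instance] ConnCDGA.ring ConnCDGA.algebra ConnCDGA.graded

variable {k : Type v} [Field k]

/-- Morphisms of differential graded algebras. -/
structure Hom (A B : ConnCDGA.{u} k) where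
  toAlgHom : A.carrier →ₐ[k] B.carrier
  map_deg : ∀ i a, a ∈ A.deg i → toAlgHom a ∈ B.deg i
  map_d : ∀ a, toAlgHom (A.d a) = B.d (toAlgHom a)

variable (A : ConnCDGA.{u} k)

/-- The augmentation ideal `A⁺ = ⨁_{i > 0} A^i`. -/
def plus : Submodule k A.carrier := ⨆ i : ℕ, A.deg (i + 1)

/-- The projection of `A` onto the sum of the `A^i` with `i ≡ b mod 2`. -/
def par (b : Fin 2) : A.carrier →ₗ[k] A.carrier :=
  DirectSum.toModule k ℕ A.carrier
      (fun i => if i % 2 = (b : ℕ) then (A.deg i).subtype else 0) ∘ₗ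
    (DirectSum.decomposeLinearEquiv A.deg).toLinearMap

/-- The degree involution `a ↦ (-1)^{|a|} a`. -/
def sgn : A.carrier →ₗ[k] A.carrier := A.par 0 - A.par 1

variable {A}

theorem par_of_mem {b : Fin 2} {i : ℕ} {a : A.carrier} (ha : a ∈ A.deg i) :
    A.par b a = if i % 2 = (b : ℕ) then a else 0 := by
  have h : DirectSum.decompose A.deg a = DirectSum.of (fun i => A.deg i) i ⟨a, ha⟩ :=
    DirectSum.decompose_of_mem A.deg ha
  have h' : (DirectSum.decomposeLinearEquiv A.deg) a
      = DirectSum.lof k ℕ (fun i => A.deg i) i ⟨a, ha⟩ := h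
  simp only [par, LinearMap.comp_apply, LinearEquiv.coe_coe, h', DirectSum.toModule_lof]
  split_ifs <;> simp

theorem sgn_of_mem {i : ℕ} {a : A.carrier} (ha : a ∈ A.deg i) :
    A.sgn a = (-1 : k) ^ i • a := by
  rw [sgn, LinearMap.sub_apply, par_of_mem ha, par_of_mem ha]
  rcases Nat.even_or_odd i with h | h
  · simp [h.neg_one_pow, Nat.even_iff.1 h]
  · simp [h.neg_one_pow, Nat.odd_iff.1 h]

/-- Linear maps out of `A` that agree on homogeneous elements are equal. -/
theorem hom_ext {M : Type*} [AddCommGroup M] [Module k M] {f g : A.carrier →ₗ[k] M}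
    (h : ∀ i a, a ∈ A.deg i → f a = g a) : f = g := by
  ext a
  induction a using DirectSum.Decomposition.inductionOn A.deg with
  | zero => simp
  | homogeneous a => exact h _ _ a.2
  | add a b ha hb => rw [map_add, map_add, ha, hb]

theorem mem_plus {i : ℕ} {a : A.carrier} (ha : a ∈ A.deg (i + 1)) : a ∈ A.plus :=
  Submodule.mem_iSup_of_mem (p := fun i => A.deg (i + 1)) i ha

theorem map_mem_plus {B : ConnCDGA.{u} k} {f : A.carrier →ₗ[k] B.carrier}
    (hf : ∀ i a, a ∈ A.deg (i + 1) → f a ∈ B.plus) {a : A.carrier} (ha : a ∈ A.plus) :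
    f a ∈ B.plus := by
  have : A.plus ≤ B.plus.comap f := iSup_le fun i a ha => hf i a ha
  exact this ha

theorem par_mem_plus (b : Fin 2) {a : A.carrier} (ha : a ∈ A.plus) : A.par b a ∈ A.plus := by
  refine map_mem_plus (fun i a ha => ?_) ha
  rw [par_of_mem ha]
  split_ifs
  · exact mem_plus ha
  · exact zero_mem _

theorem sgn_mem_plus {a : A.carrier} (ha : a ∈ A.plus) : A.sgn a ∈ A.plus := by
  rw [sgn, LinearMap.sub_apply]
  exact sub_mem (par_mem_plus _ ha) (par_mem_plus _ ha)

theorem sgn_pow_mem_plus (m : ℕ) {a : A.carrier} (ha : a ∈ A.plus) :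
    (A.sgn ^ m) a ∈ A.plus := by
  induction m with
  | zero => simpa using ha
  | succ m ih => rw [pow_succ']; exact sgn_mem_plus ih

theorem d_mem_plus {a : A.carrier} (ha : a ∈ A.plus) : A.d a ∈ A.plus :=
  map_mem_plus (fun _ _ ha => mem_plus (A.d_mem _ _ ha)) ha

theorem Hom.mem_plus {B : ConnCDGA.{u} k} (f : Hom A B) {a : A.carrier} (ha : a ∈ A.plus) :
    f.toAlgHom a ∈ B.plus :=
  map_mem_plus (f := f.toAlgHom.toLinearMap)
    (fun _ _ ha => ConnCDGA.mem_plus (f.map_deg _ _ ha)) ha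

theorem mul_mem_plus {a b : A.carrier} (ha : a ∈ A.plus) (hb : b ∈ A.plus) :
    a * b ∈ A.plus := by
  refine map_mem_plus (f := LinearMap.mulRight k b) (fun i a ha => ?_) ha
  refine map_mem_plus (f := LinearMap.mulLeft k a) (fun j b hb => ?_) hb
  have h : a * b ∈ A.deg ((i + 1 + j) + 1) := SetLike.mul_mem_graded (j := j + 1) ha hb
  exact mem_plus h

/-! Identities between the involution, the differential and right multiplications. -/

theorem sgn_comp_sgn : A.sgn ∘ₗ A.sgn = LinearMap.id := by
  refine hom_ext fun i a ha => ?_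
  simp [sgn_of_mem ha, smul_smul, ← mul_pow]

theorem d_comp_sgn_pow (m : ℕ) : A.d ∘ₗ (A.sgn ^ m) = (-1 : k) ^ m • ((A.sgn ^ m) ∘ₗ A.d) := by
  have h : A.d * A.sgn = (-1 : k) • (A.sgn * A.d) := by
    refine hom_ext fun i a ha => ?_
    simp [sgn_of_mem ha, sgn_of_mem (A.d_mem _ _ ha), pow_succ]
  change A.d * (A.sgn ^ m) = (-1 : k) ^ m • ((A.sgn ^ m) * A.d)
  induction m with
  | zero => simp
  | succ m ih =>
    rw [pow_succ, ← mul_assoc, ih, smul_mul_assoc, mul_assoc, h, pow_succ, mul_smul,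
      mul_smul_comm, mul_assoc]

theorem sgn_comp_mulRight {m : ℕ} {a : A.carrier} (ha : a ∈ A.deg m) :
    A.sgn ∘ₗ LinearMap.mulRight k a = (-1 : k) ^ m • (LinearMap.mulRight k a ∘ₗ A.sgn) := by
  refine hom_ext fun i b hb => ?_
  have h : b * a ∈ A.deg (i + m) := SetLike.mul_mem_graded hb ha
  simp [sgn_of_mem hb, sgn_of_mem h, smul_smul, pow_add, mul_comm]

theorem d_comp_mulRight (a : A.carrier) :
    A.d ∘ₗ LinearMap.mulRight k a =
      LinearMap.mulRight k a ∘ₗ A.d + LinearMap.mulRight k (A.d a) ∘ₗ A.sgn := by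
  refine hom_ext fun i b hb => ?_
  simp [sgn_of_mem hb, A.leibniz i b a hb]

theorem Hom.comp_sgn {B : ConnCDGA.{u} k} (f : Hom A B) :
    f.toAlgHom.toLinearMap ∘ₗ A.sgn = B.sgn ∘ₗ f.toAlgHom.toLinearMap := by
  refine hom_ext fun i a ha => ?_
  simp [sgn_of_mem ha, sgn_of_mem (f.map_deg _ _ ha)]

theorem Hom.comp_sgn_pow {B : ConnCDGA.{u} k} (f : Hom A B) (m : ℕ) :
    f.toAlgHom.toLinearMap ∘ₗ (A.sgn ^ m) = (B.sgn ^ m) ∘ₗ f.toAlgHom.toLinearMap := by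
  induction m with
  | zero => ext; simp
  | succ m ih =>
    rw [pow_succ', pow_succ']
    change f.toAlgHom.toLinearMap ∘ₗ (A.sgn ∘ₗ (A.sgn ^ m)) = (B.sgn ∘ₗ (B.sgn ^ m)) ∘ₗ _
    rw [← LinearMap.comp_assoc, f.comp_sgn, LinearMap.comp_assoc, ih, LinearMap.comp_assoc]

end ConnCDGA

/-! ## Bicomplexes -/

/-- A vector space with a family of subspaces indexed by bidegrees and two endomorphisms. -/
structure PreBicomplex (k : Type v) [Field k] where
  carrier : Type u
  [addCommGroup : AddCommGroup carrier]
  [module : Module k carrier]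
  piece : ℕ × ℕ → Submodule k carrier
  d₁ : carrier →ₗ[k] carrier
  d₂ : carrier →ₗ[k] carrier

namespace PreBicomplex

attribute [instance] PreBicomplex.addCommGroup PreBicomplex.module

variable {k : Type v} [Field k]

/-- `X` is a bicomplex: it is the direct sum of its bidegree pieces, `d' = d₁` has bidegree `(1,0)`,
`d'' = d₂` has bidegree `(0,1)`, and `d'd' = 0`, `d''d'' = 0`, `d'd'' + d''d' = 0`. -/
structure IsBicomplex (X : PreBicomplex.{u} k) : Prop where
  isInternal : DirectSum.IsInternal X.piece
  d₁_mem : ∀ p q x, x ∈ X.piece (p, q) → X.d₁ x ∈ X.piece (p + 1, q)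
  d₂_mem : ∀ p q x, x ∈ X.piece (p, q) → X.d₂ x ∈ X.piece (p, q + 1)
  d₁_d₁ : X.d₁ ∘ₗ X.d₁ = 0
  d₂_d₂ : X.d₂ ∘ₗ X.d₂ = 0
  d₁_d₂ : X.d₁ ∘ₗ X.d₂ + X.d₂ ∘ₗ X.d₁ = 0

/-- The total differential `d = d' + d''`. -/
def d (X : PreBicomplex.{u} k) : X.carrier →ₗ[k] X.carrier := X.d₁ + X.d₂

/-- The cohomology `ker d / im d` of the total complex (the direct sum of the cohomology spaces in
all total degrees). -/
abbrev Cohomology (X : PreBicomplex.{u} k) : Type u :=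
  LinearMap.ker X.d ⧸ (LinearMap.range X.d).comap (LinearMap.ker X.d).subtype

/-- A morphism of bicomplexes: linear, of bidegree `(0,0)`, commuting with both differentials. -/
structure Hom (X Y : PreBicomplex.{u} k) where
  toLin : X.carrier →ₗ[k] Y.carrier
  map_piece : ∀ pq x, x ∈ X.piece pq → toLin x ∈ Y.piece pq
  comm₁ : ∀ x, toLin (X.d₁ x) = Y.d₁ (toLin x)
  comm₂ : ∀ x, toLin (X.d₂ x) = Y.d₂ (toLin x)

namespace Hom

variable {X Y : PreBicomplex.{u} k}

theorem comm (f : Hom X Y) (x : X.carrier) : f.toLin (X.d x) = Y.d (f.toLin x) := by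
  simp [PreBicomplex.d, f.comm₁, f.comm₂]

/-- The restriction of a morphism to the cocycles of the total complexes. -/
def onKer (f : Hom X Y) : LinearMap.ker X.d →ₗ[k] LinearMap.ker Y.d :=
  f.toLin.restrict fun x hx => by
    rw [LinearMap.mem_ker] at hx ⊢
    rw [← f.comm, hx, map_zero]

/-- The map induced on the cohomology of the total complexes. -/
def onCohomology (f : Hom X Y) : X.Cohomology →ₗ[k] Y.Cohomology :=
  Submodule.mapQ _ _ f.onKer (by
    rintro ⟨x, hx⟩ ⟨y, hy⟩
    exact ⟨f.toLin y, by rw [← f.comm, hy]; rfl⟩)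

/-- A quasi-isomorphism of bicomplexes is a morphism of bicomplexes that induces an isomorphism in
the cohomology of the total complexes. -/
def IsQuasiIso (f : Hom X Y) : Prop := Function.Bijective f.onCohomology

end Hom

end PreBicomplex

namespace SmallComplex

/-! ## Graphs

The vertices `1, …, n` are the elements of `Fin n`; the vertex `1` is `0 : Fin n`. -/

/-- The possible edges `(i,j)`, `i < j`. -/
abbrev Edge (n : ℕ) : Type := {e : Fin n × Fin n // e.1 < e.2}

/-- The source `i` of an edge `(i,j)`. -/
abbrev Edge.src {n : ℕ} (e : Edge n) : Fin n := e.1.1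

/-- The target `j` of an edge `(i,j)`. -/
abbrev Edge.tgt {n : ℕ} (e : Edge n) : Fin n := e.1.2

/-- A graph on the vertices is given by its finite set of edges. -/
abbrev Graph (n : ℕ) : Type := Finset (Edge n)

variable {n : ℕ}

/-- No two edges of `G` have the same target. -/
def NoSharedTarget (G : Graph n) : Prop :=
  ∀ e ∈ G, ∀ f ∈ G, e.tgt = f.tgt → e = f

/-- The graph `G` as an unoriented simple graph. -/
def toSimple (G : Graph n) : SimpleGraph (Fin n) :=
  SimpleGraph.fromRel fun i j => ∃ e ∈ G, e.src = i ∧ e.tgt = j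

open Classical in
/-- The smallest vertex of the connected component of `v` in `G`. -/
def minVertex (G : Graph n) (v : Fin n) : Fin n :=
  (Finset.univ.filter fun w => (toSimple G).Reachable v w).min'
    ⟨v, Finset.mem_filter.2 ⟨Finset.mem_univ _, SimpleGraph.Reachable.refl _⟩⟩

/-- The vertex `v` is the smallest vertex of its connected component in `G`. -/
def IsMinVertex (G : Graph n) (v : Fin n) : Prop := ∀ w, (toSimple G).Reachable v w → v ≤ w

/-- The set of connected components of `G`, each one represented by its smallest vertex, and
ordered by it. -/
abbrev Comp (G : Graph n) : Type := {v : Fin n // IsMinVertex G v}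

theorem minVertex_le {G : Graph n} {v w : Fin n} (h : (toSimple G).Reachable v w) :
    minVertex G v ≤ w := by
  classical
  exact Finset.min'_le _ _ (Finset.mem_filter.2 ⟨Finset.mem_univ _, h⟩)

theorem reachable_minVertex (G : Graph n) (v : Fin n) :
    (toSimple G).Reachable v (minVertex G v) := by
  classical
  exact (Finset.mem_filter.1 (Finset.min'_mem
    (Finset.univ.filter fun w => (toSimple G).Reachable v w) _)).2

theorem isMinVertex_minVertex (G : Graph n) (v : Fin n) : IsMinVertex G (minVertex G v) :=
  fun _ h => minVertex_le ((reachable_minVertex G v).trans h)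

theorem IsMinVertex.minVertex_eq {G : Graph n} {v : Fin n} (h : IsMinVertex G v) :
    minVertex G v = v :=
  le_antisymm (minVertex_le (SimpleGraph.Reachable.refl _)) (h _ (reachable_minVertex G v))

/-- In a graph without shared targets, the smallest vertices of the components are exactly the
vertices that are not the target of an edge. -/
theorem isMinVertex_iff {G : Graph n} (hG : NoSharedTarget G) (v : Fin n) :
    IsMinVertex G v ↔ ∀ e ∈ G, e.tgt ≠ v := by
  constructor
  · rintro h e he rfl
    have hadj : (toSimple G).Adj e.tgt e.src := by
      rw [toSimple, SimpleGraph.fromRel_adj]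
      exact ⟨ne_of_gt e.2, Or.inr ⟨e, he, rfl, rfl⟩⟩
    exact absurd e.2 (not_lt.2 (h _ hadj.reachable))
  · intro h
    let R : Fin n → Fin n → Prop := fun i j => ∃ e ∈ G, e.src = i ∧ e.tgt = j
    have hle : ∀ w, Relation.ReflTransGen R v w → v ≤ w := by
      intro w hw
      induction hw with
      | refl => exact le_rfl
      | tail _ hbc ih =>
        obtain ⟨e, -, rfl, rfl⟩ := hbc
        exact ih.trans e.2.le
    have hstep : ∀ a b, (toSimple G).Adj a b → Relation.ReflTransGen R v a →
        Relation.ReflTransGen R v b := by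
      intro a b hab ha
      rw [toSimple, SimpleGraph.fromRel_adj] at hab
      rcases hab.2 with hab | ⟨e, he, rfl, rfl⟩
      · exact ha.tail hab
      · rcases Relation.ReflTransGen.cases_tail ha with h0 | ⟨c, hc, f, hf, rfl, hfe⟩
        · exact absurd h0 (h e he)
        · rwa [hG e he f hf hfe.symm]
    have hwalk : ∀ a b, (toSimple G).Walk a b → Relation.ReflTransGen R v a →
        Relation.ReflTransGen R v b := by
      intro a b p
      induction p with
      | nil => exact id
      | cons hab _ ih => exact fun ha => ih (hstep _ _ hab ha)
    rintro w ⟨p⟩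
    exact hle _ (hwalk _ _ p Relation.ReflTransGen.refl)

/-- The family of the graphs without two edges with the same target, and whose component of the
first vertex consists of that vertex alone. -/
def InH [NeZero n] (G : Graph n) : Prop :=
  NoSharedTarget G ∧ ∀ e ∈ G, e.src ≠ 0 ∧ e.tgt ≠ 0

/-- The set of the graphs that index the small bicomplex. -/
abbrev GraphH (n : ℕ) [NeZero n] : Type := {G : Graph n // InH G}

/-- The sign `ε` with `e_G e_{ij} = ε e_{G ∪ {(i,j)}}`, for `(i,j)` not in `G`, where `e_G` is the
product of the edges of `G` in lexicographic order. -/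
def edgeSign (k : Type v) [Field k] (G : Graph n) (e : Edge n) : k :=
  (-1) ^ (G.filter fun f => toLex e.1 < toLex f.1).card

/-! ## Tensor products -/

section Tensor

variable {k : Type v} [Field k]
variable {ι κ : Type} [LinearOrder ι] [LinearOrder κ]
variable {M : ι → Type u} [∀ i, AddCommGroup (M i)] [∀ i, Module k (M i)]
variable {N : κ → Type u} [∀ i, AddCommGroup (N i)] [∀ i, Module k (N i)]

/-- The differential `x_1 ⊗ ⋯ ⊗ x_l ↦ ∑_u (-1)^{|x_1| + ⋯ + |x_{u-1}|} x_1 ⊗ ⋯ ⊗ d x_u ⊗ ⋯ ⊗ x_l`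
of a tensor product, where `σ` is the involution `x ↦ (-1)^{|x|} x` of the factors. -/
def tensorD [Fintype ι] (σ d : ∀ i, M i →ₗ[k] M i) : (⨂[k] i, M i) →ₗ[k] ⨂[k] i, M i :=
  ∑ u, PiTensorProduct.map fun t => if t < u then σ t else if t = u then d t else LinearMap.id

/-- `F`, a function from families of vectors to families of vectors, is separately linear: each
argument affects exactly one value, and this value depends linearly on it. -/
def SepLinear (k : Type v) [Field k] {ι κ : Type} [LinearOrder ι]
    {M : ι → Type u} [∀ i, AddCommGroup (M i)] [∀ i, Module k (M i)]
    {N : κ → Type u} [∀ i, AddCommGroup (N i)] [∀ i, Module k (N i)]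
    (F : (∀ i, M i) → ∀ w, N w) : Prop :=
  ∀ i, ∃ w₀, (∀ a z w, w ≠ w₀ → F (Function.update a i z) w = F a w) ∧
    (∀ a x y, F (Function.update a i (x + y)) w₀ =
      F (Function.update a i x) w₀ + F (Function.update a i y) w₀) ∧
    ∀ a (c : k) x, F (Function.update a i (c • x)) w₀ = c • F (Function.update a i x) w₀

theorem SepLinear.update {ι κ : Type} [LinearOrder ι] [LinearOrder κ] {M : ι → Type u}
    {N : κ → Type u} {F : (∀ i, M i) → ∀ w, N w} {i : ι} {w₀ : κ}
    (h : ∀ a z w, w ≠ w₀ → F (Function.update a i z) w = F a w) (a : ∀ i, M i) (z : M i) :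
    F (Function.update a i z) = Function.update (F a) w₀ (F (Function.update a i z) w₀) := by
  funext w
  by_cases hw : w = w₀
  · subst hw; simp
  · rw [Function.update_of_ne hw, h a z w hw]

/-- The linear map `⊗_i a_i ↦ ⊗_w F(a)_w` for a separately linear `F`. -/
def tensorLift (F : (∀ i, M i) → ∀ w, N w) (hF : SepLinear k F) :
    (⨂[k] i, M i) →ₗ[k] ⨂[k] w, N w :=
  PiTensorProduct.lift <| MultilinearMap.mk' (fun a => PiTensorProduct.tprod k (F a))
    (fun a i x y => by
      obtain ⟨w₀, h1, h2, -⟩ := hF i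
      rw [SepLinear.update h1 a (x + y), SepLinear.update h1 a x, SepLinear.update h1 a y, h2,
        MultilinearMap.map_update_add])
    (fun a i c x => by
      obtain ⟨w₀, h1, -, h3⟩ := hF i
      rw [SepLinear.update h1 a (c • x), SepLinear.update h1 a x, h3,
        MultilinearMap.map_update_smul])

@[simp] theorem tensorLift_tprod (F : (∀ i, M i) → ∀ w, N w) (hF : SepLinear k F)
    (a : ∀ i, M i) :
    tensorLift F hF (PiTensorProduct.tprod k a) = PiTensorProduct.tprod k (F a) := by
  simp [tensorLift]

end Tensor

variable {k : Type v} [Field k]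

/-! ## The small bicomplex `C(n,A)` -/

section C

variable [NeZero n] (A : ConnCDGA.{u} k)

/-- The tensor factor at the component with smallest vertex `v`: it is `A` for the component of the
first vertex, and `A⁺` for the other ones. -/
def slot (v : Fin n) : Submodule k A.carrier := if v = 0 then ⊤ else A.plus

variable {A}

theorem slot_of_ne {v : Fin n} (h : v ≠ 0) : slot A v = A.plus := if_neg h

theorem slot_mem {B : ConnCDGA.{u} k} {v : Fin n} {f : A.carrier → B.carrier}
    (hf : ∀ a ∈ A.plus, f a ∈ B.plus) {a : A.carrier} (ha : a ∈ slot A v) : f a ∈ slot B v := by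
  unfold slot at ha ⊢
  split_ifs with h
  · trivial
  · rw [if_neg h] at ha
    exact hf a ha

theorem zero_slot_mem (a : A.carrier) : a ∈ slot A (0 : Fin n) := by simp [slot]

variable (A)

/-- The involution `a ↦ (-1)^{|a|} a` of a tensor factor. -/
def slotSgn (v : Fin n) : slot A v →ₗ[k] slot A v :=
  A.sgn.restrict fun _ => slot_mem fun _ => ConnCDGA.sgn_mem_plus

/-- The internal differential of a tensor factor. -/
def slotD (v : Fin n) : slot A v →ₗ[k] slot A v :=
  A.d.restrict fun _ => slot_mem fun _ => ConnCDGA.d_mem_plus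

/-- The space `A ⊗ (A⁺)^{⊗ (l(G)-1)}`, with one factor for each component of `G`, in the order of
their smallest vertices. -/
abbrev CTensor (G : Graph n) : Type (max u v) := ⨂[k] v : Comp G, slot A v.1

instance (G : Graph n) : AddCommGroup (CTensor A G) := Module.addCommMonoidToAddCommGroup k

/-- The vector space `⨁_{G} (A ⊗ (A⁺)^{⊗ (l(G)-1)}) e_G`, where `G` has no two edges with the same
target and the first vertex of `G` is isolated. -/
abbrev CSpace (n : ℕ) [NeZero n] (A : ConnCDGA.{u} k) : Type (max u v) :=
  ⨁ G : GraphH n, CTensor A G.1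

instance : AddCommGroup (CSpace n A) := Module.addCommMonoidToAddCommGroup k

/-- The component of the first vertex. -/
def comp0 (G : Graph n) : Comp G := ⟨0, fun _ _ => Fin.zero_le _⟩

/-- The component of the vertex `i`. -/
def compOf (G : Graph n) (i : Fin n) : Comp G := ⟨minVertex G i, isMinVertex_minVertex G i⟩

theorem compOf_ne_zero {G : Graph n} (hG : InH G) {i : Fin n} (hi : i ≠ 0) :
    (compOf G i).1 ≠ 0 := by
  intro h
  have hr := reachable_minVertex G i
  change minVertex G i = 0 at h
  rw [h] at hr
  obtain ⟨p⟩ := hr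
  have key : ∀ a b, (toSimple G).Walk a b → a ≠ 0 → b ≠ 0 := by
    intro a b p
    induction p with
    | nil => exact id
    | cons hab _ ih =>
      intro _
      apply ih
      rw [toSimple, SimpleGraph.fromRel_adj] at hab
      rcases hab.2 with ⟨e, he, rfl, rfl⟩ | ⟨e, he, rfl, rfl⟩
      · exact (hG.2 e he).2
      · exact (hG.2 e he).1
  exact key _ _ p hi rfl

theorem compOf_tgt {G : Graph n} {e : Edge n} (he : e ∉ G) (hG' : InH (insert e G)) :
    (compOf G e.tgt).1 = e.tgt := by
  refine ((isMinVertex_iff (fun a ha b hb => hG'.1 a (Finset.mem_insert_of_mem ha) b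
    (Finset.mem_insert_of_mem hb)) _).2 fun f hf h => he ?_).minVertex_eq
  rwa [← hG'.1 f (Finset.mem_insert_of_mem hf) e (Finset.mem_insert_self _ _) h]

theorem compOf_src_lt {G : Graph n} {e : Edge n} (he : e ∉ G) (hG' : InH (insert e G)) :
    compOf G e.src < compOf G e.tgt := by
  change (compOf G e.src).1 < (compOf G e.tgt).1
  rw [compOf_tgt he hG']
  exact lt_of_le_of_lt (minVertex_le (SimpleGraph.Reachable.refl _)) e.2

/-- When an edge `e = (i,j)` is added to `G`, then the smallest vertices of the components of the
new graph are those of `G`, without that of the component of `j`. -/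
theorem isMinVertex_insert_iff {G : Graph n} {e : Edge n} (he : e ∉ G) (hG' : InH (insert e G))
    (v : Fin n) :
    IsMinVertex (insert e G) v ↔ IsMinVertex G v ∧ v ≠ (compOf G e.tgt).1 := by
  have hG : NoSharedTarget G := fun a ha b hb => hG'.1 a (Finset.mem_insert_of_mem ha) b
    (Finset.mem_insert_of_mem hb)
  rw [isMinVertex_iff hG'.1, isMinVertex_iff hG, compOf_tgt he hG']
  simp only [Finset.mem_insert, forall_eq_or_imp]
  exact ⟨fun h => ⟨h.2, h.1.symm⟩, fun h => ⟨h.2.symm, h.1⟩⟩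

/-- The component of `G` with the same smallest vertex as a component of `G ∪ {e}`. -/
def oldComp {G : Graph n} {e : Edge n} (he : e ∉ G) (hG' : InH (insert e G))
    (w : Comp (insert e G)) : Comp G :=
  ⟨w.1, ((isMinVertex_insert_iff he hG' w.1).1 w.2).1⟩

theorem oldComp_val {G : Graph n} {e : Edge n} (he : e ∉ G) (hG' : InH (insert e G))
    (w : Comp (insert e G)) : (oldComp he hG' w).1 = w.1 := by
  unfold oldComp
  rfl

theorem oldComp_injective {G : Graph n} {e : Edge n} (he : e ∉ G) (hG' : InH (insert e G)) :
    Function.Injective (oldComp he hG') := fun a b h => by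
  have h' := congrArg Subtype.val h
  rw [oldComp_val, oldComp_val] at h'
  exact Subtype.ext h'

theorem oldComp_ne {G : Graph n} {e : Edge n} (he : e ∉ G) (hG' : InH (insert e G))
    (w : Comp (insert e G)) : oldComp he hG' w ≠ compOf G e.tgt := fun h => by
  have h' := congrArg Subtype.val h
  rw [oldComp_val] at h'
  exact ((isMinVertex_insert_iff he hG' w.1).1 w.2).2 h'

theorem exists_oldComp {G : Graph n} {e : Edge n} (he : e ∉ G) (hG' : InH (insert e G))
    (v : Comp G) (hv : v ≠ compOf G e.tgt) : ∃ w, oldComp he hG' w = v :=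
  ⟨⟨v.1, (isMinVertex_insert_iff he hG' v.1).2 ⟨v.2, fun h => hv (Subtype.ext h)⟩⟩, rfl⟩

variable {A}

/-- For components `r < t`, the entries of `± ⋯ ⊗ a_r a_t ⊗ ⋯ \hat{a_t} ⋯`, where the part of
`a_t` in the degrees of parity `m` is moved to the left until it stands behind `a_r`. -/
def mergeEntry {G : Graph n} (a : ∀ v : Comp G, slot A v.1) (r t : Comp G) (m : Fin 2)
    (v : Comp G) : A.carrier :=
  if v = r then (a r : A.carrier) * A.par m (a t)
  else if r < v ∧ v < t then (A.sgn ^ (m : ℕ)) (a v)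
  else a v

/-- For components `1 < s < t`, where `1` denotes the first component, the entries of
`± a_1 a_s ⊗ a_2 ⊗ ⋯ ⊗ a_{s-1} ⊗ a_t ⊗ a_{s+1} ⊗ ⋯ \hat{a_t} ⋯`, where the part of `a_s` in the
degrees of parity `m` is moved to the left until it stands behind `a_1`, and the part of `a_t` in
the degrees of parity `m'` is moved to the left into the place `s`. -/
def crossEntry {G : Graph n} (a : ∀ v : Comp G, slot A v.1) (s t : Comp G) (m m' : Fin 2)
    (v : Comp G) : A.carrier :=
  if v = comp0 G then (a v : A.carrier) * A.par m (a s)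
  else if v < s then (A.sgn ^ (m : ℕ)) (a v)
  else if v = s then A.par m' (a t)
  else if v < t then (A.sgn ^ (m' : ℕ)) (a v)
  else a v

theorem mergeEntry_mem {G : Graph n} (a : ∀ v : Comp G, slot A v.1) {r t : Comp G} (ht : t.1 ≠ 0)
    (m : Fin 2) (v : Comp G) : mergeEntry a r t m v ∈ slot A v.1 := by
  unfold mergeEntry
  split_ifs with h1 h2
  · subst h1
    refine slot_mem (f := fun x => x * A.par m (a t)) (fun x hx => ?_) (a v).2
    exact ConnCDGA.mul_mem_plus hx (ConnCDGA.par_mem_plus _ (slot_of_ne (A := A) ht ▸ (a t).2))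
  · exact slot_mem (fun x hx => ConnCDGA.sgn_pow_mem_plus _ hx) (a v).2
  · exact (a v).2

theorem crossEntry_mem {G : Graph n} (a : ∀ v : Comp G, slot A v.1) {s t : Comp G} (hs : s.1 ≠ 0)
    (ht : t.1 ≠ 0) (m m' : Fin 2) (v : Comp G) : crossEntry a s t m m' v ∈ slot A v.1 := by
  unfold crossEntry
  split_ifs with h1 h2 h3 h4
  · subst h1
    exact zero_slot_mem _
  · exact slot_mem (fun x hx => ConnCDGA.sgn_pow_mem_plus _ hx) (a v).2
  · subst h3
    rw [slot_of_ne hs]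
    exact ConnCDGA.par_mem_plus _ (slot_of_ne (A := A) ht ▸ (a t).2)
  · exact slot_mem (fun x hx => ConnCDGA.sgn_pow_mem_plus _ hx) (a v).2
  · exact (a v).2

theorem sepLinear_entry {G : Graph n} {e : Edge n} (he : e ∉ G) (hG' : InH (insert e G))
    (E : (∀ v : Comp G, slot A v.1) → Comp G → A.carrier)
    (hmem : ∀ a v, E a v ∈ slot A v.1)
    (h : ∀ i, ∃ v₀, v₀ ≠ compOf G e.tgt ∧
      (∀ a z v, v ≠ compOf G e.tgt → v ≠ v₀ → E (Function.update a i z) v = E a v) ∧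
      (∀ a x y, E (Function.update a i (x + y)) v₀ =
        E (Function.update a i x) v₀ + E (Function.update a i y) v₀) ∧
      ∀ a (c : k) x, E (Function.update a i (c • x)) v₀ = c • E (Function.update a i x) v₀) :
    SepLinear k (M := fun v : Comp G => slot A v.1)
      (N := fun w : Comp (insert e G) => slot A w.1)
      (fun a w => ⟨E a (oldComp he hG' w), hmem a (oldComp he hG' w)⟩) := by
  intro i
  obtain ⟨v₀, hv, h1, h2, h3⟩ := h i
  obtain ⟨w₀, rfl⟩ := exists_oldComp he hG' v₀ hv
  refine ⟨w₀, fun a z w hw => ?_, fun a x y => ?_, fun a c x => ?_⟩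
  · exact Subtype.ext (h1 a z _ (oldComp_ne he hG' w) fun h => hw (oldComp_injective he hG' h))
  · exact Subtype.ext (h2 a x y)
  · exact Subtype.ext (h3 a c x)

theorem mergeEntry_sep {G : Graph n} {r t : Comp G} (hrt : r < t) (m : Fin 2) (i : Comp G) :
    ∃ v₀, v₀ ≠ t ∧
      (∀ (a : ∀ v : Comp G, slot A v.1) z v, v ≠ t → v ≠ v₀ →
        mergeEntry (Function.update a i z) r t m v = mergeEntry a r t m v) ∧
      (∀ (a : ∀ v : Comp G, slot A v.1) x y, mergeEntry (Function.update a i (x + y)) r t m v₀ =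
        mergeEntry (Function.update a i x) r t m v₀ +
          mergeEntry (Function.update a i y) r t m v₀) ∧
      ∀ (a : ∀ v : Comp G, slot A v.1) (c : k) x,
        mergeEntry (Function.update a i (c • x)) r t m v₀ =
          c • mergeEntry (Function.update a i x) r t m v₀ := by
  by_cases hi : i = t
  · subst hi
    refine ⟨r, hrt.ne, fun a z v hv hv' => ?_, fun a x y => ?_, fun a c x => ?_⟩
    · simp [mergeEntry, hv, hv']
    · simp [mergeEntry, hrt.ne, mul_add]
    · simp [mergeEntry, hrt.ne]
  · refine ⟨i, hi, fun a z v hv hv' => ?_, fun a x y => ?_, fun a c x => ?_⟩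
    · by_cases hv'' : v = r
      · subst hv''
        simp [mergeEntry, hv', Ne.symm hi]
      · simp [mergeEntry, hv', hv'']
    · by_cases hr : i = r
      · subst hr
        simp [mergeEntry, Ne.symm hi, add_mul]
      · simp only [mergeEntry, hr, if_false, Function.update_self]
        split_ifs <;> simp
    · by_cases hr : i = r
      · subst hr
        simp [mergeEntry, Ne.symm hi]
      · simp only [mergeEntry, hr, if_false, Function.update_self]
        split_ifs <;> simp

theorem crossEntry_sep {G : Graph n} {s t : Comp G} (hs : s.1 ≠ 0) (hst : s < t) (m m' : Fin 2)
    (i : Comp G) :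
    ∃ v₀, v₀ ≠ t ∧
      (∀ (a : ∀ v : Comp G, slot A v.1) z v, v ≠ t → v ≠ v₀ →
        crossEntry (Function.update a i z) s t m m' v = crossEntry a s t m m' v) ∧
      (∀ (a : ∀ v : Comp G, slot A v.1) x y, crossEntry (Function.update a i (x + y)) s t m m' v₀ =
        crossEntry (Function.update a i x) s t m m' v₀ +
          crossEntry (Function.update a i y) s t m m' v₀) ∧
      ∀ (a : ∀ v : Comp G, slot A v.1) (c : k) x,
        crossEntry (Function.update a i (c • x)) s t m m' v₀ =
          c • crossEntry (Function.update a i x) s t m m' v₀ := by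
  have h0s : comp0 G < s := lt_of_le_of_ne (Fin.zero_le _) fun h =>
    hs (congrArg (fun c => c.1) h).symm
  have h0t : comp0 G < t := h0s.trans hst
  by_cases his : i = s
  · subst his
    refine ⟨comp0 G, h0t.ne, fun a z v hv hv' => ?_, fun a x y => ?_, fun a c x => ?_⟩
    · by_cases hvi : v = i
      · subst hvi
        simp [crossEntry, hv', hst.ne']
      · simp [crossEntry, hv', hvi]
    · simp [crossEntry, h0s.ne, mul_add]
    · simp [crossEntry, h0s.ne]
  by_cases hit : i = t
  · subst hit
    refine ⟨s, hst.ne, fun a z v hv hv' => ?_, fun a x y => ?_, fun a c x => ?_⟩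
    · by_cases hv0 : v = comp0 G
      · subst hv0
        simp [crossEntry, h0t.ne, hst.ne]
      · simp [crossEntry, hv0, hv', hv]
    · simp [crossEntry, h0s.ne']
    · simp [crossEntry, h0s.ne']
  · refine ⟨i, hit, fun a z v hv hv' => ?_, fun a x y => ?_, fun a c x => ?_⟩
    · simp [crossEntry, hv', Ne.symm his, Ne.symm hit]
    · by_cases hi0 : i = comp0 G
      · subst hi0
        simp [crossEntry, Ne.symm his, add_mul]
      · simp only [crossEntry, hi0, his, if_false, Function.update_self]
        split_ifs <;> simp
    · by_cases hi0 : i = comp0 G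
      · subst hi0
        simp [crossEntry, Ne.symm his]
      · simp only [crossEntry, hi0, his, if_false, Function.update_self]
        split_ifs <;> simp

theorem ne_zero_of_comp_lt {G : Graph n} {r t : Comp G} (h : r < t) : t.1 ≠ 0 :=
  ((Fin.zero_le _).trans_lt (show r.1 < t.1 from h)).ne'

/-- For components `r < t` of `G`, where `t` is that of the target of `e`: the map
`a_1 ⊗ ⋯ ⊗ a_l ↦ (-1)^{|a_t| (|a_{r+1}| + ⋯ + |a_{t-1}|)} a_1 ⊗ ⋯ ⊗ a_r a_t ⊗ ⋯ \hat{a_t} ⋯ ⊗ a_l`.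
-/
def merge {G : Graph n} {e : Edge n} (he : e ∉ G) (hG' : InH (insert e G)) (r : Comp G)
    (hr : r < compOf G e.tgt) : CTensor A G →ₗ[k] CTensor A (insert e G) :=
  ∑ m : Fin 2, tensorLift
    (fun a w => ⟨mergeEntry a r (compOf G e.tgt) m (oldComp he hG' w),
      mergeEntry_mem a (ne_zero_of_comp_lt hr) m (oldComp he hG' w)⟩)
    (sepLinear_entry (A := A) he hG' (fun a => mergeEntry a r (compOf G e.tgt) m)
      (fun a => mergeEntry_mem a (ne_zero_of_comp_lt hr) m) (mergeEntry_sep hr m))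

/-- For the components `s < t` of the source and of the target of `e`: the map
`a_1 ⊗ ⋯ ⊗ a_l ↦ ε a_1 a_s ⊗ a_2 ⊗ ⋯ ⊗ a_{s-1} ⊗ a_t ⊗ a_{s+1} ⊗ ⋯ \hat{a_t} ⋯ ⊗ a_l` with
`ε = (-1)^{|a_s| (|a_2| + ⋯ + |a_{s-1}|) + |a_t| (|a_{s+1}| + ⋯ + |a_{t-1}|)}`. -/
def cross {G : Graph n} {e : Edge n} (he : e ∉ G) (hG' : InH (insert e G))
    (hs : (compOf G e.src).1 ≠ 0) : CTensor A G →ₗ[k] CTensor A (insert e G) :=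
  ∑ m : Fin 2, ∑ m' : Fin 2, tensorLift
    (fun a w => ⟨crossEntry a (compOf G e.src) (compOf G e.tgt) m m' (oldComp he hG' w),
      crossEntry_mem a hs (ne_zero_of_comp_lt (compOf_src_lt he hG')) m m' (oldComp he hG' w)⟩)
    (sepLinear_entry (A := A) he hG'
      (fun a => crossEntry a (compOf G e.src) (compOf G e.tgt) m m')
      (fun a => crossEntry_mem a hs (ne_zero_of_comp_lt (compOf_src_lt he hG')) m m')
      (crossEntry_sep hs (compOf_src_lt he hG') m m'))

theorem InH.of_insert {G : Graph n} {e : Edge n} (hG' : InH (insert e G)) : InH G :=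
  ⟨fun a ha b hb => hG'.1 a (Finset.mem_insert_of_mem ha) b (Finset.mem_insert_of_mem hb),
    fun a ha => hG'.2 a (Finset.mem_insert_of_mem ha)⟩

theorem compOf_src_ne_zero {G : Graph n} {e : Edge n} (hG' : InH (insert e G)) :
    (compOf G e.src).1 ≠ 0 :=
  compOf_ne_zero hG'.of_insert (hG'.2 e (Finset.mem_insert_self _ _)).1

theorem comp0_lt_tgt {G : Graph n} {e : Edge n} (hG' : InH (insert e G)) :
    comp0 G < compOf G e.tgt :=
  lt_of_le_of_ne (Fin.zero_le _) fun h =>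
    compOf_ne_zero hG'.of_insert (hG'.2 e (Finset.mem_insert_self _ _)).2
      (congrArg (fun c => c.1) h).symm

/-- The map `a_1 ⊗ ⋯ ⊗ a_l ↦ α_{ij}` for `e = (i,j)`: the multiplication of `a_s` by `a_t`, minus
the multiplication of `a_1` by `a_s` with `a_t` moved to the place of `a_s`, minus the
multiplication of `a_1` by `a_t`, where `s < t` are the components of `i` and `j`. -/
def alpha (A : ConnCDGA.{u} k) {G : Graph n} {e : Edge n} (he : e ∉ G)
    (hG' : InH (insert e G)) : CTensor A G →ₗ[k] CTensor A (insert e G) :=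
  merge (A := A) he hG' (compOf G e.src) (compOf_src_lt he hG')
    - cross (A := A) he hG' (compOf_src_ne_zero hG')
    - merge (A := A) he hG' (comp0 G) (comp0_lt_tgt hG')

variable (n) (A)

open Classical in
/-- The differential `d'(a e_G) = ∑_{i<j} α_{ij} e_G e_{ij}` of `C(n,A)`, where `e_G e_{ij}` is `0` if
`(i,j)` is an edge of `G` or if `G ∪ {(i,j)}` is not one of the graphs that index `C(n,A)`. -/
def cD₁ : CSpace n A →ₗ[k] CSpace n A :=
  DirectSum.toModule k (GraphH n) (CSpace n A) fun G => ∑ e : Edge n,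
    if h : e ∉ G.1 ∧ InH (insert e G.1) then
      edgeSign k G.1 e •
        (DirectSum.lof k (GraphH n) (fun G => CTensor A G.1) ⟨insert e G.1, h.2⟩ ∘ₗ
          alpha A h.1 h.2)
    else 0

open Classical in
/-- The differential `d''` of `C(n,A)` induced by the differential of `A`:
`d''(a e_G) = (-1)^{|E(G)|} (da) e_G`. -/
def cD₂ : CSpace n A →ₗ[k] CSpace n A :=
  DirectSum.toModule k (GraphH n) (CSpace n A) fun G =>
    (-1 : k) ^ G.1.card •
      (DirectSum.lof k (GraphH n) (fun G => CTensor A G.1) G ∘ₗ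
        tensorD (fun v : Comp G.1 => slotSgn A v.1) (fun v : Comp G.1 => slotD A v.1))

open Classical in
/-- The piece of bidegree `(p,q)` of `C(n,A)`: it is spanned by the `a_1 ⊗ ⋯ ⊗ a_l e_G` where `G`
has `p` edges and the `a_v` are homogeneous with `|a_1| + ⋯ + |a_l| = q`. -/
def cPiece (pq : ℕ × ℕ) : Submodule k (CSpace n A) :=
  Submodule.span k {x | ∃ (G : GraphH n) (a : ∀ v : Comp G.1, slot A v.1) (deg : Comp G.1 → ℕ),
    G.1.card = pq.1 ∧ (∀ v, (a v : A.carrier) ∈ A.deg (deg v)) ∧ ∑ v, deg v = pq.2 ∧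
    x = DirectSum.lof k (GraphH n) (fun G => CTensor A G.1) G (PiTensorProduct.tprod k a)}

/-- The small bicomplex `C(n,A)`. -/
def C : PreBicomplex.{max u v} k where
  carrier := CSpace n A
  piece := cPiece n A
  d₁ := cD₁ n A
  d₂ := cD₂ n A

variable {A}

/-- The map `C(n,A) → C(n,B)` induced by `f : A → B`, which applies `f` to all tensor factors. -/
def C.map {B : ConnCDGA.{u} k} (f : A.Hom B) : (C n A).carrier →ₗ[k] (C n B).carrier :=
  DirectSum.lmap fun G : GraphH n => PiTensorProduct.map fun v : Comp G.1 =>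
    f.toAlgHom.toLinearMap.restrict (p := slot A v.1) (q := slot B v.1)
      fun _ => slot_mem fun _ => f.mem_plus

end C

/-! ## The bicomplex `Ē(n,A)` -/

section E

variable (n : ℕ) (A : ConnCDGA.{u} k)

/-- The space `A^{⊗ n}`. -/
abbrev TPow : Type (max u v) := ⨂[k] _ : Fin n, A.carrier

/-- The exterior algebra `Λ(e_{ij})`, that is the free graded commutative algebra on generators
`e_{ij}`, `i < j`, of degree one. -/
abbrev Lam (k : Type v) [Field k] : Type v := ExteriorAlgebra k (Edge n →₀ k)

variable {n}

/-- The generator `e_{ij}` of the exterior algebra. -/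
def gen (k : Type v) [Field k] (e : Edge n) : Lam n k :=
  ExteriorAlgebra.ι k (Finsupp.single e 1)

variable {A}

/-- For `a` of degree `m`: the right multiplication by `e_i(a) = 1 ⊗ ⋯ ⊗ a ⊗ ⋯ ⊗ 1`, with `a` in
the place `i`, in the graded algebra `A^{⊗ n}`, namely
`x_1 ⊗ ⋯ ⊗ x_n ↦ (-1)^{m (|x_{i+1}| + ⋯ + |x_n|)} x_1 ⊗ ⋯ ⊗ x_i a ⊗ ⋯ ⊗ x_n`. -/
def rightMul (i : Fin n) (m : ℕ) (a : A.carrier) : TPow n A →ₗ[k] TPow n A :=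
  PiTensorProduct.map fun t =>
    if t < i then LinearMap.id else if t = i then LinearMap.mulRight k a else A.sgn ^ m

variable (n A)

/-- The ideal of `A^{⊗ n} ⊗ Λ(e_{ij})` generated by the elements `(e_i - e_j)(a) ⊗ e_{ij}`. It is
spanned by the products `x · ((e_i - e_j)(a) ⊗ e_{ij}) · ω`, `x` in `A^{⊗ n}`, `ω` in
`Λ(e_{ij})`, `a` homogeneous, since the algebra is graded commutative. -/
def relI : Submodule k (TPow n A ⊗[k] Lam n k) :=
  Submodule.span k {z | ∃ (e : Edge n) (m : ℕ) (a : A.carrier) (x : TPow n A) (w : Lam n k),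
    a ∈ A.deg m ∧ z = (rightMul e.src m a x - rightMul e.tgt m a x) ⊗ₜ[k] (gen k e * w)}

/-- The ideal of `A^{⊗ n} ⊗ Λ(e_{ij})` generated by the products `e_{ir} e_{jr}`. -/
def relJ : Submodule k (TPow n A ⊗[k] Lam n k) :=
  Submodule.span k {z | ∃ (e f : Edge n) (x : TPow n A) (w : Lam n k),
    e.tgt = f.tgt ∧ z = x ⊗ₜ[k] (gen k e * gen k f * w)}

/-- The quotient `Ē(n,A) = E(n,A) / J`, where `E(n,A)` is the quotient of `A^{⊗ n} ⊗ Λ(e_{ij})` by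
the ideal generated by the `(e_i - e_j)(a) ⊗ e_{ij}`, and `J` is the ideal of `E(n,A)` generated by
the products `e_{ir} e_{jr}`. -/
abbrev ESpace : Type (max u v) := (TPow n A ⊗[k] Lam n k) ⧸ (relI n A ⊔ relJ n A)

/-- The right multiplication by `∑_{i<j} e_{ij}` on `A^{⊗ n} ⊗ Λ(e_{ij})`. -/
def preD₁ : TPow n A ⊗[k] Lam n k →ₗ[k] TPow n A ⊗[k] Lam n k :=
  LinearMap.lTensor (TPow n A) (LinearMap.mulRight k (∑ e : Edge n, gen k e))

/-- The differential on `A^{⊗ n} ⊗ Λ(e_{ij})` induced by that of `A`: on the products `x ⊗ ω`,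
where `ω` is a product of `p` generators, it is `x ⊗ ω ↦ (-1)^p dx ⊗ ω`. -/
def preD₂ : TPow n A ⊗[k] Lam n k →ₗ[k] TPow n A ⊗[k] Lam n k :=
  TensorProduct.map (tensorD (fun _ => A.sgn) (fun _ => A.d))
    (CliffordAlgebra.involute (Q := (0 : QuadraticForm k (Edge n →₀ k)))).toLinearMap

variable {n A}

theorem involute_gen_mul (e : Edge n) (w : Lam n k) :
    CliffordAlgebra.involute (Q := (0 : QuadraticForm k (Edge n →₀ k))) (gen k e * w) =
      gen k e * -CliffordAlgebra.involute (Q := (0 : QuadraticForm k (Edge n →₀ k))) w := by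
  rw [map_mul, mul_neg, ← neg_mul]
  congr 1
  exact CliffordAlgebra.involute_ι _

/-- The Leibniz rule `d(x · e_i(a)) = dx · e_i(a) + (-1)^{|x|} x · e_i(da)`. -/
theorem tensorD_rightMul (i : Fin n) {m : ℕ} {a : A.carrier} (ha : a ∈ A.deg m) (x : TPow n A) :
    tensorD (fun _ => A.sgn) (fun _ => A.d) (rightMul i m a x) =
      rightMul i m a (tensorD (fun _ => A.sgn) (fun _ => A.d) x) +
        rightMul i (m + 1) (A.d a) (PiTensorProduct.map (fun _ => A.sgn) x) := by
  have hu : ∀ u : Fin n,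
      (PiTensorProduct.map fun t => if t < u then A.sgn else if t = u then A.d else LinearMap.id) ∘ₗ
        rightMul i m a =
      rightMul i m a ∘ₗ (PiTensorProduct.map fun t =>
        if t < u then A.sgn else if t = u then A.d else LinearMap.id) +
      if u = i then rightMul i (m + 1) (A.d a) ∘ₗ PiTensorProduct.map (fun _ => A.sgn) else 0 := by
    intro u
    rw [rightMul, rightMul, ← PiTensorProduct.map_comp, ← PiTensorProduct.map_comp,
      ← PiTensorProduct.map_comp]
    rcases lt_trichotomy u i with hui | rfl | hui
    · rw [if_neg hui.ne, add_zero]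
      congr 1
      funext t
      rcases lt_trichotomy t u with h | rfl | h
      · simp [h, h.trans hui]
      · simp [hui]
      · simp [h.not_gt, h.ne']
    · rw [if_pos rfl]
      have key : ∀ f : A.carrier →ₗ[k] A.carrier, (Function.update (fun t : Fin n =>
          if t < u then A.sgn else A.sgn ^ m) u f) =
          fun t => if t < u then A.sgn else if t = u then f else A.sgn ^ m := by
        intro f
        funext t
        by_cases h : t = u
        · subst h; simp
        · simp [h]
      have h1 := PiTensorProduct.map_update_add (R := k) (s := fun _ : Fin n => A.carrier)
        (t := fun _ : Fin n => A.carrier) (fun t : Fin n => if t < u then A.sgn else A.sgn ^ m) u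
        (LinearMap.mulRight k a ∘ₗ A.d) (LinearMap.mulRight k (A.d a) ∘ₗ A.sgn)
      rw [← ConnCDGA.d_comp_mulRight, key, key, key] at h1
      convert h1 using 2
      · congr 1
        funext t
        rcases lt_trichotomy t u with h | rfl | h
        · simp [h]
        · simp
        · simp [h.not_gt, h.ne']
      · congr 1
        funext t
        rcases lt_trichotomy t u with h | rfl | h
        · simp [h]
        · simp
        · simp [h.not_gt, h.ne']
      · congr 1
        funext t
        rcases lt_trichotomy t u with h | rfl | h
        · simp [h]
        · simp
        · simp only [h.not_gt, h.ne', if_false]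
          rw [pow_succ]
          change (A.sgn ^ m) ∘ₗ A.sgn ∘ₗ A.sgn = _
          rw [ConnCDGA.sgn_comp_sgn, LinearMap.comp_id]
    · rw [if_neg hui.ne', add_zero]
      let c : Fin n → k := fun t =>
        (if t = i then (-1 : k) ^ m else 1) * (if t = u then (-1 : k) ^ m else 1)
      have hc : ∏ t, c t = 1 := by
        simp only [c, Finset.prod_mul_distrib, Finset.prod_ite_eq', Finset.mem_univ, if_true]
        rw [← mul_pow]
        simp
      have h1 := (PiTensorProduct.mapMultilinear k (fun _ : Fin n => A.carrier)
        (fun _ : Fin n => A.carrier)).map_smul_univ c (fun t =>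
          (if t < i then LinearMap.id else if t = i then LinearMap.mulRight k a
            else A.sgn ^ m) ∘ₗ
            (if t < u then A.sgn else if t = u then A.d else LinearMap.id))
      rw [hc, one_smul] at h1
      refine Eq.trans ?_ h1
      rw [PiTensorProduct.mapMultilinear_apply]
      congr 1
      funext t
      rcases lt_trichotomy t i with h | rfl | h
      · simp [c, h, h.trans hui, h.ne, (h.trans hui).ne]
      · simp [c, hui, hui.ne, ConnCDGA.sgn_comp_mulRight ha]
      · rcases lt_trichotomy t u with h' | rfl | h'
        · simp only [c, h', h'.ne, h.not_gt, h.ne', if_true, if_false, one_mul, one_smul]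
          change A.sgn * A.sgn ^ m = A.sgn ^ m * A.sgn
          rw [← pow_succ, ← pow_succ']
        · simp [c, h.not_gt, h.ne', ConnCDGA.d_comp_sgn_pow]
        · simp [c, h.not_gt, h.ne', h'.not_gt, h'.ne']
  simp only [tensorD, LinearMap.sum_apply]
  rw [map_sum]
  have : ∀ u : Fin n, _ := fun u => LinearMap.congr_fun (hu u) x
  simp only [LinearMap.comp_apply, LinearMap.add_apply] at this
  rw [Finset.sum_congr rfl fun u _ => this u, Finset.sum_add_distrib]
  congr 1
  rw [Finset.sum_eq_single i]
  · simp
  · intro u _ hui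
    simp [hui]
  · simp

theorem preD₁_le : relI n A ⊔ relJ n A ≤ (relI n A ⊔ relJ n A).comap (preD₁ n A) := by
  refine sup_le ?_ ?_
  · refine Submodule.span_le.2 ?_
    rintro _ ⟨e, m, a, x, w, ha, rfl⟩
    refine Submodule.mem_sup_left (Submodule.subset_span
      ⟨e, m, a, x, w * ∑ e : Edge n, gen k e, ha, ?_⟩)
    simp [preD₁, mul_assoc]
  · refine Submodule.span_le.2 ?_
    rintro _ ⟨e, f, x, w, hef, rfl⟩
    refine Submodule.mem_sup_right (Submodule.subset_span
      ⟨e, f, x, w * ∑ e : Edge n, gen k e, hef, ?_⟩)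
    simp [preD₁, mul_assoc]

theorem preD₂_le : relI n A ⊔ relJ n A ≤ (relI n A ⊔ relJ n A).comap (preD₂ n A) := by
  refine sup_le ?_ ?_
  · refine Submodule.span_le.2 ?_
    rintro _ ⟨e, m, a, x, w, ha, rfl⟩
    have h : preD₂ n A ((rightMul e.src m a x - rightMul e.tgt m a x) ⊗ₜ[k] (gen k e * w)) =
        (rightMul e.src m a (tensorD (fun _ => A.sgn) (fun _ => A.d) x) -
          rightMul e.tgt m a (tensorD (fun _ => A.sgn) (fun _ => A.d) x)) ⊗ₜ[k]
            (gen k e * -CliffordAlgebra.involute (Q := (0 : QuadraticForm k (Edge n →₀ k))) w) +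
        (rightMul e.src (m + 1) (A.d a) (PiTensorProduct.map (fun _ => A.sgn) x) -
          rightMul e.tgt (m + 1) (A.d a) (PiTensorProduct.map (fun _ => A.sgn) x)) ⊗ₜ[k]
            (gen k e * -CliffordAlgebra.involute (Q := (0 : QuadraticForm k (Edge n →₀ k))) w) := by
      rw [preD₂, TensorProduct.map_tmul, map_sub, tensorD_rightMul _ ha, tensorD_rightMul _ ha,
        AlgHom.toLinearMap_apply, involute_gen_mul, ← TensorProduct.add_tmul]
      congr 1
      abel
    change preD₂ n A _ ∈ relI n A ⊔ relJ n A
    rw [h]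
    exact Submodule.mem_sup_left (add_mem (Submodule.subset_span ⟨e, m, a, _, _, ha, rfl⟩)
      (Submodule.subset_span ⟨e, m + 1, A.d a, _, _, A.d_mem _ _ ha, rfl⟩))
  · refine Submodule.span_le.2 ?_
    rintro _ ⟨e, f, x, w, hef, rfl⟩
    refine Submodule.mem_sup_right (Submodule.subset_span ⟨e, f,
      tensorD (fun _ => A.sgn) (fun _ => A.d) x,
      CliffordAlgebra.involute (Q := (0 : QuadraticForm k (Edge n →₀ k))) w, hef, ?_⟩)
    rw [preD₂, TensorProduct.map_tmul, AlgHom.toLinearMap_apply, mul_assoc, involute_gen_mul,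
      involute_gen_mul, mul_assoc, mul_neg, mul_neg, mul_neg, neg_neg]

variable (n A)

/-- The piece of bidegree `(p,q)` of `Ē(n,A)`: it is spanned by the classes of the
`x_1 ⊗ ⋯ ⊗ x_n ⊗ ω` where the `x_i` are homogeneous with `|x_1| + ⋯ + |x_n| = q`, and `ω` is in the
`p`-th exterior power. -/
def ePiece (pq : ℕ × ℕ) : Submodule k (ESpace n A) :=
  Submodule.span k {z | ∃ (x : Fin n → A.carrier) (deg : Fin n → ℕ) (w : Lam n k),
    (∀ i, x i ∈ A.deg (deg i)) ∧ ∑ i, deg i = pq.2 ∧ w ∈ ⋀[k]^(pq.1) (Edge n →₀ k) ∧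
    z = (relI n A ⊔ relJ n A).mkQ (PiTensorProduct.tprod k x ⊗ₜ[k] w)}

/-- The bicomplex `Ē(n,A)`; `d'` is the multiplication by `∑_{i<j} e_{ij}`, and `d''` is induced by
the differential of `A`. -/
def Ebar : PreBicomplex.{max u v} k where
  carrier := ESpace n A
  piece := ePiece n A
  d₁ := Submodule.mapQ _ _ (preD₁ n A) preD₁_le
  d₂ := Submodule.mapQ _ _ (preD₂ n A) preD₂_le

variable {A}

theorem map_rightMul {B : ConnCDGA.{u} k} (f : A.Hom B) (i : Fin n) (m : ℕ) (a : A.carrier)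
    (x : TPow n A) :
    PiTensorProduct.map (fun _ => f.toAlgHom.toLinearMap) (rightMul i m a x) =
      rightMul i m (f.toAlgHom a) (PiTensorProduct.map (fun _ => f.toAlgHom.toLinearMap) x) := by
  rw [rightMul, rightMul, ← LinearMap.comp_apply, ← LinearMap.comp_apply,
    ← PiTensorProduct.map_comp, ← PiTensorProduct.map_comp]
  congr 2
  funext t
  split_ifs
  · rfl
  · ext; simp
  · exact f.comp_sgn_pow m

/-- The map `Ē(n,A) → Ē(n,B)` induced by `f : A → B`. -/
def Ebar.map {B : ConnCDGA.{u} k} (f : A.Hom B) : (Ebar n A).carrier →ₗ[k] (Ebar n B).carrier :=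
  Submodule.mapQ (relI n A ⊔ relJ n A) (relI n B ⊔ relJ n B)
    (LinearMap.rTensor (Lam n k) (PiTensorProduct.map fun _ => f.toAlgHom.toLinearMap)) (by
      refine sup_le ?_ ?_
      · refine Submodule.span_le.2 ?_
        rintro _ ⟨e, m, a, x, w, ha, rfl⟩
        refine Submodule.mem_sup_left (Submodule.subset_span
          ⟨e, m, f.toAlgHom a, PiTensorProduct.map (fun _ => f.toAlgHom.toLinearMap) x, w,
            f.map_deg _ _ ha, ?_⟩)
        rw [LinearMap.rTensor_tmul, map_sub, map_rightMul, map_rightMul]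
      · refine Submodule.span_le.2 ?_
        rintro _ ⟨e, g, x, w, heg, rfl⟩
        exact Submodule.mem_sup_right (Submodule.subset_span
          ⟨e, g, PiTensorProduct.map (fun _ => f.toAlgHom.toLinearMap) x, w, heg, by simp⟩))

end E

end SmallComplex

end

noncomputable section

namespace SmallComplex

/-! ## The monomials of the exterior algebra -/

section Monomials

variable {n : ℕ} (k : Type v) [Field k]

/-! The relations of Ē(n,A) allow the factors of a tensor in front of e_G to be moved along the
edges of G, and they kill e_G if two edges have the same target. Hence Ē(n,A) is the direct sum,
over the graphs without shared targets, of tensor powers of A with one factor for each component,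
placed at its smallest vertex (its root). These summands span by `span_barMon`, `barMon_rootMap` and
`barMon_eq_zero`. They are independent because of the projections `barCoeff`, made of the
coefficient functionals of the exterior algebra (`coeff_mon`) and of `rootMap`.

The morphism `phi` sends a_1 ⊗ ⋯ ⊗ a_l e_G to e_1(a_1) ∏ δ_s(a_s) e_G, with δ_s(a) = e_{i_s}(a) -
e_1(a) and i_s the root of the component s > 1. On multiples of e_G e_{ij} the places s and t act
alike, and up to signs δ_s(a) δ_s(b) = δ_s(ab) - e_1(a) δ_s(b) - e_1(b) δ_s(a). These are the three
terms of α_{ij} (`RAction.D_par_D`, `RAction.ordMap_D_contract`, `barCoord_alpha`). The edges that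
C(n,A) leaves out contribute nothing: a second edge with the same target is killed by J, and an edge
from the vertex 1 is killed by δ_t (`phi_cD₁`).

The substitution of δ_v for e_v is a triangular automorphism `coord` of the space A^{⊗ n} that
commutes with the differential (`invCoord_coord`, `tdiff_coord`). So `phi` commutes with d'' and is
injective (`phi_injective`). Since Ē(n,A) is visibly a bicomplex, its identities descend to C(n,A)
(`PreBicomplex.IsBicomplex.of_injective`), and d'd' = 0 need not be computed from the α_{ij}.

For the cohomology, A = k ⊕ A⁺ is used at every root other than 1. For a set S of vertices, `stage A
S` admits the entry 1 at the roots in S and edges from the vertex 1 to S. It is the image of `phi`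
for S = ∅ (`range_phi`), and everything for the full set (`stage_eq_top`). When j is added to S, two
kinds of tensors are new: those with entry 1 at the root j, spanning `unitStage`, and those whose
graph contains (1,j). Multiplication by e_{1j} maps the first kind bijectively to the second, and it
is the only part of d' + d'' that creates this edge. The quotient is therefore the cone of an
isomorphism and is acyclic (`CohomologyIso.of_cone`, `cohomologyIso_stage_insert`).

Koszul signs are handled by cutting one of two factors into its even and odd parts with `par`. For a
part of given parity, the sign for passing another factor is a power of the involution `sgn` applied
to that factor, and so it is linear. The field `comm` of `RAction` records this rule, and most
computations take place in an abstract right module over A^{⊗ n}. -/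

theorem gen_mul_gen_self (e : Edge n) : gen k e * gen k e = 0 :=
  ExteriorAlgebra.ι_sq_zero _

theorem gen_mul_gen (e f : Edge n) : gen k e * gen k f = -(gen k f * gen k e) :=
  eq_neg_of_add_eq_zero_left (ExteriorAlgebra.ι_add_mul_swap _ _)

/-- All the edges, in lexicographic order. -/
def edgeList (n : ℕ) : List (Edge n) :=
  ((Finset.univ : Finset (Fin n ×ₗ Fin n)).sort (· ≤ ·)).filterMap fun p =>
    if h : (ofLex p).1 < (ofLex p).2 then some ⟨ofLex p, h⟩ else none

theorem edgeList_sorted (n : ℕ) :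
    (edgeList n).Pairwise fun e f => toLex e.1 < toLex f.1 := by
  rw [edgeList, List.pairwise_filterMap]
  refine (Finset.sortedLT_sort _).pairwise.imp fun {p q} hpq e he f hf => ?_
  simp only [Option.dite_none_right_eq_some, Option.some.injEq] at he hf
  obtain ⟨_, rfl⟩ := he
  obtain ⟨_, rfl⟩ := hf
  exact hpq

theorem mem_edgeList (e : Edge n) : e ∈ edgeList n := by
  simp only [edgeList, List.mem_filterMap, Finset.mem_sort, Finset.mem_univ, true_and]
  exact ⟨toLex e.1, by simp [e.2]⟩

/-- The product of the edges of `G` that occur in the list `l`. -/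
def listMon (G : Graph n) (l : List (Edge n)) : Lam n k :=
  (l.map fun e => if e ∈ G then gen k e else 1).prod

/-- The monomial `e_G`, the product of the edges of `G` in lexicographic order. -/
def mon (G : Graph n) : Lam n k := listMon k G (edgeList n)

theorem listMon_append (G : Graph n) (l l' : List (Edge n)) :
    listMon k G (l ++ l') = listMon k G l * listMon k G l' := by
  simp [listMon]

theorem listMon_congr {G H : Graph n} {l : List (Edge n)} (h : ∀ e ∈ l, e ∈ G ↔ e ∈ H) :
    listMon k G l = listMon k H l := by
  unfold listMon
  congr 1
  refine List.map_congr_left fun e he => ?_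
  simp [h e he]

theorem listMon_mul_gen (G : Graph n) (e : Edge n) (l : List (Edge n)) :
    listMon k G l * gen k e = (-1 : k) ^ (l.filter (· ∈ G)).length • (gen k e * listMon k G l) := by
  induction l with
  | nil => simp [listMon]
  | cons f l ih =>
    have hc : listMon k G (f :: l) = (if f ∈ G then gen k f else 1) * listMon k G l := by
      simp [listMon]
    rw [hc, mul_assoc, ih, mul_smul_comm]
    by_cases hf : f ∈ G
    · simp only [hf, if_true, List.filter_cons_of_pos, decide_true, List.length_cons, pow_succ,
        ← mul_assoc, gen_mul_gen k f e]
      simp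
    · simp [hf]

theorem exists_split_edgeList (e : Edge n) : ∃ l₁ l₂, edgeList n = l₁ ++ e :: l₂ ∧
    (∀ f ∈ l₁, toLex f.1 < toLex e.1) ∧ ∀ f, f ∈ l₂ ↔ toLex e.1 < toLex f.1 := by
  obtain ⟨l₁, l₂, h⟩ := List.append_of_mem (mem_edgeList e)
  have hs := edgeList_sorted n
  rw [h, List.pairwise_append, List.pairwise_cons] at hs
  have h1 : ∀ f ∈ l₁, toLex f.1 < toLex e.1 := fun f hf => hs.2.2 f hf e (by simp)
  refine ⟨l₁, l₂, h, h1, fun f => ⟨hs.2.1.1 f, fun hef => ?_⟩⟩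
  have hf := mem_edgeList f
  rw [h, List.mem_append, List.mem_cons] at hf
  rcases hf with hf | rfl | hf
  · exact absurd (h1 f hf) hef.not_gt
  · exact absurd hef (lt_irrefl _)
  · exact hf

/-- The new generator comes from the right and passes exactly the edges of `G` that follow `e`
lexicographically; these are the edges counted by `edgeSign`. -/
theorem mon_mul_gen {G : Graph n} {e : Edge n} (he : e ∉ G) :
    mon k G * gen k e = edgeSign k G e • mon k (insert e G) := by
  obtain ⟨l₁, l₂, h, h1, h2⟩ := exists_split_edgeList e
  have hs := edgeList_sorted n
  rw [h, List.pairwise_append, List.pairwise_cons] at hs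
  have hcons : ∀ H : Graph n, listMon k H (e :: l₂) =
      (if e ∈ H then gen k e else 1) * listMon k H l₂ := by
    intro H; simp [listMon]
  have e1 : listMon k (insert e G) l₁ = listMon k G l₁ := listMon_congr k fun f hf => by
    have : f ≠ e := by rintro rfl; exact lt_irrefl _ (h1 f hf)
    simp [this]
  have e2 : listMon k (insert e G) l₂ = listMon k G l₂ := listMon_congr k fun f hf => by
    have : f ≠ e := by rintro rfl; exact lt_irrefl _ ((h2 f).1 hf)
    simp [this]
  have hcard : (l₂.filter (· ∈ G)).length = (G.filter fun f => toLex e.1 < toLex f.1).card := by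
    have hnd : (l₂.filter (· ∈ G)).Nodup := List.Nodup.filter _ (hs.2.1.2.imp fun {a b} hab => by
      rintro rfl; exact lt_irrefl _ hab)
    rw [← List.toFinset_card_of_nodup hnd]
    congr 1
    ext f
    simp [h2, and_comm]
  rw [mon, mon, h, listMon_append, listMon_append, hcons, hcons, e1, e2, mul_assoc, if_neg he,
    one_mul, listMon_mul_gen, if_pos (Finset.mem_insert_self _ _), hcard, mul_smul_comm]
  rfl

theorem mon_mul_gen_of_mem {G : Graph n} {e : Edge n} (he : e ∈ G) : mon k G * gen k e = 0 := by
  have hG : mon k (G.erase e) * gen k e = edgeSign k (G.erase e) e • mon k G := by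
    rw [mon_mul_gen k (Finset.notMem_erase e G), Finset.insert_erase he]
  have hu : edgeSign k (G.erase e) e * edgeSign k (G.erase e) e = 1 := by
    rw [edgeSign, ← mul_pow]; simp
  have : mon k G = edgeSign k (G.erase e) e • (mon k (G.erase e) * gen k e) := by
    rw [hG, smul_smul, hu, one_smul]
  rw [this, smul_mul_assoc, mul_assoc, gen_mul_gen_self, mul_zero, smul_zero]

theorem mon_empty : mon k (∅ : Graph n) = 1 := by
  simp [mon, listMon]

theorem edgeSign_mul_self (G : Graph n) (e : Edge n) : edgeSign k G e * edgeSign k G e = 1 := by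
  rw [edgeSign, ← mul_pow]; simp

theorem mon_eq_erase_mul_gen {G : Graph n} {e : Edge n} (he : e ∈ G) :
    mon k G = edgeSign k (G.erase e) e • (mon k (G.erase e) * gen k e) := by
  rw [mon_mul_gen k (Finset.notMem_erase e G), Finset.insert_erase he, smul_smul,
    edgeSign_mul_self, one_smul]

theorem mon_mem_exteriorPower (G : Graph n) : mon k G ∈ ⋀[k]^(G.card) (Edge n →₀ k) := by
  induction G using Finset.induction_on with
  | empty =>
    rw [mon_empty, Finset.card_empty]
    exact SetLike.GradedOne.one_mem
  | insert e G he ih =>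
    rw [Finset.card_insert_of_notMem he]
    have : mon k (insert e G) = edgeSign k G e • (mon k G * gen k e) := by
      rw [mon_mul_gen k he, smul_smul, edgeSign_mul_self, one_smul]
    rw [this]
    refine Submodule.smul_mem _ _ (SetLike.mul_mem_graded ih ?_)
    have : gen k e ∈ LinearMap.range (ExteriorAlgebra.ι k (M := Edge n →₀ k)) := ⟨_, rfl⟩
    simpa using this

theorem involute_mul_gen (e : Edge n) (w : Lam n k) :
    CliffordAlgebra.involute (Q := (0 : QuadraticForm k (Edge n →₀ k))) (w * gen k e) =
      -(CliffordAlgebra.involute (Q := (0 : QuadraticForm k (Edge n →₀ k))) w * gen k e) := by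
  rw [map_mul, ← mul_neg]
  congr 1
  exact CliffordAlgebra.involute_ι _

theorem involute_mon (G : Graph n) :
    CliffordAlgebra.involute (Q := (0 : QuadraticForm k (Edge n →₀ k))) (mon k G) =
      (-1 : k) ^ G.card • mon k G := by
  induction G using Finset.induction_on with
  | empty => rw [mon_empty]; simp
  | insert e G he ih =>
    have : mon k (insert e G) = edgeSign k G e • (mon k G * gen k e) := by
      rw [mon_mul_gen k he, smul_smul, edgeSign_mul_self, one_smul]
    rw [this, map_smul, involute_mul_gen, ih, Finset.card_insert_of_notMem he, pow_succ,
      smul_mul_assoc]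
    simp [smul_comm (edgeSign k G e)]

/-- The span contains 1 and is stable under right multiplication by the generators, so it is a right
ideal containing 1. -/
theorem span_mon : Submodule.span k (Set.range (mon k (n := n))) = ⊤ := by
  set N := Submodule.span k (Set.range (mon k (n := n)))
  have hgen : ∀ w ∈ N, ∀ e : Edge n, w * gen k e ∈ N := by
    intro w hw e
    have : N ≤ N.comap (LinearMap.mulRight k (gen k e)) := by
      refine Submodule.span_le.2 ?_
      rintro _ ⟨G, rfl⟩
      change mon k G * gen k e ∈ N
      by_cases he : e ∈ G
      · rw [mon_mul_gen_of_mem k he]; exact zero_mem _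
      · rw [mon_mul_gen k he]
        exact Submodule.smul_mem _ _ (Submodule.subset_span ⟨_, rfl⟩)
    exact this hw
  have hι : ∀ (v : Edge n →₀ k), ∀ w ∈ N, w * ExteriorAlgebra.ι k v ∈ N := by
    intro v w hw
    induction v using Finsupp.induction_linear with
    | zero => simp
    | add f g hf hg => rw [map_add, mul_add]; exact add_mem hf hg
    | single e c =>
      have : (Finsupp.single e c : Edge n →₀ k) = c • Finsupp.single e 1 := by simp
      rw [this, map_smul, mul_smul_comm]
      exact Submodule.smul_mem _ _ (hgen w hw e)
  have hall : ∀ (x : Lam n k), ∀ w ∈ N, w * x ∈ N := by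
    intro x
    induction x using ExteriorAlgebra.induction with
    | algebraMap r =>
      intro w hw
      rw [← Algebra.commutes, ← Algebra.smul_def]
      exact Submodule.smul_mem _ _ hw
    | ι x => exact hι x
    | mul a b ha hb => intro w hw; rw [← mul_assoc]; exact hb _ (ha _ hw)
    | add a b ha hb => intro w hw; rw [mul_add]; exact add_mem (ha _ hw) (hb _ hw)
  refine Submodule.eq_top_iff'.2 fun x => ?_
  have h1 : (1 : Lam n k) ∈ N := mon_empty k (n := n) ▸ Submodule.subset_span ⟨∅, rfl⟩
  simpa using hall x 1 h1

/-! ### Coefficients of the monomials -/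

/-- The left multiplication by the generator `e` on the space of functions on the set of the
monomials. -/
def creation (e : Edge n) : (Graph n → k) →ₗ[k] (Graph n → k) where
  toFun f G := if e ∈ G then
    (-1) ^ (G.filter fun g => toLex g.1 < toLex e.1).card * f (G.erase e) else 0
  map_add' f g := by
    funext G
    by_cases h : e ∈ G <;> simp [h, mul_add]
  map_smul' c f := by
    funext G
    by_cases h : e ∈ G <;> simp [h, mul_left_comm]

theorem creation_apply (e : Edge n) (f : Graph n → k) (G : Graph n) :
    creation k e f G = if e ∈ G then
      (-1) ^ (G.filter fun g => toLex g.1 < toLex e.1).card * f (G.erase e) else 0 := rfl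

theorem creation_creation_self (e : Edge n) : creation k e * creation k e = 0 := by
  refine LinearMap.ext fun f => funext fun G => ?_
  simp [Module.End.mul_apply, creation_apply]

/-- Erasing the smaller edge lowers by one the number of edges before `e'`, whereas erasing `e'`
does not change the number before `e`. The two orders thus differ by one sign. -/
theorem creation_creation_of_lt {e e' : Edge n} (h : toLex e.1 < toLex e'.1) :
    creation k e * creation k e' + creation k e' * creation k e = 0 := by
  refine LinearMap.ext fun f => funext fun G => ?_
  have hne : e ≠ e' := by rintro rfl; exact lt_irrefl _ h
  simp only [Module.End.mul_apply, LinearMap.add_apply, creation_apply, Pi.add_apply,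
    Finset.mem_erase, LinearMap.zero_apply, Pi.zero_apply]
  by_cases h1 : e ∈ G
  · by_cases h2 : e' ∈ G
    · have c1 : ((G.erase e).filter fun g => toLex g.1 < toLex e'.1).card + 1 =
          (G.filter fun g => toLex g.1 < toLex e'.1).card := by
        rw [Finset.filter_erase]
        exact Finset.card_erase_add_one (Finset.mem_filter.2 ⟨h1, h⟩)
      have c2 : ((G.erase e').filter fun g => toLex g.1 < toLex e.1) =
          (G.filter fun g => toLex g.1 < toLex e.1) := by
        rw [Finset.filter_erase]
        exact Finset.erase_eq_of_notMem fun hm => (Finset.mem_filter.1 hm).2.not_gt h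
      simp only [h1, h2, hne, hne.symm, ne_eq, not_false_eq_true, and_self, if_true, c2, ← c1,
        Finset.erase_right_comm (a := e) (b := e'), pow_succ]
      ring
    · simp [h1, h2]
  · simp [h1]

theorem creation_creation (e e' : Edge n) :
    creation k e * creation k e' + creation k e' * creation k e = 0 := by
  rcases lt_trichotomy (toLex e.1) (toLex e'.1) with h | h | h
  · exact creation_creation_of_lt k h
  · have : e = e' := Subtype.ext (toLex.injective h)
    rw [this, creation_creation_self, add_zero]
  · rw [add_comm]; exact creation_creation_of_lt k h

/-- The action of the exterior algebra on the functions on the set of the monomials. -/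
def fock : Lam n k →ₐ[k] Module.End k (Graph n → k) :=
  ExteriorAlgebra.lift k ⟨Finsupp.linearCombination k (creation k), fun v => by
    rw [Finsupp.linearCombination_apply, Finsupp.sum_fintype _ _ (by simp),
      Finset.sum_mul_sum, ← Finset.sum_product']
    -- In the square of a combination of creation operators, the terms (e,e') and (e',e) cancel.
    -- Each diagonal term vanishes by itself, so characteristic two is no exception.
    refine Finset.sum_involution (fun p _ => p.swap) (fun p _ => ?_) (fun p _ hp h => hp ?_)
      (fun p _ => Finset.mem_univ _) (fun p _ => Prod.swap_swap p)
    · simp only [Prod.fst_swap, Prod.snd_swap, smul_mul_smul_comm]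
      rw [mul_comm (v p.2), ← smul_add, creation_creation, smul_zero]
    · have : p.2 = p.1 := congrArg Prod.fst h
      rw [this, smul_mul_smul_comm, creation_creation_self, smul_zero]⟩

theorem fock_gen (e : Edge n) : fock k (gen k e) = creation k e := by
  rw [fock, gen, ExteriorAlgebra.lift_ι_apply]
  simp

/-- The coefficient of the monomial `e_G`. -/
def coeff (G : Graph n) : Lam n k →ₗ[k] k :=
  LinearMap.proj G ∘ₗ LinearMap.applyₗ (Pi.single ∅ 1) ∘ₗ (fock k).toLinearMap

theorem coeff_apply (G : Graph n) (w : Lam n k) : coeff k G w = fock k w (Pi.single ∅ 1) G := rfl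

/-- A creation operator produces only monomials that contain the created edge. -/
theorem coeff_gen_mul {G : Graph n} {e : Edge n} (he : e ∉ G) (w : Lam n k) :
    coeff k G (gen k e * w) = 0 := by
  rw [coeff_apply, map_mul, fock_gen, Module.End.mul_apply, creation_apply, if_neg he]

theorem coeff_gen_mul_self {G : Graph n} {e : Edge n} (w : Lam n k) :
    coeff k G (gen k e * (gen k e * w)) = 0 := by
  rw [← mul_assoc, gen_mul_gen_self, zero_mul, map_zero]

/-- In an increasing list, every edge is created in front of all those already present, so no sign
arises. -/
theorem fock_listMon (G : Graph n) {l : List (Edge n)}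
    (hl : l.Pairwise fun e f => toLex e.1 < toLex f.1) :
    fock k (listMon k G l) (Pi.single ∅ 1) = Pi.single (l.filter (· ∈ G)).toFinset 1 := by
  induction l with
  | nil => simp [listMon]
  | cons e l ih =>
    rw [List.pairwise_cons] at hl
    have hc : listMon k G (e :: l) = (if e ∈ G then gen k e else 1) * listMon k G l := by
      simp [listMon]
    rw [hc, map_mul, Module.End.mul_apply, ih hl.2]
    by_cases he : e ∈ G
    · rw [if_pos he, fock_gen, List.filter_cons_of_pos (by simpa using he), List.toFinset_cons]
      set H := (l.filter (· ∈ G)).toFinset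
      have hH : ∀ f ∈ H, toLex e.1 < toLex f.1 := fun f hf => hl.1 f (by
        rw [List.mem_toFinset, List.mem_filter] at hf; exact hf.1)
      have heH : e ∉ H := fun h => lt_irrefl _ (hH e h)
      funext K
      rw [creation_apply]
      by_cases hK : K = insert e H
      · subst hK
        have : ((insert e H).filter fun g => toLex g.1 < toLex e.1) = ∅ := by
          refine Finset.filter_eq_empty_iff.2 fun f hf => ?_
          rcases Finset.mem_insert.1 hf with rfl | hf
          · exact lt_irrefl _
          · exact (hH f hf).not_gt
        rw [this]
        simp [heH]
      · rw [Pi.single_eq_of_ne hK]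
        split_ifs with h
        · rw [Pi.single_eq_of_ne, mul_zero]
          rintro hK'
          exact hK (by rw [← hK', Finset.insert_erase h])
        · rfl
    · rw [if_neg he, List.filter_cons_of_neg (by simpa using he)]
      simp

/-- With `span_mon`, this makes the monomials a basis, with `coeff` as the dual family. -/
theorem coeff_mon (G H : Graph n) : coeff k G (mon k H) = if G = H then 1 else 0 := by
  rw [coeff_apply, mon, fock_listMon k H (edgeList_sorted n)]
  have : ((edgeList n).filter (· ∈ H)).toFinset = H := by
    ext e; simp [mem_edgeList]
  rw [this, Pi.single_apply]

end Monomials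

end SmallComplex

/-! ### Parity, degree and augmentation projections of `A` -/

namespace ConnCDGA

variable {k : Type v} [Field k] {A : ConnCDGA.{u} k}

theorem induction_homogeneous {p : A.carrier → Prop} (hom : ∀ i a, a ∈ A.deg i → p a)
    (add : ∀ a b, p a → p b → p (a + b)) (a : A.carrier) : p a := by
  induction a using DirectSum.Decomposition.inductionOn A.deg with
  | zero => exact hom 0 0 (zero_mem _)
  | homogeneous a => exact hom _ _ a.2
  | add a b ha hb => exact add a b ha hb

theorem one_mem_deg : (1 : A.carrier) ∈ A.deg 0 := SetLike.GradedOne.one_mem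

theorem sgn_one : A.sgn 1 = 1 := by
  rw [sgn_of_mem one_mem_deg]; simp

theorem sgn_pow_one (m : ℕ) : (A.sgn ^ m) 1 = 1 := by
  induction m with
  | zero => rfl
  | succ m ih => rw [pow_succ, Module.End.mul_apply, sgn_one, ih]

theorem d_one : A.d 1 = 0 := by
  have h := A.leibniz 0 1 1 one_mem_deg
  simpa using h

theorem sgn_pow_of_mem {i : ℕ} {a : A.carrier} (ha : a ∈ A.deg i) (m : ℕ) :
    (A.sgn ^ m) a = (-1 : k) ^ (m * i) • a := by
  induction m with
  | zero => simp
  | succ m ih =>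
    rw [pow_succ', Module.End.mul_apply, ih, map_smul, sgn_of_mem ha, smul_smul]
    congr 1
    ring

theorem sgn_pow_mod_two (m : ℕ) : A.sgn ^ (m % 2) = A.sgn ^ m := by
  refine hom_ext fun i a ha => ?_
  rw [sgn_pow_of_mem ha, sgn_pow_of_mem ha]
  congr 1
  rw [pow_mul, pow_mul]
  congr 1
  exact (neg_one_pow_eq_pow_mod_two m).symm

theorem par_add_par (a : A.carrier) : A.par 0 a + A.par 1 a = a := by
  induction a using induction_homogeneous with
  | hom i a ha =>
    rw [par_of_mem ha, par_of_mem ha]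
    rcases Nat.mod_two_eq_zero_or_one i with h | h <;> simp [h]
  | add a b ha hb =>
    rw [map_add, map_add]
    nth_rewrite 3 [← ha]
    nth_rewrite 3 [← hb]
    abel

theorem par_par (b c : Fin 2) (a : A.carrier) :
    A.par b (A.par c a) = if b = c then A.par c a else 0 := by
  induction a using induction_homogeneous with
  | hom i a ha =>
    rw [par_of_mem ha]
    split_ifs with h1 h2 h2
    · subst h2; rw [par_of_mem ha, if_pos h1]
    · rw [par_of_mem ha, if_neg]; rw [h1]; exact fun h => h2 (Fin.ext h.symm)
    · simp
    · simp
  | add a b ha hb =>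
    simp only [map_add, ha, hb]
    split_ifs <;> simp

/-- The involution is multiplicative, and its power `l` is the scalar (-1)^{lm} on the part of
parity `m`. -/
theorem sgn_pow_mul_par (l : ℕ) (m : Fin 2) (y b : A.carrier) :
    (A.sgn ^ l) (y * A.par m b) = (-1 : k) ^ (l * m) • ((A.sgn ^ l) y * A.par m b) := by
  induction b using induction_homogeneous with
  | hom j b hb =>
    induction y using induction_homogeneous with
    | hom i y hy =>
      rw [par_of_mem hb]
      split_ifs with h
      · have hyb : y * b ∈ A.deg (i + j) := SetLike.mul_mem_graded hy hb
        rw [sgn_pow_of_mem hyb, sgn_pow_of_mem hy, smul_mul_assoc, smul_smul]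
        congr 1
        rw [mul_add, pow_add, mul_comm]
        congr 1
        rw [mul_comm l j, mul_comm l, pow_mul, pow_mul, ← h, ← neg_one_pow_eq_pow_mod_two]
      · simp
    | add a b ha hb => simp only [map_add, add_mul, smul_add, ha, hb]
  | add a b ha hb => simp only [map_add, mul_add, smul_add, ha, hb]

/-- Only the parity of `b` enters the sign of graded commutativity; once it is fixed, the sign is a
power of the involution on `a`, linear in both arguments. -/
theorem par_mul_comm (m : Fin 2) (a b : A.carrier) :
    A.par m b * (A.sgn ^ (m : ℕ)) a = a * A.par m b := by
  induction b using induction_homogeneous with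
  | hom j b hb =>
    induction a using induction_homogeneous with
    | hom i a ha =>
      rw [par_of_mem hb]
      split_ifs with h
      · rw [sgn_pow_of_mem ha, mul_smul_comm, A.comm j i b a hb ha, smul_smul]
        have : (-1 : k) ^ (m * i : ℕ) * (-1) ^ (j * i) = 1 := by
          rw [← h, pow_mul, pow_mul, ← neg_one_pow_eq_pow_mod_two, ← pow_mul, ← mul_pow]
          simp
        rw [this, one_smul]
      · simp
    | add a b ha hb => simp only [map_add, mul_add, add_mul, ha, hb]
  | add a b ha hb => simp only [map_add, mul_add, add_mul, ha, hb]

variable (A) in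
/-- The projection of `A` onto its component of degree `i`. -/
def projDeg (i : ℕ) : A.carrier →ₗ[k] A.carrier := GradedAlgebra.proj A.deg i

theorem projDeg_of_mem {i j : ℕ} {a : A.carrier} (ha : a ∈ A.deg j) :
    A.projDeg i a = if j = i then a else 0 := by
  rw [projDeg, GradedAlgebra.proj_apply]
  split_ifs with h
  · subst h; exact DirectSum.decompose_of_mem_same _ ha
  · exact DirectSum.decompose_of_mem_ne _ ha h

variable (A) in
/-- The projection of `A` onto the augmentation ideal. -/
def aug : A.carrier →ₗ[k] A.carrier := LinearMap.id - A.projDeg 0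

theorem aug_of_mem {i : ℕ} {a : A.carrier} (ha : a ∈ A.deg i) :
    A.aug a = if i = 0 then 0 else a := by
  rw [aug, LinearMap.sub_apply, projDeg_of_mem ha]
  split_ifs <;> simp

theorem aug_mem_plus (a : A.carrier) : A.aug a ∈ A.plus := by
  induction a using induction_homogeneous with
  | hom i a ha =>
    rw [aug_of_mem ha]
    cases i with
    | zero => simp
    | succ i => simpa using mem_plus ha
  | add a b ha hb => rw [map_add]; exact add_mem ha hb

theorem aug_of_mem_plus {a : A.carrier} (ha : a ∈ A.plus) : A.aug a = a := by
  have : A.plus ≤ LinearMap.eqLocus A.aug LinearMap.id := iSup_le fun i a ha => by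
    simp [LinearMap.mem_eqLocus, aug_of_mem ha]
  exact this ha

theorem aug_one : A.aug 1 = 0 := by
  rw [aug_of_mem one_mem_deg]; simp

/-- The assumption A^0 = k enters here. -/
theorem exists_eq_add_aug (a : A.carrier) : ∃ c : k, a = c • 1 + A.aug a := by
  have h : A.projDeg 0 a ∈ A.deg 0 := (DirectSum.decompose A.deg a 0).2
  rw [A.deg_zero, Submodule.mem_one] at h
  obtain ⟨c, hc⟩ := h
  refine ⟨c, ?_⟩
  rw [← Algebra.algebraMap_eq_smul_one, hc, aug, LinearMap.sub_apply]
  simp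

theorem aug_sgn_pow (m : ℕ) (a : A.carrier) : A.aug ((A.sgn ^ m) a) = (A.sgn ^ m) (A.aug a) := by
  induction a using induction_homogeneous with
  | hom i a ha =>
    rw [sgn_pow_of_mem ha, map_smul, aug_of_mem ha]
    split_ifs
    · simp
    · rw [sgn_pow_of_mem ha]
  | add a b ha hb => simp only [map_add, ha, hb]

theorem aug_par (m : Fin 2) (a : A.carrier) : A.aug (A.par m a) = A.par m (A.aug a) := by
  induction a using induction_homogeneous with
  | hom i a ha =>
    rw [par_of_mem ha, aug_of_mem ha]
    split_ifs with h1 h2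
    · simp [aug_of_mem ha, h2]
    · rw [aug_of_mem ha, if_neg ‹_›, par_of_mem ha, if_pos ‹_›]
    · simp
    · rw [par_of_mem ha, if_neg ‹_›, map_zero]
  | add a b ha hb => simp only [map_add, ha, hb]

/-- The differential kills the scalars and preserves A⁺. -/
theorem aug_d (a : A.carrier) : A.aug (A.d a) = A.d (A.aug a) := by
  obtain ⟨c, hc⟩ := exists_eq_add_aug a
  conv_lhs => rw [hc, map_add, map_smul, d_one, smul_zero, zero_add]
  exact aug_of_mem_plus (d_mem_plus (aug_mem_plus a))

theorem Hom.map_aug {B : ConnCDGA.{u} k} (f : Hom A B) (a : A.carrier) :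
    f.toAlgHom (A.aug a) = B.aug (f.toAlgHom a) := by
  obtain ⟨c, hc⟩ := exists_eq_add_aug a
  conv_rhs => rw [hc, map_add, map_smul, map_one, map_add, map_smul, aug_one, smul_zero, zero_add]
  exact (aug_of_mem_plus (f.mem_plus (aug_mem_plus a))).symm

end ConnCDGA

namespace SmallComplex

/-! ## Ordered products of operators -/

section OpProd

variable {k : Type v} [Field k] {n : ℕ}
variable {X Y : Type*} [AddCommGroup X] [Module k X] [AddCommGroup Y] [Module k Y]

/-- The composition of the operators `F v`, for `v` in a list; the first one is applied first. -/
def opProd : List (Fin n) → (Fin n → X →ₗ[k] X) → X →ₗ[k] X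
  | [], _ => LinearMap.id
  | v :: l, F => opProd l F ∘ₗ F v

theorem opProd_cons (v : Fin n) (l : List (Fin n)) (F : Fin n → X →ₗ[k] X) (y : X) :
    opProd (v :: l) F y = opProd l F (F v y) := rfl

theorem opProd_append (l l' : List (Fin n)) (F : Fin n → X →ₗ[k] X) (y : X) :
    opProd (l ++ l') F y = opProd l' F (opProd l F y) := by
  induction l generalizing y with
  | nil => rfl
  | cons v l ih => exact ih _

theorem opProd_congr {l : List (Fin n)} {F F' : Fin n → X →ₗ[k] X} (h : ∀ v ∈ l, F v = F' v) :
    opProd l F = opProd l F' := by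
  induction l with
  | nil => rfl
  | cons v l ih =>
    rw [opProd, opProd, h v (by simp), ih fun w hw => h w (by simp [hw])]

theorem opProd_eq_self {l : List (Fin n)} {F : Fin n → X →ₗ[k] X} {y : X}
    (h : ∀ v ∈ l, F v y = y) : opProd l F y = y := by
  induction l with
  | nil => rfl
  | cons v l ih =>
    rw [opProd_cons, h v (by simp), ih fun w hw => h w (by simp [hw])]

/-- With `F'` a sign twist of `F`, this moves an operator of fixed parity from the end of an ordered
product to its beginning. -/
theorem map_opProd {l : List (Fin n)} {F : Fin n → X →ₗ[k] X} {F' : Fin n → Y →ₗ[k] Y}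
    (T : X →ₗ[k] Y) (h : ∀ v ∈ l, ∀ y, T (F v y) = F' v (T y)) (y : X) :
    T (opProd l F y) = opProd l F' (T y) := by
  induction l generalizing y with
  | nil => rfl
  | cons v l ih =>
    rw [opProd_cons, opProd_cons, ih (fun w hw => h w (by simp [hw])), h v (by simp)]

theorem opProd_mem {l : List (Fin n)} {F : Fin n → X →ₗ[k] X} {N : Submodule k X}
    (h : ∀ v ∈ l, ∀ y ∈ N, F v y ∈ N) {y : X} (hy : y ∈ N) : opProd l F y ∈ N := by
  induction l generalizing y with
  | nil => exact hy
  | cons v l ih => exact ih (fun w hw => h w (by simp [hw])) (h v (by simp) y hy)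

/-- In a list without repetitions, exactly one factor of the composition depends on the updated
entry. -/
theorem opProd_update_add [DecidableEq (Fin n)] {l : List (Fin n)} (hl : l.Nodup) {v : Fin n}
    (hv : v ∈ l) (F : Fin n → X →ₗ[k] X) (f g : X →ₗ[k] X) :
    opProd l (Function.update F v (f + g)) =
      opProd l (Function.update F v f) + opProd l (Function.update F v g) := by
  obtain ⟨l₁, l₂, rfl⟩ := List.append_of_mem hv
  rw [List.nodup_append, List.nodup_cons] at hl
  have h1 : ∀ f, opProd l₁ (Function.update F v f) = opProd l₁ F := fun f =>
    opProd_congr fun w hw => Function.update_of_ne (fun h => hl.2.2 w hw v (by simp) h) _ _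
  have h2 : ∀ f, opProd l₂ (Function.update F v f) = opProd l₂ F := fun f =>
    opProd_congr fun w hw => Function.update_of_ne (by rintro rfl; exact hl.2.1.1 hw) _ _
  ext y
  simp only [opProd_append, opProd_cons, LinearMap.add_apply, h1, h2, Function.update_self,
    map_add]

theorem opProd_update_smul [DecidableEq (Fin n)] {l : List (Fin n)} (hl : l.Nodup) {v : Fin n}
    (hv : v ∈ l) (F : Fin n → X →ₗ[k] X) (c : k) (f : X →ₗ[k] X) :
    opProd l (Function.update F v (c • f)) = c • opProd l (Function.update F v f) := by
  obtain ⟨l₁, l₂, rfl⟩ := List.append_of_mem hv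
  rw [List.nodup_append, List.nodup_cons] at hl
  have h1 : ∀ f, opProd l₁ (Function.update F v f) = opProd l₁ F := fun f =>
    opProd_congr fun w hw => Function.update_of_ne (fun h => hl.2.2 w hw v (by simp) h) _ _
  have h2 : ∀ f, opProd l₂ (Function.update F v f) = opProd l₂ F := fun f =>
    opProd_congr fun w hw => Function.update_of_ne (by rintro rfl; exact hl.2.1.1 hw) _ _
  ext y
  simp only [opProd_append, opProd_cons, LinearMap.smul_apply, h1, h2, Function.update_self,
    map_smul]

theorem exists_split_finRange (v : Fin n) : ∃ l₁ l₂, List.finRange n = l₁ ++ v :: l₂ ∧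
    (∀ w, w ∈ l₁ ↔ w < v) ∧ ∀ w, w ∈ l₂ ↔ v < w := by
  obtain ⟨l₁, l₂, h⟩ := List.append_of_mem (List.mem_finRange v)
  have hs := List.pairwise_lt_finRange n
  rw [h, List.pairwise_append, List.pairwise_cons] at hs
  have h1 : ∀ w ∈ l₁, w < v := fun w hw => hs.2.2 w hw v (by simp)
  have h2 : ∀ w ∈ l₂, v < w := hs.2.1.1
  have hm : ∀ w, w ∈ l₁ ∨ w = v ∨ w ∈ l₂ := fun w => by
    have := List.mem_finRange w
    rwa [h, List.mem_append, List.mem_cons] at this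
  refine ⟨l₁, l₂, h, fun w => ⟨h1 w, fun hw => ?_⟩, fun w => ⟨h2 w, fun hw => ?_⟩⟩
  · rcases hm w with h | rfl | h
    · exact h
    · exact absurd hw (lt_irrefl _)
    · exact absurd hw (h2 w h).not_gt
  · rcases hm w with h | rfl | h
    · exact absurd hw (h1 w h).not_gt
    · exact absurd hw (lt_irrefl _)
    · exact h

theorem exists_split_finRange₂ {s t : Fin n} (hst : s < t) : ∃ l₁ l₂ l₃,
    List.finRange n = l₁ ++ s :: (l₂ ++ t :: l₃) ∧
    (∀ w, w ∈ l₁ → w < s) ∧ (∀ w, w ∈ l₂ → s < w ∧ w < t) ∧ ∀ w, w ∈ l₃ → t < w := by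
  obtain ⟨l₁, l, h, h1, h2⟩ := exists_split_finRange s
  obtain ⟨l₂, l₃, rfl⟩ := List.append_of_mem ((h2 t).2 hst)
  have hs := List.pairwise_lt_finRange n
  rw [h, List.pairwise_append, List.pairwise_cons, List.pairwise_append, List.pairwise_cons] at hs
  exact ⟨l₁, l₂, l₃, h, fun w hw => (h1 w).1 hw,
    fun w hw => ⟨(h2 w).1 (by simp [hw]), hs.2.1.2.2.2 w hw t (by simp)⟩,
    fun w hw => hs.2.1.2.2.1.1 w hw⟩

end OpProd

/-! ### Right multiplications by the elements e_i(a) of A^{⊗ n} -/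

section Operators

variable {k : Type v} [Field k] {n : ℕ} {A : ConnCDGA.{u} k}

/-- The linear map `x_1 ⊗ ⋯ ⊗ x_n ↦ Q_n(x_n) ⋯ Q_1(x_1)`. -/
def ordMap {X : Type*} [AddCommGroup X] [Module k X] (Q : Fin n → A.carrier →ₗ[k] X →ₗ[k] X) :
    TPow n A →ₗ[k] X →ₗ[k] X :=
  PiTensorProduct.lift <| MultilinearMap.mk'
    (fun x => opProd (List.finRange n) fun v => Q v (x v))
    (fun x v a b => by
      have h : ∀ c, (fun w => Q w (Function.update x v c w)) =
          Function.update (fun w => Q w (x w)) v (Q v c) := fun c =>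
        funext fun w => Function.apply_update (fun w => Q w) x v c w
      rw [h, h, h, map_add, opProd_update_add (List.nodup_finRange n) (List.mem_finRange v)])
    (fun x v c a => by
      have h : ∀ c, (fun w => Q w (Function.update x v c w)) =
          Function.update (fun w => Q w (x w)) v (Q v c) := fun c =>
        funext fun w => Function.apply_update (fun w => Q w) x v c w
      rw [h, h, map_smul, opProd_update_smul (List.nodup_finRange n) (List.mem_finRange v)])

theorem ordMap_tprod {X : Type*} [AddCommGroup X] [Module k X]
    (Q : Fin n → A.carrier →ₗ[k] X →ₗ[k] X) (x : Fin n → A.carrier) :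
    ordMap Q (PiTensorProduct.tprod k x) = opProd (List.finRange n) fun v => Q v (x v) := by
  simp [ordMap]

/-- The dependence of `rightMul` on the multiplier. -/
def rightMulₗ (i : Fin n) (m : ℕ) : A.carrier →ₗ[k] TPow n A →ₗ[k] TPow n A :=
  (PiTensorProduct.mapMultilinear k (fun _ : Fin n => A.carrier) (fun _ => A.carrier)).toLinearMap
    (fun t => if t < i then LinearMap.id else A.sgn ^ m) i ∘ₗ (LinearMap.mul k A.carrier).flip

theorem rightMulₗ_apply (i : Fin n) (m : ℕ) (a : A.carrier) :
    rightMulₗ i m a = rightMul i m a := by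
  simp only [rightMulₗ, rightMul, LinearMap.comp_apply, MultilinearMap.toLinearMap_apply,
    PiTensorProduct.mapMultilinear_apply]
  congr 1
  funext t
  by_cases h : t = i
  · subst h; simp; rfl
  · simp [h]

theorem rightMul_tprod (i : Fin n) (m : ℕ) (a : A.carrier) (x : Fin n → A.carrier) :
    rightMul i m a (PiTensorProduct.tprod k x) = PiTensorProduct.tprod k fun t =>
      if t < i then x t else if t = i then x t * a else (A.sgn ^ m) (x t) := by
  rw [rightMul, PiTensorProduct.map_tprod]
  congr 1
  funext t
  split_ifs <;> rfl

theorem rightMul_zero (i : Fin n) (m : ℕ) : rightMul i m (0 : A.carrier) = 0 := by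
  rw [← rightMulₗ_apply, map_zero]

/-- The right multiplication by `e_i(a)` in `A^{⊗ n}`. -/
def rmul (i : Fin n) : A.carrier →ₗ[k] TPow n A →ₗ[k] TPow n A :=
  rightMulₗ i 0 ∘ₗ A.par 0 + rightMulₗ i 1 ∘ₗ A.par 1

theorem rightMul_mod_two (i : Fin n) (m : ℕ) (a : A.carrier) :
    rightMul i (m % 2) a = rightMul i m a := by
  rw [rightMul, rightMul, ConnCDGA.sgn_pow_mod_two]

theorem rmul_of_mem (i : Fin n) {m : ℕ} {a : A.carrier} (ha : a ∈ A.deg m) :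
    rmul i a = rightMul i m a := by
  rw [← rightMul_mod_two]
  simp only [rmul, LinearMap.add_apply, LinearMap.comp_apply, ConnCDGA.par_of_mem ha]
  rcases Nat.mod_two_eq_zero_or_one m with h | h <;> simp [h, rightMulₗ_apply, rightMul_zero]

theorem rmul_par (i : Fin n) (m : Fin 2) (a : A.carrier) :
    rmul i (A.par m a) = rightMul i m (A.par m a) := by
  simp only [rmul, LinearMap.add_apply, LinearMap.comp_apply, ConnCDGA.par_par]
  fin_cases m <;> simp [rightMulₗ_apply, rightMul_zero]

theorem rmul_mul (i : Fin n) (a b : A.carrier) (x : TPow n A) :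
    rmul i (a * b) x = rmul i b (rmul i a x) := by
  induction a using ConnCDGA.induction_homogeneous with
  | hom m a ha =>
    induction b using ConnCDGA.induction_homogeneous with
    | hom l b hb =>
      have hab : a * b ∈ A.deg (m + l) := SetLike.mul_mem_graded ha hb
      rw [rmul_of_mem i ha, rmul_of_mem i hb, rmul_of_mem i hab]
      induction x using PiTensorProduct.induction_on with
      | smul_tprod r x =>
        rw [map_smul, map_smul, map_smul, rightMul_tprod, rightMul_tprod, rightMul_tprod]
        congr 2
        funext t
        rcases lt_trichotomy t i with h | rfl | h
        · simp [h]
        · simp [mul_assoc]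
        · simp only [h.not_gt, h.ne', if_false]
          rw [add_comm, pow_add, Module.End.mul_apply]
      | add x y hx hy => simp only [map_add, hx, hy]
    | add a b ha hb => simp only [map_add, mul_add, LinearMap.add_apply, ha, hb]
  | add a b ha hb => simp only [map_add, add_mul, LinearMap.add_apply, ha, hb]

theorem rmul_one (i : Fin n) : rmul i (1 : A.carrier) = LinearMap.id := by
  rw [rmul_of_mem i ConnCDGA.one_mem_deg]
  refine PiTensorProduct.ext (MultilinearMap.ext fun x => ?_)
  simp only [LinearMap.compMultilinearMap_apply, rightMul_tprod, LinearMap.id_apply]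
  congr 1
  funext t
  split_ifs <;> simp

/-- This places a Koszul sign at a single entry, so that pure tensors can be compared entry by
entry. -/
theorem tprod_smul_entry (x : Fin n → A.carrier) (i : Fin n) (c : k) :
    PiTensorProduct.tprod k (fun t => if t = i then c • x t else x t) =
      c • PiTensorProduct.tprod k x := by
  have h : (fun t => if t = i then c • x t else x t) = Function.update x i (c • x i) := by
    funext t
    by_cases h : t = i
    · subst h; simp
    · simp [h]
  rw [h, MultilinearMap.map_update_smul, Function.update_eq_self]

/-- At equal places this is graded commutativity of `A`. At different places the sign arises at the
later place, where the twist belonging to the earlier one meets the other factor; all remaining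
twists commute. -/
theorem rmul_comm (i j : Fin n) (m : Fin 2) (b c : A.carrier) (x : TPow n A) :
    rmul i (A.par m b) (rmul j c x) = rmul j ((A.sgn ^ (m : ℕ)) c) (rmul i (A.par m b) x) := by
  rcases eq_or_ne i j with rfl | hij
  · rw [← rmul_mul, ← rmul_mul, ConnCDGA.par_mul_comm]
  · induction c using ConnCDGA.induction_homogeneous with
    | hom l c hc =>
      have hp : A.par ⟨l % 2, Nat.mod_lt _ two_pos⟩ c = c := by
        rw [ConnCDGA.par_of_mem hc, if_pos rfl]
      have hsc : ∀ y, (A.sgn ^ (m : ℕ)) (y * c) =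
          (-1 : k) ^ (m * l : ℕ) • ((A.sgn ^ (m : ℕ)) y * c) := by
        intro y
        have := ConnCDGA.sgn_pow_mul_par m ⟨l % 2, Nat.mod_lt _ two_pos⟩ y c
        rw [hp] at this
        rw [this]
        congr 1
        rw [mul_comm, mul_comm (m : ℕ), pow_mul, pow_mul]
        congr 1
        exact (neg_one_pow_eq_pow_mod_two l).symm
      rw [ConnCDGA.sgn_pow_of_mem hc, map_smul, rmul_of_mem j hc, rmul_par]
      induction x using PiTensorProduct.induction_on with
      | smul_tprod r x =>
        simp only [map_smul, LinearMap.smul_apply]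
        congr 1
        rw [rightMul_tprod, rightMul_tprod, rightMul_tprod, rightMul_tprod]
        rcases lt_or_gt_of_ne hij with h | h
        -- For `i < j` the twist of the multiplication at `i` hits `c` at the entry `j`, and the
        -- scalar on the right matches it there.
        · rw [← tprod_smul_entry _ j]
          congr 1
          funext t
          rcases lt_trichotomy t j with h' | rfl | h'
          · rcases lt_trichotomy t i with h2 | rfl | h2
            · simp [h', h2, h'.ne]
            · simp [h', h'.ne]
            · simp [h', h2.not_gt, h2.ne', h'.ne]
          · simp [h.not_gt, h.ne', hsc]
          · simp only [h'.not_gt, h'.ne', (h.trans h').not_gt, (h.trans h').ne', if_false]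
            rw [← Module.End.mul_apply, ← Module.End.mul_apply, ← pow_add, ← pow_add, add_comm]
        -- For `j < i` the twist of the multiplication at `j` hits `b` at the entry `i` on the
        -- right, and the scalar cancels this sign.
        · rw [← tprod_smul_entry _ i]
          congr 1
          funext t
          rcases lt_trichotomy t i with h' | rfl | h'
          · rcases lt_trichotomy t j with h2 | rfl | h2
            · simp [h', h2, h'.ne]
            · simp [h', h'.ne]
            · simp [h', h2.not_gt, h2.ne', h'.ne]
          · simp only [h.not_gt, h.ne', lt_irrefl, if_false, if_true]
            rw [ConnCDGA.sgn_pow_mul_par, smul_smul, ← pow_add, mul_comm (m : ℕ) l,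
              Even.neg_one_pow ⟨_, rfl⟩, one_smul]
          · simp only [h'.not_gt, h'.ne', (h.trans h').not_gt, (h.trans h').ne', if_false]
            rw [← Module.End.mul_apply, ← Module.End.mul_apply, ← pow_add, ← pow_add, add_comm]
      | add x y hx hy => simp only [map_add, hx, hy]
    | add a b ha hb => simp only [map_add, LinearMap.add_apply, ha, hb]

end Operators

end SmallComplex

namespace SmallComplex

/-! ## Modules over `A^{⊗ n}` -/

section Actions

variable {k : Type v} [Field k] {n : ℕ}

/-- A right module over the graded commutative algebra `A^{⊗ n}`, given by the right
multiplications by the elements `e_v(a)`. -/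
structure RAction (n : ℕ) (A : ConnCDGA.{u} k) (X : Type*) [AddCommGroup X] [Module k X] where
  R : Fin n → A.carrier →ₗ[k] X →ₗ[k] X
  one : ∀ v, R v 1 = LinearMap.id
  mul : ∀ v a b x, R v (a * b) x = R v b (R v a x)
  comm : ∀ u v (m : Fin 2) b c x,
    R u (A.par m b) (R v c x) = R v ((A.sgn ^ (m : ℕ)) c) (R u (A.par m b) x)

variable {A : ConnCDGA.{u} k}

/-- The algebra `A^{⊗ n}` as a right module over itself. -/
def tensorAction (n : ℕ) (A : ConnCDGA.{u} k) : RAction n A (TPow n A) where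
  R := rmul
  one := rmul_one
  mul := rmul_mul
  comm := rmul_comm

variable (n A) in
/-- The unit of `A^{⊗ n}`. -/
def tone : TPow n A := PiTensorProduct.tprod k fun _ => 1

namespace RAction

variable {X : Type*} [AddCommGroup X] [Module k X] (S : RAction n A X)

/-- The restriction of a module along the endomorphism `e_v(a) ↦ e_{ρ(v)}(a)` of `A^{⊗ n}`. -/
def pullback (ρ : Fin n → Fin n) : RAction n A X where
  R v := S.R (ρ v)
  one v := S.one (ρ v)
  mul v := S.mul (ρ v)
  comm u v := S.comm (ρ u) (ρ v)

theorem eq_par (v : Fin n) (a : A.carrier) (x : X) :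
    S.R v a x = ∑ m : Fin 2, S.R v (A.par m a) x := by
  rw [Fin.sum_univ_two, ← LinearMap.add_apply, ← map_add, ConnCDGA.par_add_par]

/-- The vectors on which `e_t(a)` and `e_s(a)` act in the same way. -/
def eqR (t s : Fin n) : Submodule k X := ⨅ a, LinearMap.eqLocus (S.R t a) (S.R s a)

theorem mem_eqR {t s : Fin n} {y : X} : y ∈ S.eqR t s ↔ ∀ a, S.R t a y = S.R s a y := by
  simp [eqR]

/-- A part of given parity passes `S.R u a` with the same twist whether it acts at `t` or at `s`. -/
theorem R_mem_eqR {t s : Fin n} {y : X} (hy : y ∈ S.eqR t s) (u : Fin n) (a : A.carrier) :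
    S.R u a y ∈ S.eqR t s := by
  rw [mem_eqR] at hy ⊢
  intro b
  rw [S.eq_par t, S.eq_par s]
  refine Finset.sum_congr rfl fun m _ => ?_
  rw [S.comm, S.comm, hy]

/-- This expresses that A^{⊗ n} is free on its unit. The last factor e_u(a) moves left past the
factors with index greater than `u`, which causes the twists in `rightMul`, and merges with x_u. -/
theorem ordMap_rmul (u : Fin n) (a : A.carrier) (z : TPow n A) (y : X) :
    ordMap S.R (rmul u a z) y = S.R u a (ordMap S.R z y) := by
  rw [S.eq_par]
  conv_lhs => rw [← ConnCDGA.par_add_par a]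
  rw [Fin.sum_univ_two, map_add, LinearMap.add_apply, map_add, LinearMap.add_apply]
  have key : ∀ m : Fin 2, ordMap S.R (rmul u (A.par m a) z) y =
      S.R u (A.par m a) (ordMap S.R z y) := by
    intro m
    rw [rmul_par]
    induction z using PiTensorProduct.induction_on with
    | smul_tprod r x =>
      simp only [map_smul, LinearMap.smul_apply]
      congr 1
      rw [rightMul_tprod, ordMap_tprod, ordMap_tprod]
      obtain ⟨l₁, l₂, h, h1, h2⟩ := exists_split_finRange u
      rw [h, opProd_append, opProd_append, opProd_cons, opProd_cons]
      rw [map_opProd (F' := fun v => S.R v ((A.sgn ^ (m : ℕ)) (x v))) (S.R u (A.par m a))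
        fun v _ y => S.comm u v m a (x v) y, ← S.mul]
      rw [opProd_congr (l := l₁) (F' := fun v => S.R v (x v)) fun v hv => by
        rw [if_pos ((h1 v).1 hv)]]
      rw [opProd_congr (l := l₂) (F' := fun v => S.R v ((A.sgn ^ (m : ℕ)) (x v))) fun v hv => by
        rw [if_neg ((h2 v).1 hv).not_gt, if_neg ((h2 v).1 hv).ne']]
      simp
    | add x y hx hy => simp only [map_add, LinearMap.add_apply, hx, hy]
  rw [key, key]

theorem ordMap_tone {Q : Fin n → A.carrier →ₗ[k] X →ₗ[k] X} (hQ : ∀ v, Q v 1 = LinearMap.id)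
    (y : X) : ordMap Q (tone n A) y = y := by
  rw [tone, ordMap_tprod]
  exact opProd_eq_self fun v _ => by rw [hQ]; rfl

end RAction

/-! ### Tensors supported on an initial interval -/

variable (n A) in
/-- The span of the `x_1 ⊗ ⋯ ⊗ x_n` with `x_u = 1` for `u ≥ m`. -/
def initialTensors (m : ℕ) : Submodule k (TPow n A) :=
  Submodule.span k {z | ∃ x : Fin n → A.carrier, (∀ u : Fin n, m ≤ u → x u = 1) ∧
    z = PiTensorProduct.tprod k x}

theorem initialTensors_top : initialTensors n A n = ⊤ := by
  refine top_le_iff.1 ?_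
  rw [← PiTensorProduct.span_tprod_eq_top]
  refine Submodule.span_mono ?_
  rintro _ ⟨x, rfl⟩
  exact ⟨x, fun u hu => absurd u.2 hu.not_gt, rfl⟩

theorem initialTensors_map {m : ℕ} {f : Fin n → A.carrier →ₗ[k] A.carrier}
    (hf : ∀ u : Fin n, m ≤ u → f u 1 = 1) {z : TPow n A} (hz : z ∈ initialTensors n A m) :
    PiTensorProduct.map f z ∈ initialTensors n A m := by
  have : initialTensors n A m ≤ (initialTensors n A m).comap (PiTensorProduct.map f) := by
    refine Submodule.span_le.2 ?_
    rintro _ ⟨x, hx, rfl⟩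
    refine Submodule.subset_span ⟨fun u => f u (x u), fun u hu => ?_, PiTensorProduct.map_tprod _ _⟩
    simp only
    rw [hx u hu, hf u hu]
  exact this hz

theorem rmul_mem_initialTensors {m : ℕ} {v : Fin n} (hv : (v : ℕ) < m) (a : A.carrier)
    {z : TPow n A} (hz : z ∈ initialTensors n A m) : rmul v a z ∈ initialTensors n A m := by
  induction a using ConnCDGA.induction_homogeneous with
  | hom i a ha =>
    rw [rmul_of_mem v ha]
    refine initialTensors_map (fun u hu => ?_) hz
    have h : v < u := hv.trans_le hu
    rw [if_neg h.not_gt, if_neg h.ne', ConnCDGA.sgn_pow_one]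
  | add a b ha hb => rw [map_add]; exact add_mem ha hb

/-- The entries from `v` on are 1 and hence fixed by the involution, so `a` enters the place `v`
without any sign. -/
theorem rmul_tprod_initial {v : Fin n} (a : A.carrier) {x : Fin n → A.carrier}
    (hx : ∀ u, v ≤ u → x u = 1) :
    rmul v a (PiTensorProduct.tprod k x) = PiTensorProduct.tprod k (Function.update x v a) := by
  induction a using ConnCDGA.induction_homogeneous with
  | hom i a ha =>
    rw [rmul_of_mem v ha, rightMul_tprod]
    congr 1
    funext t
    rcases lt_trichotomy t v with h | rfl | h
    · simp [h, h.ne]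
    · simp [hx t le_rfl]
    · simp [h.not_gt, h.ne', hx t h.le, ConnCDGA.sgn_pow_one]
  | add a b ha hb => rw [map_add, LinearMap.add_apply, MultilinearMap.map_update_add, ha, hb]

/-- Linear maps on `A^{⊗ n}` agree if they do so on the unit, and this property is preserved by
the multiplication of initial tensors by the `e_v(a)`. -/
theorem eq_of_initialTensors {X : Type*} [AddCommGroup X] [Module k X] {f g : TPow n A →ₗ[k] X}
    (h1 : f (tone n A) = g (tone n A))
    (h : ∀ (v : Fin n) (a : A.carrier) z, z ∈ initialTensors n A v → f z = g z →
      f (rmul v a z) = g (rmul v a z)) : f = g := by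
  have key : ∀ m : ℕ, m ≤ n → ∀ z ∈ initialTensors n A m, f z = g z := by
    intro m
    induction m with
    | zero =>
      intro _
      have : initialTensors n A 0 ≤ LinearMap.eqLocus f g := by
        refine Submodule.span_le.2 ?_
        rintro _ ⟨x, hx, rfl⟩
        have : x = fun _ => 1 := funext fun u => hx u (Nat.zero_le _)
        subst this
        exact h1
      exact fun z hz => this hz
    | succ m ih =>
      intro hm
      have : initialTensors n A (m + 1) ≤ LinearMap.eqLocus f g := by
        refine Submodule.span_le.2 ?_
        rintro _ ⟨x, hx, rfl⟩
        have hv : ∀ u, (⟨m, hm⟩ : Fin n) ≤ u → Function.update x ⟨m, hm⟩ 1 u = 1 := by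
          intro u hu
          rcases hu.eq_or_lt with rfl | hu
          · simp
          · rw [Function.update_of_ne hu.ne']; exact hx u hu
        have hz : PiTensorProduct.tprod k (Function.update x ⟨m, hm⟩ 1) ∈ initialTensors n A m :=
          Submodule.subset_span ⟨_, hv, rfl⟩
        have := h ⟨m, hm⟩ (x ⟨m, hm⟩) _ hz (ih (Nat.le_of_succ_le hm) _ hz)
        rwa [rmul_tprod_initial _ hv, Function.update_idem, Function.update_eq_self] at this
      exact fun z hz => this hz
  refine LinearMap.ext fun z => key n le_rfl z ?_
  rw [initialTensors_top]
  trivial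

/-- The factors after `v` are identities, so `Q v` acts last. No commutation rule for `Q` is needed,
and the lemma covers both `D` and `invOp`. -/
theorem ordMap_rmul_initial {X : Type*} [AddCommGroup X] [Module k X]
    {Q : Fin n → A.carrier →ₗ[k] X →ₗ[k] X} (hQ : ∀ v, Q v 1 = LinearMap.id) {v : Fin n}
    (a : A.carrier) {z : TPow n A} (hz : z ∈ initialTensors n A v) (y : X) :
    ordMap Q (rmul v a z) y = Q v a (ordMap Q z y) := by
  have : initialTensors n A v ≤ LinearMap.eqLocus ((ordMap Q).flip y ∘ₗ rmul v a)
      (Q v a ∘ₗ (ordMap Q).flip y) := by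
    refine Submodule.span_le.2 ?_
    rintro _ ⟨x, hx, rfl⟩
    have hx' : ∀ u, v ≤ u → x u = 1 := fun u hu => hx u hu
    rw [SetLike.mem_coe, LinearMap.mem_eqLocus, LinearMap.comp_apply, LinearMap.comp_apply,
      LinearMap.flip_apply, LinearMap.flip_apply]
    rw [rmul_tprod_initial a hx', ordMap_tprod, ordMap_tprod]
    obtain ⟨l₁, l₂, h, h1, h2⟩ := exists_split_finRange v
    rw [h, opProd_append, opProd_append, opProd_cons, opProd_cons, Function.update_self,
      hx' v le_rfl, hQ]
    rw [opProd_congr (l := l₁) (F' := fun u => Q u (x u)) fun u hu => by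
      rw [Function.update_of_ne ((h1 u).1 hu).ne]]
    rw [opProd_eq_self (l := l₂) fun u hu => by
      rw [Function.update_of_ne ((h2 u).1 hu).ne', hx' u ((h2 u).1 hu).le, hQ]; rfl]
    rw [opProd_eq_self (l := l₂) fun u hu => by
      rw [hx' u ((h2 u).1 hu).le, hQ]; rfl]
    rfl
  exact this hz

theorem ordMap_mem_initialTensors {Q : Fin n → A.carrier →ₗ[k] TPow n A →ₗ[k] TPow n A}
    (hQ : ∀ v, Q v 1 = LinearMap.id) {m : ℕ}
    (h : ∀ (v : Fin n) a z, (v : ℕ) < m → z ∈ initialTensors n A m →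
      Q v a z ∈ initialTensors n A m) {z : TPow n A} (hz : z ∈ initialTensors n A m) :
    ordMap Q z (tone n A) ∈ initialTensors n A m := by
  have : initialTensors n A m ≤
      (initialTensors n A m).comap ((ordMap Q).flip (tone n A)) := by
    refine Submodule.span_le.2 ?_
    rintro _ ⟨x, hx, rfl⟩
    rw [SetLike.mem_coe, Submodule.mem_comap, LinearMap.flip_apply, ordMap_tprod]
    refine opProd_mem (fun v _ y hy => ?_) (Submodule.subset_span ⟨_, fun _ _ => rfl, rfl⟩)
    by_cases hv : (v : ℕ) < m
    · exact h v _ _ hv hy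
    · rw [hx v (not_lt.1 hv), hQ]; exact hy
  exact this hz

/-! ### Derivations of the tensor powers -/

theorem map_sgn_rmul (v : Fin n) (a : A.carrier) (z : TPow n A) :
    PiTensorProduct.map (fun _ => A.sgn) (rmul v a z) =
      rmul v (A.sgn a) (PiTensorProduct.map (fun _ => A.sgn) z) := by
  induction a using ConnCDGA.induction_homogeneous with
  | hom i a ha =>
    rw [ConnCDGA.sgn_of_mem ha, map_smul, rmul_of_mem v ha]
    induction z using PiTensorProduct.induction_on with
    | smul_tprod r x =>
      simp only [map_smul, LinearMap.smul_apply]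
      congr 1
      rw [PiTensorProduct.map_tprod, rightMul_tprod, rightMul_tprod, PiTensorProduct.map_tprod,
        ← tprod_smul_entry _ v]
      congr 1
      funext t
      rcases lt_trichotomy t v with h | rfl | h
      · simp [h, h.ne]
      · have := LinearMap.congr_fun (ConnCDGA.sgn_comp_mulRight ha) (x t)
        simpa using this
      · simp only [h.not_gt, h.ne', if_false]
        rw [← Module.End.mul_apply, ← Module.End.mul_apply, ← pow_succ, ← pow_succ']
    | add x y hx hy => simp only [map_add, hx, hy]
  | add a b ha hb => simp only [map_add, LinearMap.add_apply, ha, hb]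

variable (n A) in
/-- The differential of `A^{⊗ n}`. -/
abbrev tdiff : TPow n A →ₗ[k] TPow n A := tensorD (fun _ => A.sgn) (fun _ => A.d)

theorem tdiff_rmul (v : Fin n) (a : A.carrier) (z : TPow n A) :
    tdiff n A (rmul v a z) = rmul v a (tdiff n A z) +
      rmul v (A.d a) (PiTensorProduct.map (fun _ => A.sgn) z) := by
  induction a using ConnCDGA.induction_homogeneous with
  | hom i a ha =>
    rw [rmul_of_mem v ha, rmul_of_mem v (A.d_mem _ _ ha), tdiff, tensorD_rightMul v ha]
  | add a b ha hb =>
    simp only [map_add, LinearMap.add_apply, ha, hb]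
    abel

theorem map_sgn_tone : PiTensorProduct.map (fun _ => A.sgn) (tone n A) = tone n A := by
  rw [tone, PiTensorProduct.map_tprod]
  simp [ConnCDGA.sgn_one]

theorem tdiff_tone : tdiff n A (tone n A) = 0 := by
  rw [tdiff, tensorD, LinearMap.sum_apply]
  refine Finset.sum_eq_zero fun u _ => ?_
  rw [tone, PiTensorProduct.map_tprod]
  exact MultilinearMap.map_coord_zero _ u (by simp [ConnCDGA.d_one])

theorem map_sgn_mem_initialTensors {m : ℕ} {z : TPow n A} (hz : z ∈ initialTensors n A m) :
    PiTensorProduct.map (fun _ => A.sgn) z ∈ initialTensors n A m :=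
  initialTensors_map (fun _ _ => ConnCDGA.sgn_one) hz

theorem tdiff_mem_initialTensors {m : ℕ} {z : TPow n A} (hz : z ∈ initialTensors n A m) :
    tdiff n A z ∈ initialTensors n A m := by
  have : initialTensors n A m ≤ (initialTensors n A m).comap (tdiff n A) := by
    refine Submodule.span_le.2 ?_
    rintro _ ⟨x, hx, rfl⟩
    change tdiff n A _ ∈ initialTensors n A m
    rw [tdiff, tensorD, LinearMap.sum_apply]
    refine Submodule.sum_mem _ fun u _ => ?_
    rw [PiTensorProduct.map_tprod]
    by_cases hu : m ≤ u
    · rw [MultilinearMap.map_coord_zero _ u (by simp [hx u hu, ConnCDGA.d_one])]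
      exact zero_mem _
    · refine Submodule.subset_span ⟨_, fun w hw => ?_, rfl⟩
      have : u < w := Fin.lt_def.2 (lt_of_lt_of_le (not_le.1 hu) hw)
      simp [this.not_gt, this.ne', hx w hw]
  exact this hz

theorem tdiff_map_sgn (z : TPow n A) :
    tdiff n A (PiTensorProduct.map (fun _ => A.sgn) z) =
      -PiTensorProduct.map (fun _ => A.sgn) (tdiff n A z) := by
  have : tdiff n A ∘ₗ PiTensorProduct.map (fun _ => A.sgn) =
      -(PiTensorProduct.map (fun _ => A.sgn) ∘ₗ tdiff n A) := by
    refine eq_of_initialTensors ?_ fun v a z _ ih => ?_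
    · simp [map_sgn_tone, tdiff_tone]
    · simp only [LinearMap.comp_apply, LinearMap.neg_apply] at ih ⊢
      have hd : A.d (A.sgn a) = -A.sgn (A.d a) := by
        have := LinearMap.congr_fun (ConnCDGA.d_comp_sgn_pow (A := A) 1) a
        simpa using this
      rw [map_sgn_rmul, tdiff_rmul, tdiff_rmul, ih, map_add, map_sgn_rmul, map_sgn_rmul, hd]
      simp only [map_neg, LinearMap.neg_apply]
      abel
  exact LinearMap.congr_fun this z

/-- By induction on the multiplications that build a tensor: the two mixed terms of the Leibniz rule
cancel, since the differential anticommutes with the involution. -/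
theorem tdiff_tdiff (z : TPow n A) : tdiff n A (tdiff n A z) = 0 := by
  have : tdiff n A ∘ₗ tdiff n A = 0 := by
    refine eq_of_initialTensors ?_ fun v a z _ ih => ?_
    · simp [tdiff_tone]
    · simp only [LinearMap.comp_apply, LinearMap.zero_apply] at ih ⊢
      rw [tdiff_rmul, map_add, tdiff_rmul, tdiff_rmul, ih, A.d_d, tdiff_map_sgn]
      simp
  exact LinearMap.congr_fun this z

end Actions

/-! ## The change of coordinates -/

section Coordinates

variable {k : Type v} [Field k] {n : ℕ} [NeZero n] {A : ConnCDGA.{u} k}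

variable (A) in
/-- The projection onto `A⁺` for `v ≠ 0`, and zero for `v = 0`. -/
def augAt (v : Fin n) : A.carrier →ₗ[k] A.carrier := if v = 0 then 0 else A.aug

theorem augAt_one (v : Fin n) : augAt A v 1 = 0 := by
  unfold augAt; split_ifs
  · rfl
  · exact ConnCDGA.aug_one

theorem augAt_sgn_pow (v : Fin n) (m : ℕ) (a : A.carrier) :
    augAt A v ((A.sgn ^ m) a) = (A.sgn ^ m) (augAt A v a) := by
  unfold augAt; split_ifs
  · simp
  · exact ConnCDGA.aug_sgn_pow _ _

theorem augAt_par (v : Fin n) (m : Fin 2) (a : A.carrier) :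
    augAt A v (A.par m a) = A.par m (augAt A v a) := by
  unfold augAt; split_ifs
  · simp
  · exact ConnCDGA.aug_par _ _

theorem augAt_d (v : Fin n) (a : A.carrier) : augAt A v (A.d a) = A.d (augAt A v a) := by
  unfold augAt; split_ifs
  · simp
  · exact ConnCDGA.aug_d _

namespace RAction

variable {X : Type*} [AddCommGroup X] [Module k X] (S : RAction n A X)

/-- The multiplication by `e_v(a) - e_1(a)`, for `a` in `A⁺` and `v ≠ 1`; it is the identity for
`a = 1`. For `v = 1` it is the multiplication by `e_1(a)`. -/
def D (v : Fin n) : A.carrier →ₗ[k] X →ₗ[k] X := S.R v - S.R 0 ∘ₗ augAt A v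

theorem D_apply (v : Fin n) (a : A.carrier) (x : X) :
    S.D v a x = S.R v a x - S.R 0 (augAt A v a) x := rfl

theorem D_zero (a : A.carrier) (x : X) : S.D 0 a x = S.R 0 a x := by
  simp [D_apply, augAt]

theorem D_one (v : Fin n) : S.D v 1 = LinearMap.id := by
  ext x; simp [D_apply, augAt_one, S.one]

theorem D_of_mem_plus {v : Fin n} (hv : v ≠ 0) {a : A.carrier} (ha : a ∈ A.plus) (x : X) :
    S.D v a x = S.R v a x - S.R 0 a x := by
  rw [D_apply, augAt, if_neg hv, ConnCDGA.aug_of_mem_plus ha]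

theorem R_D_comm (u v : Fin n) (m : Fin 2) (b c : A.carrier) (x : X) :
    S.R u (A.par m b) (S.D v c x) = S.D v ((A.sgn ^ (m : ℕ)) c) (S.R u (A.par m b) x) := by
  rw [D_apply, D_apply, map_sub, S.comm, S.comm, augAt_sgn_pow]

theorem D_D_comm (u v : Fin n) (m : Fin 2) (b c : A.carrier) (x : X) :
    S.D u (A.par m b) (S.D v c x) = S.D v ((A.sgn ^ (m : ℕ)) c) (S.D u (A.par m b) x) := by
  rw [D_apply, D_apply _ u, augAt_par, R_D_comm, R_D_comm, map_sub]

/-- The product of two differences at the same place, expanded: e_1(ab) occurs with coefficient 1 on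
the left and with -1 + 1 + 1 on the right. This identity is the source of the three terms of α_{ij}.
-/
theorem D_par_D {s : Fin n} (hs : s ≠ 0) {a b : A.carrier} (ha : a ∈ A.plus) (hb : b ∈ A.plus)
    (m : Fin 2) (y : X) :
    S.D s (A.par m b) (S.D s a y) = S.D s (a * A.par m b) y - S.D s (A.par m b) (S.R 0 a y) -
      S.D s ((A.sgn ^ (m : ℕ)) a) (S.R 0 (A.par m b) y) := by
  have hb' := ConnCDGA.par_mem_plus m hb
  rw [S.D_of_mem_plus hs hb', S.D_of_mem_plus hs hb', S.D_of_mem_plus hs ha,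
    S.D_of_mem_plus hs (ConnCDGA.mul_mem_plus ha hb'),
    S.D_of_mem_plus hs (ConnCDGA.sgn_pow_mem_plus _ ha), map_sub, map_sub, S.mul, S.mul,
    S.comm 0 s m b a y, S.comm 0 0 m b a y]
  abel

theorem D_mem_eqR {t s : Fin n} {y : X} (hy : y ∈ S.eqR t s) (u : Fin n) (a : A.carrier) :
    S.D u a y ∈ S.eqR t s := by
  rw [D_apply]
  exact sub_mem (S.R_mem_eqR hy _ _) (S.R_mem_eqR hy _ _)

theorem D_eq_of_mem_eqR {t s : Fin n} (ht : t ≠ 0) (hs : s ≠ 0) {y : X} (hy : y ∈ S.eqR t s)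
    (a : A.carrier) : S.D t a y = ∑ m : Fin 2, S.D s (A.par m a) y := by
  rw [Fin.sum_univ_two, ← LinearMap.add_apply, ← map_add, ConnCDGA.par_add_par, D_apply, D_apply,
    S.mem_eqR.1 hy]
  simp [augAt, ht, hs]

/-- Applied to z ↦ z e_G, it transports the change of coordinates from A^{⊗ n} to Ē(n,A). -/
theorem map_ordMap_D {Y : Type*} [AddCommGroup Y] [Module k Y] (S' : RAction n A Y)
    (T : X →ₗ[k] Y) (hT : ∀ v a x, T (S.R v a x) = S'.R v a (T x)) (z : TPow n A) (y : X) :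
    T (ordMap S.D z y) = ordMap S'.D z (T y) := by
  induction z using PiTensorProduct.induction_on with
  | smul_tprod r x =>
    simp only [map_smul, LinearMap.smul_apply]
    rw [ordMap_tprod, ordMap_tprod]
    congr 1
    exact map_opProd T (fun v _ y => by rw [D_apply, D_apply, map_sub, hT, hT]) y
  | add x y hx hy => simp only [map_add, LinearMap.add_apply, hx, hy]

end RAction

/-! ### Contraction of two entries -/

/-- For `r < t`, the entries of `± ⋯ ⊗ x_r x_t ⊗ ⋯ ⊗ 1 ⊗ ⋯`, where the part of `x_t` in the
degrees of parity `m` is moved to the left. -/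
def mergeFun (x : Fin n → A.carrier) (r t : Fin n) (m : Fin 2) (v : Fin n) : A.carrier :=
  if v = r then x r * A.par m (x t)
  else if v = t then 1
  else if r < v ∧ v < t then (A.sgn ^ (m : ℕ)) (x v)
  else x v

/-- For `0 < s < t`, the entries of `± x_0 x_s ⊗ ⋯ ⊗ x_t ⊗ ⋯ ⊗ 1 ⊗ ⋯`, where the parts of `x_s`
and of `x_t` in the degrees of parity `m` and `m'` are moved to the left. -/
def crossFun (x : Fin n → A.carrier) (s t : Fin n) (m m' : Fin 2) (v : Fin n) : A.carrier :=
  if v = 0 then x 0 * A.par m (x s)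
  else if v = t then 1
  else if v < s then (A.sgn ^ (m : ℕ)) (x v)
  else if v = s then A.par m' (x t)
  else if v < t then (A.sgn ^ (m' : ℕ)) (x v)
  else x v

theorem exists_split_finRange₃ {s t : Fin n} (hs : s ≠ 0) (hst : s < t) : ∃ l₁ l₂ l₃,
    List.finRange n = 0 :: (l₁ ++ s :: (l₂ ++ t :: l₃)) ∧
    (∀ w, w ∈ l₁ → 0 < w ∧ w < s) ∧ (∀ w, w ∈ l₂ → s < w ∧ w < t) ∧ ∀ w, w ∈ l₃ → t < w := by
  obtain ⟨l₁, l₂, l₃, h, h1, h2, h3⟩ := exists_split_finRange₂ hst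
  obtain ⟨l₀, l₄, h', h5, h6⟩ := exists_split_finRange (0 : Fin n)
  have h0 : l₀ = [] := List.eq_nil_iff_forall_not_mem.2 fun w hw =>
    absurd ((h5 w).1 hw) (Fin.not_lt_zero w)
  subst h0
  rw [List.nil_append] at h'
  have hc := h'.symm.trans h
  rcases l₁ with _ | ⟨a, l₁⟩
  · simp only [List.nil_append, List.cons.injEq] at hc
    exact absurd hc.1.symm hs
  · simp only [List.cons_append, List.cons.injEq] at hc
    obtain ⟨rfl, hc⟩ := hc
    refine ⟨l₁, l₂, l₃, by rw [h', hc], fun w hw => ⟨(h6 w).1 ?_, h1 w (by simp [hw])⟩, h2, h3⟩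
    rw [hc]; simp [hw]

namespace RAction

variable {X : Type*} [AddCommGroup X] [Module k X] (S : RAction n A X)

/-- Since e_t and e_s agree on everything generated by `y`, the factor at `t` can be read at `s`; it
is moved next to the factor at `s`, and their product is expanded by `D_par_D`. The sums over
parities encode the Koszul signs of these moves. -/
theorem ordMap_D_contract {s t : Fin n} (hs : s ≠ 0) (hst : s < t) {y : X} (hy : y ∈ S.eqR t s)
    {x : Fin n → A.carrier} (hxs : x s ∈ A.plus) (hxt : x t ∈ A.plus) :
    ordMap S.D (PiTensorProduct.tprod k x) y =
      ∑ m : Fin 2, ordMap S.D (PiTensorProduct.tprod k (mergeFun x s t m)) y -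
      ∑ m : Fin 2, ∑ m' : Fin 2, ordMap S.D (PiTensorProduct.tprod k (crossFun x s t m m')) y -
      ∑ m : Fin 2, ordMap S.D (PiTensorProduct.tprod k (mergeFun x 0 t m)) y := by
  obtain ⟨l₁, l₂, l₃, h, h1, h2, h3⟩ := exists_split_finRange₃ hs hst
  have h0s : 0 < s := lt_of_le_of_ne (Fin.zero_le _) hs.symm
  have ht : t ≠ 0 := (h0s.trans hst).ne'
  have split : ∀ x : Fin n → A.carrier, ordMap S.D (PiTensorProduct.tprod k x) y =
      opProd l₃ (fun v => S.D v (x v)) (S.D t (x t) (opProd l₂ (fun v => S.D v (x v))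
        (S.D s (x s) (opProd l₁ (fun v => S.D v (x v)) (S.R 0 (x 0) y))))) := by
    intro x
    rw [ordMap_tprod, h, opProd_cons, opProd_append, opProd_cons, opProd_append, opProd_cons,
      S.D_zero]
  set z := opProd l₁ (fun v => S.D v (x v)) (S.R 0 (x 0) y) with hz
  have hzm : S.D s (x s) z ∈ S.eqR t s :=
    S.D_mem_eqR (opProd_mem (fun v _ y hy => S.D_mem_eqR hy _ _) (S.R_mem_eqR hy _ _)) _ _
  have hzm' : opProd l₂ (fun v => S.D v (x v)) (S.D s (x s) z) ∈ S.eqR t s :=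
    opProd_mem (fun v _ y hy => S.D_mem_eqR hy _ _) hzm
  -- A factor at the first vertex goes to the front, twisting what lies between, and merges with
  -- x_1.
  have move : ∀ (m : Fin 2) (b : A.carrier), S.R 0 (A.par m b) z =
      opProd l₁ (fun v => S.D v ((A.sgn ^ (m : ℕ)) (x v))) (S.R 0 (x 0 * A.par m b) y) := by
    intro m b
    rw [hz, map_opProd (F' := fun v => S.D v ((A.sgn ^ (m : ℕ)) (x v))) _
      fun v _ y => S.R_D_comm 0 v m b (x v) y, S.mul]
  have merge1 : ∀ m : Fin 2, ordMap S.D (PiTensorProduct.tprod k (mergeFun x s t m)) y =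
      opProd l₃ (fun v => S.D v (x v)) (opProd l₂ (fun v => S.D v ((A.sgn ^ (m : ℕ)) (x v)))
        (S.D s (x s * A.par m (x t)) z)) := by
    intro m
    have e0 : mergeFun x s t m 0 = x 0 := by simp [mergeFun, hs.symm, ht.symm]
    have es : mergeFun x s t m s = x s * A.par m (x t) := by simp [mergeFun]
    have et : mergeFun x s t m t = 1 := by simp [mergeFun, hst.ne']
    rw [split, e0, es, et, S.D_one, LinearMap.id_apply,
      opProd_congr (l := l₁) (F' := fun v => S.D v (x v)) fun v hv => by
        simp [mergeFun, (h1 v hv).2.ne, ((h1 v hv).2.trans hst).ne, (h1 v hv).2.not_gt],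
      opProd_congr (l := l₂) (F' := fun v => S.D v ((A.sgn ^ (m : ℕ)) (x v))) fun v hv => by
        simp [mergeFun, (h2 v hv).1.ne', (h2 v hv).2.ne, (h2 v hv).1, (h2 v hv).2],
      opProd_congr (l := l₃) (F' := fun v => S.D v (x v)) fun v hv => by
        simp [mergeFun, (hst.trans (h3 v hv)).ne', (h3 v hv).ne', (h3 v hv).not_gt]]
  have merge0 : ∀ m : Fin 2, ordMap S.D (PiTensorProduct.tprod k (mergeFun x 0 t m)) y =
      opProd l₃ (fun v => S.D v (x v)) (opProd l₂ (fun v => S.D v ((A.sgn ^ (m : ℕ)) (x v)))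
        (S.D s ((A.sgn ^ (m : ℕ)) (x s)) (S.R 0 (A.par m (x t)) z))) := by
    intro m
    have e0 : mergeFun x 0 t m 0 = x 0 * A.par m (x t) := by simp [mergeFun]
    have es : mergeFun x 0 t m s = (A.sgn ^ (m : ℕ)) (x s) := by
      simp [mergeFun, hs, hst, hst.ne, h0s]
    have et : mergeFun x 0 t m t = 1 := by simp [mergeFun, ht]
    rw [split, e0, es, et, S.D_one, LinearMap.id_apply, move,
      opProd_congr (l := l₁) (F' := fun v => S.D v ((A.sgn ^ (m : ℕ)) (x v))) fun v hv => by
        simp [mergeFun, (h1 v hv).1.ne', ((h1 v hv).2.trans hst).ne, (h1 v hv).1,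
          (h1 v hv).2.trans hst],
      opProd_congr (l := l₂) (F' := fun v => S.D v ((A.sgn ^ (m : ℕ)) (x v))) fun v hv => by
        simp [mergeFun, (h0s.trans (h2 v hv).1).ne', (h2 v hv).2.ne, h0s.trans (h2 v hv).1,
          (h2 v hv).2],
      opProd_congr (l := l₃) (F' := fun v => S.D v (x v)) fun v hv => by
        simp [mergeFun, (h0s.trans (hst.trans (h3 v hv))).ne', (h3 v hv).ne', (h3 v hv).not_gt]]
  have cross : ∀ m m' : Fin 2, ordMap S.D (PiTensorProduct.tprod k (crossFun x s t m m')) y =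
      opProd l₃ (fun v => S.D v (x v)) (opProd l₂ (fun v => S.D v ((A.sgn ^ (m' : ℕ)) (x v)))
        (S.D s (A.par m' (x t)) (S.R 0 (A.par m (x s)) z))) := by
    intro m m'
    have e0 : crossFun x s t m m' 0 = x 0 * A.par m (x s) := by simp [crossFun]
    have es : crossFun x s t m m' s = A.par m' (x t) := by
      simp [crossFun, hs, hst.ne]
    have et : crossFun x s t m m' t = 1 := by simp [crossFun, ht]
    rw [split, e0, es, et, S.D_one, LinearMap.id_apply, move,
      opProd_congr (l := l₁) (F' := fun v => S.D v ((A.sgn ^ (m : ℕ)) (x v))) fun v hv => by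
        simp [crossFun, (h1 v hv).1.ne', ((h1 v hv).2.trans hst).ne, (h1 v hv).2],
      opProd_congr (l := l₂) (F' := fun v => S.D v ((A.sgn ^ (m' : ℕ)) (x v))) fun v hv => by
        simp [crossFun, (h0s.trans (h2 v hv).1).ne', (h2 v hv).2.ne, (h2 v hv).1.ne',
          (h2 v hv).1.not_gt, (h2 v hv).2],
      opProd_congr (l := l₃) (F' := fun v => S.D v (x v)) fun v hv => by
        simp [crossFun, (h0s.trans (hst.trans (h3 v hv))).ne', (h3 v hv).ne', (h3 v hv).not_gt,
          (hst.trans (h3 v hv)).ne', (hst.trans (h3 v hv)).not_gt]]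
  -- The factor at `t` is read at `s` and cut into its parities, before it is moved over `l₂`.
  rw [split, S.D_eq_of_mem_eqR ht hs hzm', map_sum]
  simp only [merge1, merge0, cross]
  -- In the mixed term the parity of `x t` becomes the outer index, as in the other two sums.
  rw [Finset.sum_comm, ← Finset.sum_sub_distrib, ← Finset.sum_sub_distrib]
  refine Finset.sum_congr rfl fun m _ => ?_
  rw [map_opProd (F' := fun v => S.D v ((A.sgn ^ (m : ℕ)) (x v))) _
      fun v _ y => S.D_D_comm s v m (x t) (x v) y, S.D_par_D hs hxs hxt, map_sub, map_sub, map_sub,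
    map_sub, S.eq_par 0 (x s), map_sum, map_sum, map_sum]

/-- With no factor at `s` there is nothing to expand: the factor at `t` just moves to the empty
place. This case does not occur for C(n,A), only in the filtration of Ē(n,A). -/
theorem ordMap_D_contract_one {s t : Fin n} (hs : s ≠ 0) (hst : s < t) {y : X}
    (hy : y ∈ S.eqR t s) {x : Fin n → A.carrier} (hxs : x s = 1) :
    ordMap S.D (PiTensorProduct.tprod k x) y =
      ∑ m : Fin 2, ordMap S.D (PiTensorProduct.tprod k (mergeFun x s t m)) y := by
  obtain ⟨l₁, l₂, l₃, h, h1, h2, h3⟩ := exists_split_finRange₂ hst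
  have ht : t ≠ 0 := (lt_of_le_of_lt (Fin.zero_le s) hst).ne'
  have split : ∀ x : Fin n → A.carrier, ordMap S.D (PiTensorProduct.tprod k x) y =
      opProd l₃ (fun v => S.D v (x v)) (S.D t (x t) (opProd l₂ (fun v => S.D v (x v))
        (S.D s (x s) (opProd l₁ (fun v => S.D v (x v)) y)))) := by
    intro x
    rw [ordMap_tprod, h, opProd_append, opProd_cons, opProd_append, opProd_cons]
  set z := opProd l₁ (fun v => S.D v (x v)) y with hz
  have hzm : z ∈ S.eqR t s := opProd_mem (fun v _ y hy => S.D_mem_eqR hy _ _) hy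
  have hzm' : opProd l₂ (fun v => S.D v (x v)) z ∈ S.eqR t s :=
    opProd_mem (fun v _ y hy => S.D_mem_eqR hy _ _) hzm
  rw [split, hxs, S.D_one, LinearMap.id_apply, S.D_eq_of_mem_eqR ht hs hzm', map_sum]
  refine Finset.sum_congr rfl fun m _ => ?_
  have es : mergeFun x s t m s = A.par m (x t) := by simp [mergeFun, hxs]
  have et : mergeFun x s t m t = 1 := by simp [mergeFun, hst.ne']
  rw [split, es, et, S.D_one, LinearMap.id_apply,
    opProd_congr (l := l₁) (F' := fun v => S.D v (x v)) fun v hv => by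
      simp [mergeFun, (h1 v hv).ne, ((h1 v hv).trans hst).ne, (h1 v hv).not_gt],
    opProd_congr (l := l₂) (F := fun v => S.D v (mergeFun x s t m v))
      (F' := fun v => S.D v ((A.sgn ^ (m : ℕ)) (x v))) fun v hv => by
      simp [mergeFun, (h2 v hv).1.ne', (h2 v hv).2.ne, (h2 v hv).1, (h2 v hv).2],
    opProd_congr (l := l₃) (F := fun v => S.D v (mergeFun x s t m v))
      (F' := fun v => S.D v (x v)) fun v hv => by
      simp [mergeFun, (hst.trans (h3 v hv)).ne', (h3 v hv).ne', (h3 v hv).not_gt],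
    map_opProd (F' := fun v => S.D v ((A.sgn ^ (m : ℕ)) (x v))) _
      fun v _ y => S.D_D_comm s v m (x t) (x v) y, hz]

/-- The factor at `t` is a difference of two multiplications that agree here. -/
theorem ordMap_D_eq_zero {t : Fin n} (ht : t ≠ 0) {y : X} (hy : y ∈ S.eqR t 0)
    {x : Fin n → A.carrier} (hxt : x t ∈ A.plus) :
    ordMap S.D (PiTensorProduct.tprod k x) y = 0 := by
  obtain ⟨l₁, l₂, h, h1, h2⟩ := exists_split_finRange t
  have hz : opProd l₁ (fun v => S.D v (x v)) y ∈ S.eqR t 0 :=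
    opProd_mem (fun v _ y hy => S.D_mem_eqR hy _ _) hy
  rw [ordMap_tprod, h, opProd_append, opProd_cons, S.D_of_mem_plus ht hxt, S.mem_eqR.1 hz,
    sub_self, map_zero]

end RAction

/-! ### The automorphism of the tensor power -/

variable (n A) in
/-- The map `x_1 ⊗ ⋯ ⊗ x_n ↦ e_1(x_1) (e_2(x_2) - e_1(x_2)) ⋯`, for `x_2`, … in `A⁺`. -/
def coord : TPow n A →ₗ[k] TPow n A := (ordMap (tensorAction n A).D).flip (tone n A)

theorem coord_apply (z : TPow n A) : coord n A z = ordMap (tensorAction n A).D z (tone n A) := rfl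

theorem coord_tone : coord n A (tone n A) = tone n A :=
  RAction.ordMap_tone (fun v => (tensorAction n A).D_one v) _

theorem coord_rmul {v : Fin n} (a : A.carrier) {z : TPow n A} (hz : z ∈ initialTensors n A v) :
    coord n A (rmul v a z) = rmul v a (coord n A z) - rmul 0 (augAt A v a) (coord n A z) :=
  ordMap_rmul_initial (fun v => (tensorAction n A).D_one v) a hz _

variable (n A) in
/-- The operators with the ordered product inverse to `coord`. -/
def invOp (v : Fin n) : A.carrier →ₗ[k] TPow n A →ₗ[k] TPow n A :=
  rmul v + rmul 0 ∘ₗ augAt A v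

theorem invOp_apply (v : Fin n) (a : A.carrier) (z : TPow n A) :
    invOp n A v a z = rmul v a z + rmul 0 (augAt A v a) z := rfl

theorem invOp_one (v : Fin n) : invOp n A v 1 = LinearMap.id := by
  ext x; simp [invOp_apply, augAt_one, rmul_one]

variable (n A) in
/-- The inverse of `coord`. -/
def invCoord : TPow n A →ₗ[k] TPow n A := (ordMap (invOp n A)).flip (tone n A)

/-- The first vertex comes first in the ordered product, so only commutation with e_1(a) is
required. This serves `coord` as well as its inverse. -/
theorem ordMap_rmul_zero {Q : Fin n → A.carrier →ₗ[k] TPow n A →ₗ[k] TPow n A}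
    (h0 : Q 0 = rmul 0)
    (hc : ∀ v (m : Fin 2) b c x, rmul 0 (A.par m b) (Q v c x) =
      Q v ((A.sgn ^ (m : ℕ)) c) (rmul 0 (A.par m b) x)) (a : A.carrier) (z y : TPow n A) :
    ordMap Q (rmul 0 a z) y = rmul 0 a (ordMap Q z y) := by
  rw [← ConnCDGA.par_add_par a]
  simp only [map_add, LinearMap.add_apply]
  have key : ∀ m : Fin 2, ordMap Q (rmul 0 (A.par m a) z) y =
      rmul 0 (A.par m a) (ordMap Q z y) := by
    intro m
    rw [rmul_par]
    induction z using PiTensorProduct.induction_on with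
    | smul_tprod r x =>
      simp only [map_smul, LinearMap.smul_apply]
      congr 1
      rw [rightMul_tprod, ordMap_tprod, ordMap_tprod]
      obtain ⟨l₁, l₂, h, h1, h2⟩ := exists_split_finRange (0 : Fin n)
      have hl : l₁ = [] := List.eq_nil_iff_forall_not_mem.2 fun w hw =>
        absurd ((h1 w).1 hw) (Fin.not_lt_zero w)
      rw [h, hl, List.nil_append, opProd_cons, opProd_cons, ← rmul_par,
        map_opProd (F' := fun v => Q v ((A.sgn ^ (m : ℕ)) (x v))) (rmul 0 (A.par m a))
        fun v _ y => hc v m a (x v) y]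
      rw [opProd_congr (l := l₂) (F' := fun v => Q v ((A.sgn ^ (m : ℕ)) (x v))) fun v hv => by
        rw [if_neg ((h2 v).1 hv).not_gt, if_neg ((h2 v).1 hv).ne']]
      simp [h0, rmul_mul]
    | add x y hx hy => simp only [map_add, LinearMap.add_apply, hx, hy]
  rw [key, key]

theorem coord_rmul_zero (a : A.carrier) (z : TPow n A) :
    coord n A (rmul 0 a z) = rmul 0 a (coord n A z) :=
  ordMap_rmul_zero (LinearMap.ext fun a => LinearMap.ext fun x => (tensorAction n A).D_zero a x)
    (fun v m b c x => (tensorAction n A).R_D_comm 0 v m b c x) a z _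

theorem invCoord_rmul_zero (a : A.carrier) (z : TPow n A) :
    invCoord n A (rmul 0 a z) = rmul 0 a (invCoord n A z) := by
  refine ordMap_rmul_zero ?_ (fun v m b c x => ?_) a z _
  · ext a x; simp [invOp_apply, augAt]
  · rw [invOp_apply, invOp_apply, map_add, rmul_comm, rmul_comm, augAt_sgn_pow]

theorem invCoord_tone : invCoord n A (tone n A) = tone n A :=
  RAction.ordMap_tone invOp_one _

theorem invCoord_rmul {v : Fin n} (a : A.carrier) {z : TPow n A} (hz : z ∈ initialTensors n A v) :
    invCoord n A (rmul v a z) =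
      rmul v a (invCoord n A z) + rmul 0 (augAt A v a) (invCoord n A z) :=
  ordMap_rmul_initial invOp_one a hz _

theorem coord_mem_initialTensors {m : ℕ} {z : TPow n A} (hz : z ∈ initialTensors n A m) :
    coord n A z ∈ initialTensors n A m := by
  refine ordMap_mem_initialTensors (fun v => (tensorAction n A).D_one v) (fun v a z hv hz => ?_) hz
  refine sub_mem (rmul_mem_initialTensors hv _ hz)
    (rmul_mem_initialTensors (v := (0 : Fin n)) ?_ _ hz)
  exact lt_of_le_of_lt (Fin.zero_le v) hv

theorem invCoord_mem_initialTensors {m : ℕ} {z : TPow n A} (hz : z ∈ initialTensors n A m) :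
    invCoord n A z ∈ initialTensors n A m := by
  refine ordMap_mem_initialTensors invOp_one (fun v a z hv hz => ?_) hz
  refine add_mem (rmul_mem_initialTensors hv _ hz)
    (rmul_mem_initialTensors (v := (0 : Fin n)) ?_ _ hz)
  exact lt_of_le_of_lt (Fin.zero_le v) hv

/-- The change of coordinates is triangular: on tensors supported before `v`, the factor at `v` has
an e_1-term subtracted, which `invCoord` adds back, because `coord` preserves such tensors and
`invCoord` commutes with e_1. -/
theorem invCoord_coord (z : TPow n A) : invCoord n A (coord n A z) = z := by
  have : invCoord n A ∘ₗ coord n A = LinearMap.id := by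
    refine eq_of_initialTensors ?_ fun v a z hz ih => ?_
    · simp [coord_tone, invCoord_tone]
    · simp only [LinearMap.comp_apply, LinearMap.id_apply] at ih ⊢
      rw [coord_rmul a hz, map_sub, invCoord_rmul a (coord_mem_initialTensors hz),
        invCoord_rmul_zero, ih, add_sub_cancel_right]
  exact LinearMap.congr_fun this z

theorem coord_invCoord (z : TPow n A) : coord n A (invCoord n A z) = z := by
  have : coord n A ∘ₗ invCoord n A = LinearMap.id := by
    refine eq_of_initialTensors ?_ fun v a z hz ih => ?_
    · simp [coord_tone, invCoord_tone]
    · simp only [LinearMap.comp_apply, LinearMap.id_apply] at ih ⊢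
      rw [invCoord_rmul a hz, map_add, coord_rmul a (invCoord_mem_initialTensors hz),
        coord_rmul_zero, ih, sub_add_cancel]
  exact LinearMap.congr_fun this z

theorem map_sgn_coord (z : TPow n A) :
    PiTensorProduct.map (fun _ => A.sgn) (coord n A z) =
      coord n A (PiTensorProduct.map (fun _ => A.sgn) z) := by
  have : PiTensorProduct.map (fun _ => A.sgn) ∘ₗ coord n A =
      coord n A ∘ₗ PiTensorProduct.map (fun _ => A.sgn) := by
    refine eq_of_initialTensors ?_ fun v a z hz ih => ?_
    · simp [coord_tone, map_sgn_tone]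
    · simp only [LinearMap.comp_apply] at ih ⊢
      have := augAt_sgn_pow v 1 a
      rw [pow_one] at this
      rw [coord_rmul a hz, map_sub, map_sgn_rmul, map_sgn_rmul, map_sgn_rmul,
        coord_rmul _ (map_sgn_mem_initialTensors hz), ih, this]
  exact LinearMap.congr_fun this z

/-- The Leibniz rule holds for each e_v(a), and the augmentation projection commutes with the
differential. -/
theorem tdiff_coord (z : TPow n A) : tdiff n A (coord n A z) = coord n A (tdiff n A z) := by
  have : tdiff n A ∘ₗ coord n A = coord n A ∘ₗ tdiff n A := by
    refine eq_of_initialTensors ?_ fun v a z hz ih => ?_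
    · simp [coord_tone, tdiff_tone]
    · simp only [LinearMap.comp_apply] at ih ⊢
      rw [coord_rmul a hz, map_sub, tdiff_rmul, tdiff_rmul, tdiff_rmul, map_add,
        coord_rmul _ (tdiff_mem_initialTensors hz), coord_rmul _ (map_sgn_mem_initialTensors hz),
        ih, map_sgn_coord, augAt_d]
      abel
  exact LinearMap.congr_fun this z

end Coordinates

end SmallComplex

namespace SmallComplex

/-! ## The structure of `Ē(n,A)` -/

section Structure

variable {k : Type v} [Field k] {n : ℕ} {A : ConnCDGA.{u} k}

/-- The relations carry their generators on the left and the monomials are extended on the right;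
this mediates between the two. -/
theorem mul_gen (w : Lam n k) (e : Edge n) : w * gen k e =
    gen k e * CliffordAlgebra.involute (Q := (0 : QuadraticForm k (Edge n →₀ k))) w := by
  induction w using ExteriorAlgebra.induction with
  | algebraMap r => rw [AlgHom.commutes, Algebra.commutes]
  | ι x =>
    have h : CliffordAlgebra.involute (Q := (0 : QuadraticForm k (Edge n →₀ k)))
        (ExteriorAlgebra.ι k x) = -ExteriorAlgebra.ι k x := CliffordAlgebra.involute_ι _
    rw [h, mul_neg]
    exact eq_neg_of_add_eq_zero_left (ExteriorAlgebra.ι_add_mul_swap _ _)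
  | mul a b ha hb => rw [mul_assoc, hb, ← mul_assoc, ha, map_mul, mul_assoc]
  | add a b ha hb => rw [add_mul, ha, hb, map_add, mul_add]

theorem rmul_sub_tmul_mem (e : Edge n) (a : A.carrier) (x : TPow n A) (w : Lam n k) :
    (rmul e.src a x - rmul e.tgt a x) ⊗ₜ[k] (gen k e * w) ∈ relI n A ⊔ relJ n A := by
  induction a using ConnCDGA.induction_homogeneous with
  | hom m a ha =>
    rw [rmul_of_mem _ ha, rmul_of_mem _ ha]
    exact Submodule.mem_sup_left (Submodule.subset_span ⟨e, m, a, x, w, ha, rfl⟩)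
  | add a b ha hb =>
    have : rmul e.src (a + b) x - rmul e.tgt (a + b) x =
        (rmul e.src a x - rmul e.tgt a x) + (rmul e.src b x - rmul e.tgt b x) := by
      simp only [map_add, LinearMap.add_apply]; abel
    rw [this, TensorProduct.add_tmul]
    exact add_mem ha hb

theorem gen_mul_gen_tmul_mem {e f : Edge n} (h : e.tgt = f.tgt) (x : TPow n A) (w : Lam n k) :
    x ⊗ₜ[k] (gen k e * gen k f * w) ∈ relI n A ⊔ relJ n A :=
  Submodule.mem_sup_right (Submodule.subset_span ⟨e, f, x, w, h, rfl⟩)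

/-- A linear map that is compatible with the generators of the relations of `Ē(n,A)`. -/
theorem relations_le {Z : Type*} [AddCommGroup Z] [Module k Z]
    {f : TPow n A ⊗[k] Lam n k →ₗ[k] Z} {N : Submodule k Z}
    (hI : ∀ e m a x w, a ∈ A.deg m →
      f ((rmul (Edge.src e) a x - rmul (Edge.tgt e) a x) ⊗ₜ[k] (gen k e * w)) ∈ N)
    (hJ : ∀ e g x w, Edge.tgt e = Edge.tgt g → f (x ⊗ₜ[k] (gen k e * gen k g * w)) ∈ N) :
    relI n A ⊔ relJ n A ≤ N.comap f := by
  refine sup_le ?_ ?_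
  · refine Submodule.span_le.2 ?_
    rintro _ ⟨e, m, a, x, w, ha, rfl⟩
    have := hI e m a x w ha
    rwa [rmul_of_mem _ ha, rmul_of_mem _ ha] at this
  · refine Submodule.span_le.2 ?_
    rintro _ ⟨e, g, x, w, h, rfl⟩
    exact hJ e g x w h

theorem rTensor_rmul_le (v : Fin n) (b : A.carrier) : relI n A ⊔ relJ n A ≤
    (relI n A ⊔ relJ n A).comap (LinearMap.rTensor (Lam n k) (rmul v b)) := by
  refine relations_le (fun e m a x w _ => ?_) (fun e g x w h => ?_)
  · rw [← ConnCDGA.par_add_par b, map_add, LinearMap.rTensor_add, LinearMap.add_apply]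
    refine add_mem ?_ ?_ <;>
    · rw [LinearMap.rTensor_tmul, map_sub, rmul_comm, rmul_comm]
      exact rmul_sub_tmul_mem _ _ _ _
  · exact gen_mul_gen_tmul_mem h _ _

variable (n A) in
/-- The class of `x ⊗ w`. -/
def barMk : TPow n A →ₗ[k] Lam n k →ₗ[k] ESpace n A :=
  LinearMap.compr₂ (TensorProduct.mk k (TPow n A) (Lam n k)) (relI n A ⊔ relJ n A).mkQ

theorem barMk_apply (x : TPow n A) (w : Lam n k) :
    barMk n A x w = (relI n A ⊔ relJ n A).mkQ (x ⊗ₜ[k] w) := rfl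

theorem barMk_ext {Z : Type*} [AddCommGroup Z] [Module k Z] {f g : ESpace n A →ₗ[k] Z}
    (h : ∀ x w, f (barMk n A x w) = g (barMk n A x w)) : f = g :=
  Submodule.linearMap_qext _ (TensorProduct.ext' h)

/-- The right multiplication by `e_v(a)` on `Ē(n,A)`. -/
def barR (v : Fin n) (a : A.carrier) : ESpace n A →ₗ[k] ESpace n A :=
  Submodule.mapQ _ _ (LinearMap.rTensor (Lam n k) (rmul v a)) (rTensor_rmul_le v a)

theorem barR_mk (v : Fin n) (a : A.carrier) (x : TPow n A) (w : Lam n k) :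
    barR v a (barMk n A x w) = barMk n A (rmul v a x) w := rfl

variable (n A) in
/-- The right action of `A^{⊗ n}` on `Ē(n,A)`. -/
def barAction : RAction n A (ESpace n A) where
  R v :=
    { toFun := barR v
      map_add' := fun a b => barMk_ext fun x w => by
        rw [LinearMap.add_apply, barR_mk, barR_mk, barR_mk, map_add, LinearMap.add_apply, map_add,
          LinearMap.add_apply]
      map_smul' := fun c a => barMk_ext fun x w => by
        rw [LinearMap.smul_apply, barR_mk, barR_mk, map_smul, LinearMap.smul_apply, map_smul,
          LinearMap.smul_apply]
        rfl }
  one v := barMk_ext fun x w => by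
    change barR v 1 _ = _
    rw [barR_mk, rmul_one]; rfl
  mul v a b := LinearMap.congr_fun (f := barR v (a * b)) (g := barR v b ∘ₗ barR v a) <|
    barMk_ext fun x w => by
      rw [LinearMap.comp_apply, barR_mk, barR_mk, barR_mk, rmul_mul]
  comm u v m b c := LinearMap.congr_fun (f := barR u (A.par m b) ∘ₗ barR v c)
      (g := barR v ((A.sgn ^ (m : ℕ)) c) ∘ₗ barR u (A.par m b)) <|
    barMk_ext fun x w => by
      rw [LinearMap.comp_apply, LinearMap.comp_apply, barR_mk, barR_mk, barR_mk, barR_mk,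
        rmul_comm]

theorem barAction_R (v : Fin n) (a : A.carrier) (x : TPow n A) (w : Lam n k) :
    (barAction n A).R v a (barMk n A x w) = barMk n A (rmul v a x) w := rfl

theorem barMk_eq_zero_iff {x : TPow n A} {w : Lam n k} :
    barMk n A x w = 0 ↔ x ⊗ₜ[k] w ∈ relI n A ⊔ relJ n A := by
  rw [barMk_apply, Submodule.mkQ_apply, Submodule.Quotient.mk_eq_zero]

theorem mulRight_gen_le (e : Edge n) : relI n A ⊔ relJ n A ≤ (relI n A ⊔ relJ n A).comap
    (LinearMap.lTensor (TPow n A) (LinearMap.mulRight k (gen k e))) := by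
  refine relations_le (fun e m a x w _ => ?_) (fun e g x w h => ?_)
  · rw [LinearMap.lTensor_tmul, LinearMap.mulRight_apply, mul_assoc]
    exact rmul_sub_tmul_mem _ _ _ _
  · rw [LinearMap.lTensor_tmul, LinearMap.mulRight_apply, mul_assoc]
    exact gen_mul_gen_tmul_mem h _ _

variable (A) in
/-- The right multiplication by `e_{ij}` on `Ē(n,A)`. -/
def barGen (e : Edge n) : ESpace n A →ₗ[k] ESpace n A :=
  Submodule.mapQ _ _ (LinearMap.lTensor (TPow n A) (LinearMap.mulRight k (gen k e)))
    (mulRight_gen_le e)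

theorem barGen_mk (e : Edge n) (x : TPow n A) (w : Lam n k) :
    barGen A e (barMk n A x w) = barMk n A x (w * gen k e) := rfl

variable (n A) in
/-- The differential `d'` of `Ē(n,A)`. -/
def barD₁ : ESpace n A →ₗ[k] ESpace n A := Submodule.mapQ _ _ (preD₁ n A) preD₁_le

variable (n A) in
/-- The differential `d''` of `Ē(n,A)`. -/
def barD₂ : ESpace n A →ₗ[k] ESpace n A := Submodule.mapQ _ _ (preD₂ n A) preD₂_le

theorem barD₁_mk (x : TPow n A) (w : Lam n k) :
    barD₁ n A (barMk n A x w) = barMk n A x (w * ∑ e : Edge n, gen k e) := rfl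

theorem barD₂_mk (x : TPow n A) (w : Lam n k) :
    barD₂ n A (barMk n A x w) = barMk n A (tdiff n A x)
      (CliffordAlgebra.involute (Q := (0 : QuadraticForm k (Edge n →₀ k))) w) := rfl

theorem barD₁_eq_sum : barD₁ n A = ∑ e : Edge n, barGen A e := by
  refine barMk_ext fun x w => ?_
  rw [barD₁_mk, Finset.mul_sum, map_sum, LinearMap.sum_apply]
  exact Finset.sum_congr rfl fun e _ => (barGen_mk e x w).symm

/-! ### The summand of a graph -/

variable (A) in
/-- The map `z ↦ z e_G`. -/
def barMon (G : Graph n) : TPow n A →ₗ[k] ESpace n A := (barMk n A).flip (mon k G)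

theorem barMon_apply (G : Graph n) (z : TPow n A) : barMon A G z = barMk n A z (mon k G) := rfl

theorem barMon_rmul (G : Graph n) (v : Fin n) (a : A.carrier) (z : TPow n A) :
    barMon A G (rmul v a z) = (barAction n A).R v a (barMon A G z) := rfl

theorem barGen_barMon {G : Graph n} {e : Edge n} (he : e ∉ G) (z : TPow n A) :
    barGen A e (barMon A G z) = edgeSign k G e • barMon A (insert e G) z := by
  rw [barMon_apply, barGen_mk, mon_mul_gen k he, map_smul, barMon_apply]

theorem barGen_barMon_of_mem {G : Graph n} {e : Edge n} (he : e ∈ G) (z : TPow n A) :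
    barGen A e (barMon A G z) = 0 := by
  rw [barMon_apply, barGen_mk, mon_mul_gen_of_mem k he, map_zero]

theorem barD₂_barMon (G : Graph n) (z : TPow n A) :
    barD₂ n A (barMon A G z) = (-1 : k) ^ G.card • barMon A G (tdiff n A z) := by
  rw [barMon_apply, barD₂_mk, involute_mon, map_smul, barMon_apply]

/-- The two edges with a common target are split off from the monomial and brought to its front,
where they form a generator of J. -/
theorem barMon_eq_zero {G : Graph n} (hG : ¬ NoSharedTarget G) (z : TPow n A) :
    barMon A G z = 0 := by
  simp only [NoSharedTarget, not_forall] at hG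
  obtain ⟨e, he, f, hf, hef, hne⟩ := hG
  have hf' : f ∈ G.erase e := Finset.mem_erase.2 ⟨fun h => hne h.symm, hf⟩
  rw [barMon_apply, mon_eq_erase_mul_gen k he, map_smul, mon_eq_erase_mul_gen k hf',
    smul_mul_assoc, map_smul, mul_gen (_ * _), involute_mul_gen, mul_gen, mul_neg, map_neg,
    ← mul_assoc, barMk_eq_zero_iff.2 (gen_mul_gen_tmul_mem hef z _)]
  simp

theorem barMon_mem_eqR_of_mem {G : Graph n} {e : Edge n} (he : e ∈ G) (z : TPow n A) :
    barMon A G z ∈ (barAction n A).eqR e.src e.tgt := by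
  rw [RAction.mem_eqR]
  intro a
  rw [← sub_eq_zero, ← barMon_rmul, ← barMon_rmul, ← map_sub, barMon_apply,
    mon_eq_erase_mul_gen k he, map_smul, mul_gen,
    barMk_eq_zero_iff.2 (rmul_sub_tmul_mem e a z _), smul_zero]

/-- The relation given by a single edge propagates along paths, so a component acts through any one
of its vertices. -/
theorem barMon_mem_eqR {G : Graph n} {v w : Fin n} (h : (toSimple G).Reachable v w)
    (z : TPow n A) : barMon A G z ∈ (barAction n A).eqR v w := by
  rw [RAction.mem_eqR]
  intro a
  obtain ⟨p⟩ := h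
  induction p with
  | nil => rfl
  | cons hab _ ih =>
    rw [← ih]
    rw [toSimple, SimpleGraph.fromRel_adj] at hab
    rcases hab.2 with ⟨e, he, rfl, rfl⟩ | ⟨e, he, rfl, rfl⟩
    · exact (RAction.mem_eqR _).1 (barMon_mem_eqR_of_mem he z) a
    · exact ((RAction.mem_eqR _).1 (barMon_mem_eqR_of_mem he z) a).symm

theorem minVertex_eq_of_reachable {G : Graph n} {v w : Fin n} (h : (toSimple G).Reachable v w) :
    minVertex G v = minVertex G w :=
  le_antisymm (minVertex_le (h.trans (reachable_minVertex G w)))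
    (minVertex_le (h.symm.trans (reachable_minVertex G v)))

theorem reachable_of_mem {G : Graph n} {e : Edge n} (he : e ∈ G) :
    (toSimple G).Reachable e.src e.tgt := by
  refine SimpleGraph.Adj.reachable ?_
  rw [toSimple, SimpleGraph.fromRel_adj]
  exact ⟨ne_of_lt e.2, Or.inl ⟨e, he, rfl, rfl⟩⟩

variable (A) in
/-- The endomorphism of `A^{⊗ n}` that moves all tensor factors to the smallest vertices of their
components. -/
def rootMap (G : Graph n) : TPow n A →ₗ[k] TPow n A :=
  (ordMap ((tensorAction n A).pullback (minVertex G)).R).flip (tone n A)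

theorem rootMap_rmul (G : Graph n) (v : Fin n) (a : A.carrier) (z : TPow n A) :
    rootMap A G (rmul v a z) = rmul (minVertex G v) a (rootMap A G z) :=
  RAction.ordMap_rmul _ v a z _

theorem rootMap_tone (G : Graph n) : rootMap A G (tone n A) = tone n A :=
  RAction.ordMap_tone (fun v => ((tensorAction n A).pullback (minVertex G)).one v) _

/-- Moving a factor to the root of its component does not change the class in front of e_G. -/
theorem barMon_rootMap (G : Graph n) (z : TPow n A) :
    barMon A G (rootMap A G z) = barMon A G z := by
  have : barMon A G ∘ₗ rootMap A G = barMon A G := by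
    refine eq_of_initialTensors ?_ fun v a z _ ih => ?_
    · rw [LinearMap.comp_apply, rootMap_tone]
    · rw [LinearMap.comp_apply] at ih ⊢
      rw [rootMap_rmul, barMon_rmul, ih, barMon_rmul]
      exact ((RAction.mem_eqR _).1 (barMon_mem_eqR (reachable_minVertex G v) z) a).symm
  exact LinearMap.congr_fun this z

theorem coeff_gen_mul_gen {G : Graph n} (hG : NoSharedTarget G) {e f : Edge n}
    (h : e.tgt = f.tgt) (w : Lam n k) : coeff k G (gen k e * gen k f * w) = 0 := by
  rw [mul_assoc]
  by_cases he : e ∈ G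
  · by_cases hf : f ∈ G
    · rw [hG e he f hf h, coeff_gen_mul_self]
    · rw [← mul_assoc, gen_mul_gen, neg_mul, mul_assoc, map_neg, coeff_gen_mul k hf, neg_zero]
  · exact coeff_gen_mul k he _

variable (A) in
/-- The projection of `Ē(n,A)` onto the summand of a graph. -/
def barCoeff {G : Graph n} (hG : NoSharedTarget G) :
    ESpace n A →ₗ[k] TPow n A :=
  Submodule.liftQ _ (TensorProduct.lift
    (LinearMap.compl₂ (LinearMap.lsmul k (TPow n A)).flip (coeff k G) ∘ₗ rootMap A G)) (by
      refine (relations_le (N := ⊥) (fun e m a x w _ => ?_) (fun e g x w h => ?_)).trans_eq rfl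
      · rw [Submodule.mem_bot]
        simp only [TensorProduct.lift.tmul, LinearMap.comp_apply, map_sub]
        rw [LinearMap.sub_apply]
        simp only [LinearMap.compl₂_apply, LinearMap.flip_apply, LinearMap.lsmul_apply]
        -- An edge of `G` joins vertices with the same root, which `rootMap` identifies; a multiple
        -- of any other edge has no coefficient at e_G.
        by_cases he : e ∈ G
        · rw [rootMap_rmul, rootMap_rmul, minVertex_eq_of_reachable (reachable_of_mem he),
            sub_self]
        · rw [coeff_gen_mul k he, zero_smul, zero_smul, sub_zero]
      · rw [Submodule.mem_bot]
        simp only [TensorProduct.lift.tmul, LinearMap.comp_apply, LinearMap.compl₂_apply,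
          LinearMap.flip_apply, LinearMap.lsmul_apply, coeff_gen_mul_gen hG h, zero_smul])

theorem barCoeff_mk {G : Graph n} (hG : NoSharedTarget G) (x : TPow n A) (w : Lam n k) :
    barCoeff A hG (barMk n A x w) = coeff k G w • rootMap A G x := rfl

theorem barCoeff_barMon {G H : Graph n} (hG : NoSharedTarget G) (z : TPow n A) :
    barCoeff A hG (barMon A H z) = if G = H then rootMap A G z else 0 := by
  rw [barMon_apply, barCoeff_mk, coeff_mon]
  split_ifs <;> simp

theorem span_barMon : ⨆ G : Graph n, LinearMap.range (barMon A G) = ⊤ := by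
  refine top_le_iff.1 fun y _ => ?_
  obtain ⟨y, rfl⟩ := Submodule.mkQ_surjective _ y
  induction y using TensorProduct.induction_on with
  | zero => simp
  | add x y hx hy => rw [map_add]; exact add_mem (hx trivial) (hy trivial)
  | tmul x w =>
    change barMk n A x w ∈ _
    have hw : w ∈ Submodule.span k (Set.range (mon k (n := n))) := by rw [span_mon]; trivial
    have : Submodule.span k (Set.range (mon k (n := n))) ≤
        (⨆ G : Graph n, LinearMap.range (barMon A G)).comap (barMk n A x) := by
      refine Submodule.span_le.2 ?_
      rintro _ ⟨G, rfl⟩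
      exact Submodule.mem_iSup_of_mem (p := fun G => LinearMap.range (barMon A G)) G ⟨x, rfl⟩
    exact this hw

theorem NoSharedTarget.of_insert {G : Graph n} {e : Edge n} (h : NoSharedTarget (insert e G)) :
    NoSharedTarget G :=
  fun a ha b hb => h a (Finset.mem_insert_of_mem ha) b (Finset.mem_insert_of_mem hb)

theorem isMinVertex_tgt {G : Graph n} {e : Edge n} (he : e ∉ G) (h : NoSharedTarget (insert e G)) :
    IsMinVertex G e.tgt :=
  (isMinVertex_iff h.of_insert _).2 fun f hf hfe => he <| by
    rwa [← h f (Finset.mem_insert_of_mem hf) e (Finset.mem_insert_self _ _) hfe]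

theorem minVertex_src_lt {G : Graph n} {e : Edge n} : minVertex G e.src < e.tgt :=
  lt_of_le_of_lt (minVertex_le (SimpleGraph.Reachable.refl _)) e.2

theorem toSimple_mono {G H : Graph n} (h : G ⊆ H) : toSimple G ≤ toSimple H := by
  intro a b hab
  rw [toSimple, SimpleGraph.fromRel_adj] at hab ⊢
  refine ⟨hab.1, hab.2.imp ?_ ?_⟩
  · rintro ⟨f, hf, h'⟩; exact ⟨f, h hf, h'⟩
  · rintro ⟨f, hf, h'⟩; exact ⟨f, h hf, h'⟩

end Structure

/-! ### The summands of Ē(n,A) in the new coordinates -/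

section BarCoord

variable {k : Type v} [Field k] {n : ℕ} [NeZero n] {A : ConnCDGA.{u} k}

variable (A) in
/-- The map `x_1 ⊗ ⋯ ⊗ x_n ↦ e_1(x_1) (e_2(x_2) - e_1(x_2)) ⋯ e_G`, for `x_2`, … in `A⁺`. -/
def barCoord (G : Graph n) : TPow n A →ₗ[k] ESpace n A := barMon A G ∘ₗ coord n A

/-- Written as operators acting on e_G itself, the factors can be contracted with the relations e_t
= e_s that hold there. -/
theorem barCoord_eq (G : Graph n) (z : TPow n A) :
    barCoord A G z = ordMap (barAction n A).D z (barMon A G (tone n A)) := by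
  rw [barCoord, LinearMap.comp_apply, coord_apply]
  exact (tensorAction n A).map_ordMap_D _ (barMon A G) (fun v a x => barMon_rmul G v a x) z _

theorem minVertex_zero (G : Graph n) : minVertex G 0 = 0 :=
  le_antisymm (minVertex_le (SimpleGraph.Reachable.refl _)) (Fin.zero_le _)

/-- The only nontrivial factors are at roots and at the first vertex, which is its own root;
`rootMap` fixes all of these places. -/
theorem rootMap_coord {G : Graph n} {x : Fin n → A.carrier}
    (hx : ∀ v, ¬ IsMinVertex G v → x v = 1) :
    rootMap A G (coord n A (PiTensorProduct.tprod k x)) =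
      coord n A (PiTensorProduct.tprod k x) := by
  rw [coord_apply, ordMap_tprod, map_opProd (F' := fun v => (tensorAction n A).D v (x v)),
    rootMap_tone]
  intro v _ y
  by_cases hv : IsMinVertex G v
  · simp only [RAction.D_apply, map_sub]
    change rootMap A G (rmul v _ y) - rootMap A G (rmul 0 _ y) = _
    rw [rootMap_rmul, rootMap_rmul, minVertex_zero, hv.minVertex_eq]
    rfl
  · rw [hx v hv, RAction.D_one]; rfl

theorem barCoeff_barCoord {G : Graph n} (hG : NoSharedTarget G) {x : Fin n → A.carrier}
    (hx : ∀ v, ¬ IsMinVertex G v → x v = 1) :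
    barCoeff A hG (barCoord A G (PiTensorProduct.tprod k x)) =
      coord n A (PiTensorProduct.tprod k x) := by
  rw [barCoord, LinearMap.comp_apply, barCoeff_barMon, if_pos rfl, rootMap_coord hx]

theorem barCoeff_barCoord_of_ne {G H : Graph n} (hG : NoSharedTarget G) (h : G ≠ H)
    (z : TPow n A) : barCoeff A hG (barCoord A H z) = 0 := by
  rw [barCoord, LinearMap.comp_apply, barCoeff_barMon, if_neg h]

theorem barD₂_barCoord (G : Graph n) (z : TPow n A) :
    barD₂ n A (barCoord A G z) = (-1 : k) ^ G.card • barCoord A G (tdiff n A z) := by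
  rw [barCoord, LinearMap.comp_apply, barD₂_barMon, tdiff_coord]; rfl

theorem barGen_barCoord {G : Graph n} {e : Edge n} (he : e ∉ G) (z : TPow n A) :
    barGen A e (barCoord A G z) = edgeSign k G e • barCoord A (insert e G) z :=
  barGen_barMon he _

theorem barGen_barCoord_of_mem {G : Graph n} {e : Edge n} (he : e ∈ G) (z : TPow n A) :
    barGen A e (barCoord A G z) = 0 :=
  barGen_barMon_of_mem he _

theorem barCoord_eq_zero {G : Graph n} (hG : ¬ NoSharedTarget G) (z : TPow n A) :
    barCoord A G z = 0 :=
  barMon_eq_zero hG _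

/-! ### Contraction along an added edge -/

variable {G : Graph n} {e : Edge n}

theorem barMon_insert_mem_eqR (z : TPow n A) :
    barMon A (insert e G) z ∈ (barAction n A).eqR e.tgt (minVertex G e.src) := by
  refine barMon_mem_eqR ?_ z
  exact (reachable_of_mem (Finset.mem_insert_self e G)).symm.trans
    ((reachable_minVertex G e.src).mono (toSimple_mono (Finset.subset_insert e G)))

theorem tgt_ne_zero (e : Edge n) : e.tgt ≠ 0 :=
  (lt_of_le_of_lt (Fin.zero_le e.src) e.2).ne'

theorem barCoord_insert (hs : minVertex G e.src ≠ 0)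
    {x : Fin n → A.carrier} (hxs : x (minVertex G e.src) ∈ A.plus) (hxt : x e.tgt ∈ A.plus) :
    barCoord A (insert e G) (PiTensorProduct.tprod k x) =
      ∑ m : Fin 2, barCoord A (insert e G)
        (PiTensorProduct.tprod k (mergeFun x (minVertex G e.src) e.tgt m)) -
      ∑ m : Fin 2, ∑ m' : Fin 2, barCoord A (insert e G)
        (PiTensorProduct.tprod k (crossFun x (minVertex G e.src) e.tgt m m')) -
      ∑ m : Fin 2, barCoord A (insert e G)
        (PiTensorProduct.tprod k (mergeFun x 0 e.tgt m)) := by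
  simp only [barCoord_eq]
  exact (barAction n A).ordMap_D_contract hs minVertex_src_lt (barMon_insert_mem_eqR _) hxs hxt

theorem barCoord_insert_one (hs : minVertex G e.src ≠ 0)
    {x : Fin n → A.carrier} (hxs : x (minVertex G e.src) = 1) :
    barCoord A (insert e G) (PiTensorProduct.tprod k x) =
      ∑ m : Fin 2, barCoord A (insert e G)
        (PiTensorProduct.tprod k (mergeFun x (minVertex G e.src) e.tgt m)) := by
  simp only [barCoord_eq]
  exact (barAction n A).ordMap_D_contract_one hs minVertex_src_lt (barMon_insert_mem_eqR _) hxs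

theorem barCoord_insert_eq_zero (hs : minVertex G e.src = 0)
    {x : Fin n → A.carrier} (hxt : x e.tgt ∈ A.plus) :
    barCoord A (insert e G) (PiTensorProduct.tprod k x) = 0 := by
  rw [barCoord_eq]
  refine (barAction n A).ordMap_D_eq_zero (tgt_ne_zero e) ?_ hxt
  have := barMon_insert_mem_eqR (G := G) (e := e) (A := A) (tone n A)
  rwa [hs] at this

end BarCoord

end SmallComplex

/-! ## Linear algebra of bicomplexes -/

section LinearAlgebra

variable {k : Type v} [Field k]

theorem isInternal_of_proj {ι V : Type*} [DecidableEq ι] [AddCommGroup V] [Module k V]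
    {P : ι → Submodule k V} (π : ι → V →ₗ[k] V)
    (hπ : ∀ i j x, x ∈ P j → π i x = if j = i then x else 0) (hP : ⨆ i, P i = ⊤) :
    DirectSum.IsInternal P := by
  rw [DirectSum.isInternal_submodule_iff_iSupIndep_and_iSup_eq_top]
  refine ⟨fun i => Submodule.disjoint_def.2 fun x hx hx' => ?_, hP⟩
  have h : ⨆ j, ⨆ (_ : j ≠ i), P j ≤ LinearMap.ker (π i) :=
    iSup₂_le fun j hj y hy => by rw [LinearMap.mem_ker, hπ i j y hy, if_neg hj]
  rw [← LinearMap.mem_ker.1 (h hx'), hπ i i x hx, if_pos rfl]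

/-- Tensors `⊗ x_i` with `x_i` in the span of `s_i` are in a subspace if this is so for `x_i` in
`s_i`. -/
theorem tprod_mem_of_span {ι : Type*} [Finite ι] {M : ι → Type*} [∀ i, AddCommMonoid (M i)]
    [∀ i, Module k (M i)] {s : ∀ i, Set (M i)} {N : Submodule k (⨂[k] i, M i)}
    (h : ∀ x : ∀ i, M i, (∀ i, x i ∈ s i) → PiTensorProduct.tprod k x ∈ N) (x : ∀ i, M i)
    (hx : ∀ i, x i ∈ Submodule.span k (s i)) : PiTensorProduct.tprod k x ∈ N := by
  classical
  have := Fintype.ofFinite ι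
  have key : ∀ t : Finset ι, ∀ x : ∀ i, M i, (∀ i ∈ t, x i ∈ Submodule.span k (s i)) →
      (∀ i ∉ t, x i ∈ s i) → PiTensorProduct.tprod k x ∈ N := by
    intro t
    induction t using Finset.induction_on with
    | empty => exact fun x _ hx => h x fun i => hx i (by simp)
    | insert i t hi ih =>
      intro x hx hx'
      have hle : Submodule.span k (s i) ≤
          N.comap ((PiTensorProduct.tprod k (s := M)).toLinearMap x i) := by
        refine Submodule.span_le.2 fun y hy => ih _ (fun j hj => ?_) fun j hj => ?_
        · have hji : j ≠ i := by rintro rfl; exact hi hj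
          rw [Function.update_of_ne hji]
          exact hx j (Finset.mem_insert_of_mem hj)
        · by_cases hji : j = i
          · subst hji; simpa using hy
          · rw [Function.update_of_ne hji]
            exact hx' j (by simp [hji, hj])
      have := hle (hx i (Finset.mem_insert_self _ _))
      rwa [Submodule.mem_comap, MultilinearMap.toLinearMap_apply, Function.update_eq_self] at this
  exact key Finset.univ x (fun i _ => hx i) fun i hi => absurd (Finset.mem_univ i) hi

/-- The inclusion of `W` into `V` induces an isomorphism in the cohomology with respect to `d`. -/
def CohomologyIso {X : Type*} [AddCommGroup X] [Module k X] (d : X →ₗ[k] X)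
    (W V : Submodule k X) : Prop :=
  (∀ v ∈ V, d v = 0 → ∃ u, v - d u ∈ W) ∧ ∀ v ∈ V, d v ∈ W → ∃ w ∈ W, d w = d v

namespace CohomologyIso

variable {X : Type*} [AddCommGroup X] [Module k X] {d : X →ₗ[k] X} {U V W : Submodule k X}

theorem refl (W : Submodule k X) : CohomologyIso d W W :=
  ⟨fun v hv _ => ⟨0, by simpa using hv⟩, fun v hv _ => ⟨v, hv, rfl⟩⟩

/-- The bounding elements may lie anywhere in the ambient space, so those of the two steps can
simply be added. -/
theorem trans (hd : ∀ x, d (d x) = 0) (hWV : W ≤ V) (h : CohomologyIso d W V)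
    (h' : CohomologyIso d V U) : CohomologyIso d W U := by
  refine ⟨fun u hu hdu => ?_, fun u hu hdu => ?_⟩
  · obtain ⟨x, hx⟩ := h'.1 u hu hdu
    obtain ⟨y, hy⟩ := h.1 _ hx (by rw [map_sub, hdu, hd, sub_zero])
    exact ⟨x + y, by rwa [map_add, ← sub_sub]⟩
  · obtain ⟨v, hv, hvu⟩ := h'.2 u hu (hWV hdu)
    rw [← hvu] at hdu ⊢
    exact h.2 v hv hdu

/-- If `V / W` is the sum of `Y` and of `m(Y)`, with `m` injective on `Y`, and if the differential
of `Y` is `m` modulo `W + Y`, then `V / W` is acyclic. -/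
theorem of_cone (hd : ∀ x, d (d x) = 0) {Y : Submodule k X} (m : X →ₗ[k] X)
    (hW : ∀ w ∈ W, d w ∈ W) (hV : V ≤ W ⊔ Y ⊔ Y.map m) (hdm : ∀ y ∈ Y, d y - m y ∈ W ⊔ Y)
    (hm : ∀ y ∈ Y, m y ∈ W ⊔ Y → y = 0) : CohomologyIso d W V := by
  -- The component of `v` in m(Y) is removed by a boundary, since m(u) is `d u` modulo W + Y.
  have key : ∀ v ∈ V, ∃ u, ∃ w ∈ W, ∃ y ∈ Y, v - d u = w + y := by
    intro v hv
    obtain ⟨a, ha, b, hb, rfl⟩ := Submodule.mem_sup.1 (hV hv)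
    obtain ⟨u, hu, rfl⟩ := Submodule.mem_map.1 hb
    obtain ⟨w, hw, y, hy, h⟩ := Submodule.mem_sup.1 (sub_mem ha (hdm u hu))
    exact ⟨u, w, hw, y, hy, by rw [h]; abel⟩
  -- If `d y` is in W, then m(y) is in W + Y, where it can only come from zero.
  have key' : ∀ y ∈ Y, d y ∈ W → y = 0 := fun y hy h => hm y hy <| by
    have := sub_mem (Submodule.mem_sup_left h) (hdm y hy)
    rwa [sub_sub_cancel] at this
  refine ⟨fun v hv hdv => ?_, fun v hv hdv => ?_⟩
  · obtain ⟨u, w, hw, y, hy, h⟩ := key v hv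
    have h1 : d w + d y = 0 := by rw [← map_add, ← h, map_sub, hdv, hd, sub_zero]
    have hy0 := key' y hy (by rw [eq_neg_of_add_eq_zero_right h1]; exact neg_mem (hW w hw))
    exact ⟨u, by rw [h, hy0, add_zero]; exact hw⟩
  · obtain ⟨u, w, hw, y, hy, h⟩ := key v hv
    have h1 : d w + d y = d v := by rw [← map_add, ← h, map_sub, hd, sub_zero]
    have hy0 := key' y hy (by rw [eq_sub_of_add_eq' h1]; exact sub_mem hdv (hW w hw))
    exact ⟨w, hw, by rw [← h1, hy0, map_zero, add_zero]⟩

end CohomologyIso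

/-! ### Transfer of structure along an injective morphism -/

namespace PreBicomplex

variable {X Y : PreBicomplex.{u} k}

theorem IsBicomplex.d_d (hX : X.IsBicomplex) (x : X.carrier) : X.d (X.d x) = 0 := by
  have h1 := LinearMap.congr_fun hX.d₁_d₁ x
  have h2 := LinearMap.congr_fun hX.d₂_d₂ x
  have h3 := LinearMap.congr_fun hX.d₁_d₂ x
  simp only [LinearMap.comp_apply, LinearMap.add_apply, LinearMap.zero_apply] at h1 h2 h3
  simp only [d, LinearMap.add_apply, map_add, h1, h2, zero_add, add_zero]
  rw [add_comm]
  exact h3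

/-- An injective morphism with the image of a quasi-isomorphic subcomplex is a quasi-isomorphism. -/
theorem Hom.isQuasiIso_of_range (f : Hom X Y) (hd : ∀ y, Y.d (Y.d y) = 0)
    (hf : Function.Injective f.toLin)
    (h : CohomologyIso Y.d (LinearMap.range f.toLin) ⊤) : f.IsQuasiIso := by
  constructor
  · rw [← LinearMap.ker_eq_bot, LinearMap.ker_eq_bot']
    intro c hc
    obtain ⟨⟨x, hx⟩, rfl⟩ := Submodule.mkQ_surjective _ c
    rw [onCohomology, Submodule.mkQ_apply, Submodule.mapQ_apply,
      Submodule.Quotient.mk_eq_zero] at hc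
    rw [Submodule.mkQ_apply, Submodule.Quotient.mk_eq_zero]
    obtain ⟨y, hy⟩ := hc
    have hy' : Y.d y = f.toLin x := hy
    obtain ⟨_, ⟨z, rfl⟩, hz⟩ := h.2 y trivial ⟨x, hy'.symm⟩
    refine ⟨z, hf ?_⟩
    rw [f.comm, hz, hy']
    rfl
  · intro c
    obtain ⟨⟨y, hy⟩, rfl⟩ := Submodule.mkQ_surjective _ c
    obtain ⟨u, x, hx⟩ := h.1 y trivial hy
    have hx0 : X.d x = 0 := hf (by
      rw [f.comm, hx, map_sub, LinearMap.mem_ker.1 hy, hd, sub_zero, map_zero])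
    refine ⟨(Submodule.mkQ _) ⟨x, hx0⟩, ?_⟩
    rw [onCohomology, Submodule.mkQ_apply, Submodule.mapQ_apply, Submodule.mkQ_apply,
      Submodule.Quotient.eq]
    refine ⟨-u, ?_⟩
    have : f.toLin x - y = Y.d (-u) := by rw [hx, map_neg]; abel
    exact this.symm

/-- A space with an injective morphism to a bicomplex is a bicomplex as soon as its pieces span
it. -/
theorem IsBicomplex.of_injective (f : Hom X Y) (hf : Function.Injective f.toLin)
    (hY : Y.IsBicomplex) (hX : ⨆ pq, X.piece pq = ⊤) : X.IsBicomplex := by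
  have hind := hY.isInternal.submodule_iSupIndep
  have hle : ∀ i, (⨆ j, ⨆ (_ : j ≠ i), X.piece j) ≤
      (⨆ j, ⨆ (_ : j ≠ i), Y.piece j).comap f.toLin := fun i => iSup₂_le fun j hj x hx =>
    (le_iSup₂_of_le (f := fun j (_ : j ≠ i) => Y.piece j) j hj le_rfl) (f.map_piece j x hx)
  have hzero : ∀ i x, f.toLin x ∈ Y.piece i → x ∈ ⨆ j, ⨆ (_ : j ≠ i), X.piece j → x = 0 :=
    fun i x hx hx' => hf (by
      rw [map_zero]
      exact Submodule.disjoint_def.1 (hind i) _ hx (hle i hx'))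
  -- The part of `x` outside its `i`-th piece has its image both in the `i`-th piece of `Y` and in
  -- the sum of the others, hence vanishes. So the degrees of the differentials can be read off in
  -- `Y`.
  have hmem : ∀ i x, f.toLin x ∈ Y.piece i → x ∈ X.piece i := by
    intro i x hx
    have hx' : x ∈ X.piece i ⊔ ⨆ j, ⨆ (_ : j ≠ i), X.piece j := by
      have : ⨆ pq, X.piece pq ≤ X.piece i ⊔ ⨆ j, ⨆ (_ : j ≠ i), X.piece j :=
        iSup_le fun j => by
          by_cases hj : j = i
          · subst hj; exact le_sup_left
          · exact le_sup_of_le_right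
              (le_iSup₂_of_le (f := fun j (_ : j ≠ i) => X.piece j) j hj le_rfl)
      exact this (hX ▸ Submodule.mem_top)
    obtain ⟨a, ha, b, hb, rfl⟩ := Submodule.mem_sup.1 hx'
    have hb' : f.toLin b ∈ Y.piece i := by
      have := sub_mem hx (f.map_piece i a ha)
      rwa [map_add, add_sub_cancel_left] at this
    rw [hzero i b hb' hb, add_zero]
    exact ha
  refine ⟨?_, fun p q x hx => hmem _ _ ?_, fun p q x hx => hmem _ _ ?_, ?_, ?_, ?_⟩
  · rw [DirectSum.isInternal_submodule_iff_iSupIndep_and_iSup_eq_top]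
    exact ⟨fun i => Submodule.disjoint_def.2 fun x hx hx' => hzero i x (f.map_piece i x hx) hx', hX⟩
  · rw [f.comm₁]; exact hY.d₁_mem p q _ (f.map_piece _ x hx)
  · rw [f.comm₂]; exact hY.d₂_mem p q _ (f.map_piece _ x hx)
  · refine LinearMap.ext fun x => hf ?_
    rw [LinearMap.comp_apply, f.comm₁, f.comm₁, ← LinearMap.comp_apply, hY.d₁_d₁]
    simp
  · refine LinearMap.ext fun x => hf ?_
    rw [LinearMap.comp_apply, f.comm₂, f.comm₂, ← LinearMap.comp_apply, hY.d₂_d₂]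
    simp
  · refine LinearMap.ext fun x => hf ?_
    have := LinearMap.congr_fun hY.d₁_d₂ (f.toLin x)
    simp only [LinearMap.add_apply, LinearMap.comp_apply, LinearMap.zero_apply] at this
    rw [LinearMap.add_apply, LinearMap.comp_apply, LinearMap.comp_apply, map_add, f.comm₁, f.comm₂,
      f.comm₂, f.comm₁, this]
    simp

end PreBicomplex

end LinearAlgebra

namespace SmallComplex

/-! ## The bigrading of `Ē(n,A)` -/

section Grading

variable {k : Type v} [Field k] {n : ℕ} {A : ConnCDGA.{u} k}

variable (n A) in
/-- The homogeneous tensors of degree `q`. -/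
def tensorDeg (q : ℕ) : Submodule k (TPow n A) :=
  Submodule.span k {z | ∃ (x : Fin n → A.carrier) (deg : Fin n → ℕ), (∀ i, x i ∈ A.deg (deg i)) ∧
    ∑ i, deg i = q ∧ z = PiTensorProduct.tprod k x}

theorem tprod_mem_tensorDeg {x : Fin n → A.carrier} {deg : Fin n → ℕ}
    (h : ∀ i, x i ∈ A.deg (deg i)) :
    PiTensorProduct.tprod k x ∈ tensorDeg n A (∑ i, deg i) :=
  Submodule.subset_span ⟨x, deg, h, rfl, rfl⟩

theorem iSup_tensorDeg : ⨆ q, tensorDeg n A q = ⊤ := by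
  refine top_le_iff.1 ?_
  rw [← PiTensorProduct.span_tprod_eq_top, Submodule.span_le]
  rintro _ ⟨x, rfl⟩
  refine tprod_mem_of_span (s := fun _ => {a | ∃ i, a ∈ A.deg i}) (fun x hx => ?_) x fun i => ?_
  · choose deg hdeg using hx
    exact Submodule.mem_iSup_of_mem (p := fun q => tensorDeg n A q) _ (tprod_mem_tensorDeg hdeg)
  · generalize x i = a
    induction a using ConnCDGA.induction_homogeneous with
    | hom j a ha => exact Submodule.subset_span ⟨j, ha⟩
    | add a b ha hb => exact add_mem ha hb

variable (n A) in
/-- The projection onto the homogeneous tensors of degree `q`. -/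
def tensorProj (q : ℕ) : TPow n A →ₗ[k] TPow n A :=
  ∑ δ ∈ Finset.piAntidiag (Finset.univ : Finset (Fin n)) q,
    PiTensorProduct.map fun i => A.projDeg (δ i)

theorem tensorProj_of_mem {p q : ℕ} {z : TPow n A} (hz : z ∈ tensorDeg n A p) :
    tensorProj n A q z = if p = q then z else 0 := by
  have : tensorDeg n A p ≤
      LinearMap.eqLocus (tensorProj n A q) (if p = q then LinearMap.id else 0) := by
    refine Submodule.span_le.2 ?_
    rintro _ ⟨x, deg, hx, rfl, rfl⟩
    rw [SetLike.mem_coe, LinearMap.mem_eqLocus, tensorProj, LinearMap.sum_apply]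
    have hδ : ∀ δ : Fin n → ℕ, PiTensorProduct.map (fun i => A.projDeg (δ i))
        (PiTensorProduct.tprod k x) = if δ = deg then PiTensorProduct.tprod k x else 0 := by
      intro δ
      rw [PiTensorProduct.map_tprod]
      split_ifs with h
      · subst h
        congr 1
        funext i
        rw [ConnCDGA.projDeg_of_mem (hx i), if_pos rfl]
      · obtain ⟨i, hi⟩ := Function.ne_iff.1 h
        exact MultilinearMap.map_coord_zero _ i (by
          rw [ConnCDGA.projDeg_of_mem (hx i), if_neg (Ne.symm hi)])
    simp only [hδ, Finset.sum_ite_eq', Finset.mem_piAntidiag]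
    split_ifs with h1 h2 h2
    · rfl
    · exact absurd h1.1 h2
    · exact absurd ⟨h2, fun _ _ => Finset.mem_univ _⟩ h1
    · rfl
  have := this hz
  rw [LinearMap.mem_eqLocus] at this
  rw [this]
  split_ifs <;> rfl

theorem rmul_mem_tensorDeg {m q : ℕ} (v : Fin n) {a : A.carrier} (ha : a ∈ A.deg m) {z : TPow n A}
    (hz : z ∈ tensorDeg n A q) : rmul v a z ∈ tensorDeg n A (q + m) := by
  have : tensorDeg n A q ≤ (tensorDeg n A (q + m)).comap (rmul v a) := by
    refine Submodule.span_le.2 ?_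
    rintro _ ⟨x, deg, hx, rfl, rfl⟩
    rw [SetLike.mem_coe, Submodule.mem_comap, rmul_of_mem v ha, rightMul_tprod]
    have hs : ∑ i, (deg i + if i = v then m else 0) = ∑ i, deg i + m := by
      rw [Finset.sum_add_distrib]; simp
    rw [← hs]
    refine tprod_mem_tensorDeg fun i => ?_
    rcases lt_trichotomy i v with h | rfl | h
    · simpa [h, h.ne] using hx i
    · simpa using SetLike.mul_mem_graded (hx i) ha
    · simp only [h.not_gt, h.ne', if_false, add_zero, ConnCDGA.sgn_pow_of_mem (hx i)]
      exact Submodule.smul_mem _ _ (hx i)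
  exact this hz

theorem tdiff_mem_tensorDeg {q : ℕ} {z : TPow n A} (hz : z ∈ tensorDeg n A q) :
    tdiff n A z ∈ tensorDeg n A (q + 1) := by
  have : tensorDeg n A q ≤ (tensorDeg n A (q + 1)).comap (tdiff n A) := by
    refine Submodule.span_le.2 ?_
    rintro _ ⟨x, deg, hx, rfl, rfl⟩
    rw [SetLike.mem_coe, Submodule.mem_comap, tdiff, tensorD, LinearMap.sum_apply]
    refine Submodule.sum_mem _ fun u _ => ?_
    rw [PiTensorProduct.map_tprod]
    have hs : ∑ i, (deg i + if i = u then 1 else 0) = ∑ i, deg i + 1 := by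
      rw [Finset.sum_add_distrib]; simp
    rw [← hs]
    refine tprod_mem_tensorDeg fun i => ?_
    rcases lt_trichotomy i u with h | rfl | h
    · simp only [h, h.ne, if_true, if_false, add_zero, ConnCDGA.sgn_of_mem (hx i)]
      exact Submodule.smul_mem _ _ (hx i)
    · simpa using A.d_mem _ _ (hx i)
    · simpa [h.not_gt, h.ne'] using hx i
  exact this hz

theorem gen_mem_exteriorPower (e : Edge n) : gen k e ∈ ⋀[k]^1 (Edge n →₀ k) := by
  have : gen k e ∈ LinearMap.range (ExteriorAlgebra.ι k (M := Edge n →₀ k)) := ⟨_, rfl⟩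
  simpa using this

theorem involute_mem_exteriorPower {p : ℕ} {w : Lam n k} (hw : w ∈ ⋀[k]^p (Edge n →₀ k)) :
    CliffordAlgebra.involute (Q := (0 : QuadraticForm k (Edge n →₀ k))) w ∈
      ⋀[k]^p (Edge n →₀ k) := by
  have h1 : (LinearMap.range (ExteriorAlgebra.ι k (M := Edge n →₀ k))).map
      (CliffordAlgebra.involute (Q := (0 : QuadraticForm k (Edge n →₀ k)))).toLinearMap ≤
      LinearMap.range (ExteriorAlgebra.ι k (M := Edge n →₀ k)) := by
    rintro _ ⟨_, ⟨x, rfl⟩, rfl⟩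
    exact ⟨-x, by rw [map_neg]; exact (CliffordAlgebra.involute_ι x).symm⟩
  have h2 := Submodule.map_pow (LinearMap.range (ExteriorAlgebra.ι k (M := Edge n →₀ k)))
    (CliffordAlgebra.involute (Q := (0 : QuadraticForm k (Edge n →₀ k)))) p
  exact (h2.trans_le (pow_le_pow_left' h1 p)) ⟨w, hw, rfl⟩

theorem iSup_exteriorPower : ⨆ p : ℕ, ⋀[k]^p (Edge n →₀ k) = ⊤ := by
  rw [eq_top_iff, ← span_mon, Submodule.span_le]
  rintro _ ⟨G, rfl⟩
  exact Submodule.mem_iSup_of_mem (p := fun p : ℕ => ⋀[k]^p (Edge n →₀ k)) _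
    (mon_mem_exteriorPower k G)

/-- The projection of the exterior algebra onto its component of degree `p`. -/
def lamProj (n : ℕ) (k : Type v) [Field k] (p : ℕ) : Lam n k →ₗ[k] Lam n k :=
  GradedAlgebra.proj (fun p : ℕ => ⋀[k]^p (Edge n →₀ k)) p

theorem lamProj_of_mem {p q : ℕ} {w : Lam n k} (hw : w ∈ ⋀[k]^p (Edge n →₀ k)) :
    lamProj n k q w = if p = q then w else 0 := by
  rw [lamProj, GradedAlgebra.proj_apply]
  split_ifs with h
  · subst h
    exact DirectSum.decompose_of_mem_same (fun p : ℕ => ⋀[k]^p (Edge n →₀ k)) hw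
  · exact DirectSum.decompose_of_mem_ne (fun p : ℕ => ⋀[k]^p (Edge n →₀ k)) hw h

theorem mem_of_homogeneous {Z : Type*} [AddCommGroup Z] [Module k Z] {N : Submodule k Z}
    (f : TPow n A →ₗ[k] Lam n k →ₗ[k] Z)
    (h : ∀ p q x w, x ∈ tensorDeg n A q → w ∈ ⋀[k]^p (Edge n →₀ k) → f x w ∈ N)
    (x : TPow n A) (w : Lam n k) : f x w ∈ N := by
  have hw : w ∈ ⨆ p : ℕ, ⋀[k]^p (Edge n →₀ k) := by rw [iSup_exteriorPower]; trivial
  have hx : x ∈ ⨆ q, tensorDeg n A q := by rw [iSup_tensorDeg]; trivial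
  have h1 : ∀ q, ∀ x ∈ tensorDeg n A q, f x w ∈ N := fun q x hx =>
    (iSup_le fun p w hw => h p q x w hx hw :
      ⨆ p : ℕ, ⋀[k]^p (Edge n →₀ k) ≤ N.comap (f x)) hw
  exact (iSup_le fun q x hx => h1 q x hx : ⨆ q, tensorDeg n A q ≤ N.comap (f.flip w)) hx

/-- Both ideals are spanned by bihomogeneous elements, and a bidegree projection keeps or kills each
of these. -/
theorem proj_le (pq : ℕ × ℕ) : relI n A ⊔ relJ n A ≤ (relI n A ⊔ relJ n A).comap
    (TensorProduct.map (tensorProj n A pq.2) (lamProj n k pq.1)) := by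
  refine relations_le (fun e m a x w ha => ?_) (fun e g x w h => ?_)
  · refine mem_of_homogeneous (LinearMap.compr₂ (LinearMap.compl₂
      (TensorProduct.mk k (TPow n A) (Lam n k) ∘ₗ (rmul e.src a - rmul e.tgt a))
        (LinearMap.mulLeft k (gen k e)))
      (TensorProduct.map (tensorProj n A pq.2) (lamProj n k pq.1))) (fun p q x w hx hw => ?_) x w
    simp only [LinearMap.compr₂_apply, LinearMap.compl₂_apply, LinearMap.comp_apply,
      TensorProduct.mk_apply, TensorProduct.map_tmul, LinearMap.sub_apply, LinearMap.mulLeft_apply]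
    rw [tensorProj_of_mem (sub_mem (rmul_mem_tensorDeg e.src ha hx)
        (rmul_mem_tensorDeg e.tgt ha hx)),
      lamProj_of_mem (SetLike.mul_mem_graded (gen_mem_exteriorPower e) hw)]
    split_ifs
    · exact rmul_sub_tmul_mem e a x w
    · simp
    · simp
    · simp
  · refine mem_of_homogeneous (LinearMap.compr₂ (LinearMap.compl₂
      (TensorProduct.mk k (TPow n A) (Lam n k)) (LinearMap.mulLeft k (gen k e * gen k g)))
      (TensorProduct.map (tensorProj n A pq.2) (lamProj n k pq.1))) (fun p q x w hx hw => ?_) x w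
    simp only [LinearMap.compr₂_apply, LinearMap.compl₂_apply, TensorProduct.mk_apply,
      TensorProduct.map_tmul, LinearMap.mulLeft_apply]
    rw [tensorProj_of_mem hx, lamProj_of_mem (SetLike.mul_mem_graded
      (SetLike.mul_mem_graded (gen_mem_exteriorPower e) (gen_mem_exteriorPower g)) hw)]
    split_ifs
    · exact gen_mul_gen_tmul_mem h x w
    · simp
    · simp
    · simp

variable (n A) in
/-- The projection of `Ē(n,A)` onto its piece of bidegree `(p,q)`. -/
def barProj (pq : ℕ × ℕ) : ESpace n A →ₗ[k] ESpace n A :=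
  Submodule.mapQ _ _ (TensorProduct.map (tensorProj n A pq.2) (lamProj n k pq.1)) (proj_le pq)

theorem barProj_mk (pq : ℕ × ℕ) (x : TPow n A) (w : Lam n k) :
    barProj n A pq (barMk n A x w) =
      barMk n A (tensorProj n A pq.2 x) (lamProj n k pq.1 w) := rfl

theorem barMk_mem_ePiece {p q : ℕ} {x : TPow n A} {w : Lam n k} (hx : x ∈ tensorDeg n A q)
    (hw : w ∈ ⋀[k]^p (Edge n →₀ k)) : barMk n A x w ∈ ePiece n A (p, q) := by
  have : tensorDeg n A q ≤ (ePiece n A (p, q)).comap ((barMk n A).flip w) := by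
    refine Submodule.span_le.2 ?_
    rintro _ ⟨x, deg, hx, hs, rfl⟩
    exact Submodule.subset_span ⟨x, deg, w, hx, hs, hw, rfl⟩
  exact this hx

/-- A subspace contains a piece of `Ē(n,A)` if it contains the classes that span it. -/
theorem ePiece_le {p q : ℕ} {N : Submodule k (ESpace n A)}
    (h : ∀ x w, x ∈ tensorDeg n A q → w ∈ ⋀[k]^p (Edge n →₀ k) → barMk n A x w ∈ N) :
    ePiece n A (p, q) ≤ N := by
  refine Submodule.span_le.2 ?_
  rintro _ ⟨x, deg, w, hx, rfl, hw, rfl⟩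
  exact h _ w (tprod_mem_tensorDeg hx) hw

theorem iSup_ePiece : ⨆ pq, ePiece n A pq = ⊤ := by
  refine top_le_iff.1 fun y _ => ?_
  obtain ⟨y, rfl⟩ := Submodule.mkQ_surjective _ y
  induction y using TensorProduct.induction_on with
  | zero => simp
  | add x y hx hy => rw [map_add]; exact add_mem (hx trivial) (hy trivial)
  | tmul x w =>
    exact mem_of_homogeneous (barMk n A) (fun p q x w hx hw =>
      Submodule.mem_iSup_of_mem (p := fun pq => ePiece n A pq) (p, q) (barMk_mem_ePiece hx hw)) x w

/-- The sum of the e_{ij} is an element of degree one of the exterior algebra, so its square is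
zero. -/
theorem barD₁_comp_barD₁ : barD₁ n A ∘ₗ barD₁ n A = 0 := by
  refine barMk_ext fun x w => ?_
  have h : (∑ e : Edge n, gen k e) * ∑ e : Edge n, gen k e = 0 := by
    have : ∑ e : Edge n, gen k e = ExteriorAlgebra.ι k (∑ e : Edge n, Finsupp.single e 1) := by
      rw [map_sum]; rfl
    rw [this]
    exact ExteriorAlgebra.ι_sq_zero _
  rw [LinearMap.comp_apply, barD₁_mk, barD₁_mk, mul_assoc, h, mul_zero, map_zero,
    LinearMap.zero_apply]

theorem barD₂_comp_barD₂ : barD₂ n A ∘ₗ barD₂ n A = 0 := by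
  refine barMk_ext fun x w => ?_
  rw [LinearMap.comp_apply, barD₂_mk, barD₂_mk, tdiff_tdiff, map_zero, LinearMap.zero_apply,
    LinearMap.zero_apply]

theorem barD₁_comp_barD₂ : barD₁ n A ∘ₗ barD₂ n A + barD₂ n A ∘ₗ barD₁ n A = 0 := by
  refine barMk_ext fun x w => ?_
  rw [LinearMap.add_apply, LinearMap.comp_apply, LinearMap.comp_apply, barD₁_mk, barD₂_mk, barD₁_mk,
    barD₂_mk, ← map_add, Finset.mul_sum, Finset.mul_sum, map_sum, ← Finset.sum_add_distrib,
    Finset.sum_eq_zero, map_zero, LinearMap.zero_apply]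
  intro e _
  rw [involute_mul_gen, add_neg_cancel]

theorem Ebar_isBicomplex : (Ebar n A).IsBicomplex where
  isInternal := by
    refine isInternal_of_proj (barProj n A) (fun pq rs x hx => ?_) iSup_ePiece
    have : ePiece n A rs ≤
        LinearMap.eqLocus (barProj n A pq) (if rs = pq then LinearMap.id else 0) := by
      refine ePiece_le (p := rs.1) (q := rs.2) fun x w hx hw => ?_
      rw [LinearMap.mem_eqLocus, barProj_mk, tensorProj_of_mem hx, lamProj_of_mem hw]
      by_cases h : rs = pq
      · subst h; simp
      · rw [if_neg h]
        split_ifs with h1 h2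
        · exact absurd (Prod.ext h2 h1) h
        · simp
        · simp
        · simp
    refine (LinearMap.mem_eqLocus.1 (this hx)).trans ?_
    split_ifs <;> rfl
  d₁_mem p q x hx := by
    have : ePiece n A (p, q) ≤ (ePiece n A (p + 1, q)).comap (barD₁ n A) := by
      refine ePiece_le fun x w hx hw => ?_
      rw [Submodule.mem_comap, barD₁_mk]
      exact barMk_mem_ePiece hx (SetLike.mul_mem_graded hw
        (sum_mem fun e _ => gen_mem_exteriorPower e))
    exact this hx
  d₂_mem p q x hx := by
    have : ePiece n A (p, q) ≤ (ePiece n A (p, q + 1)).comap (barD₂ n A) := by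
      refine ePiece_le fun x w hx hw => ?_
      rw [Submodule.mem_comap, barD₂_mk]
      exact barMk_mem_ePiece (tdiff_mem_tensorDeg hx) (involute_mem_exteriorPower hw)
    exact this hx
  d₁_d₁ := barD₁_comp_barD₁
  d₂_d₂ := barD₂_comp_barD₂
  d₁_d₂ := barD₁_comp_barD₂

end Grading

end SmallComplex

namespace SmallComplex

/-! ## The morphism from `C(n,A)` to `Ē(n,A)` -/

section Morphism

variable {k : Type v} [Field k] {n : ℕ} {A : ConnCDGA.{u} k}

/-- The map on the underlying spaces of `Ē(n,A)` and `Ē(n,B)` induced by `f : A → B`. -/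
def eMap {B : ConnCDGA.{u} k} (f : A.Hom B) : ESpace n A →ₗ[k] ESpace n B := Ebar.map n f

theorem eMap_mk {B : ConnCDGA.{u} k} (f : A.Hom B) (x : TPow n A) (w : Lam n k) :
    eMap f (barMk n A x w) =
      barMk n B (PiTensorProduct.map (fun _ => f.toAlgHom.toLinearMap) x) w := rfl

theorem map_rmul {B : ConnCDGA.{u} k} (f : A.Hom B) (v : Fin n) (a : A.carrier) (x : TPow n A) :
    PiTensorProduct.map (fun _ => f.toAlgHom.toLinearMap) (rmul v a x) =
      rmul v (f.toAlgHom a) (PiTensorProduct.map (fun _ => f.toAlgHom.toLinearMap) x) := by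
  induction a using ConnCDGA.induction_homogeneous with
  | hom i a ha => rw [rmul_of_mem v ha, rmul_of_mem v (f.map_deg _ _ ha), map_rightMul]
  | add a b ha hb => simp only [map_add, LinearMap.add_apply, ha, hb]

theorem eMap_R {B : ConnCDGA.{u} k} (f : A.Hom B) (v : Fin n) (a : A.carrier)
    (y : ESpace n A) : eMap f ((barAction n A).R v a y) =
      (barAction n B).R v (f.toAlgHom a) (eMap f y) := by
  have : eMap f ∘ₗ (barAction n A).R v a =
      (barAction n B).R v (f.toAlgHom a) ∘ₗ eMap f := by
    refine barMk_ext fun x w => ?_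
    rw [LinearMap.comp_apply, LinearMap.comp_apply, barAction_R, eMap_mk, eMap_mk, map_rmul]
    rfl
  exact LinearMap.congr_fun this y

variable [NeZero n]

open Classical in
/-- The family of elements of `A`, indexed by all the vertices, that extends a family indexed by
the components by `1`. -/
def fill {G : Graph n} (a : ∀ v : Comp G, slot A v.1) (v : Fin n) : A.carrier :=
  if h : IsMinVertex G v then a ⟨v, h⟩ else 1

theorem fill_val {G : Graph n} (a : ∀ v : Comp G, slot A v.1) (v : Comp G) :
    fill a v.1 = a v := dif_pos v.2

theorem fill_of_not {G : Graph n} (a : ∀ v : Comp G, slot A v.1) {v : Fin n}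
    (h : ¬ IsMinVertex G v) : fill a v = 1 := dif_neg h

theorem fill_mem_plus {G : Graph n} (a : ∀ v : Comp G, slot A v.1) {v : Fin n}
    (h : IsMinVertex G v) (hv : v ≠ 0) : fill a v ∈ A.plus := by
  rw [show fill a v = a ⟨v, h⟩ from fill_val a ⟨v, h⟩, ← slot_of_ne (A := A) hv]
  exact (a ⟨v, h⟩).2

theorem sepLinear_fill (G : Graph n) : SepLinear k (M := fun v : Comp G => slot A v.1)
    (N := fun _ : Fin n => A.carrier) fill := by
  intro i
  refine ⟨i.1, fun a z w hw => ?_, fun a x y => ?_, fun a c x => ?_⟩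
  · by_cases h : IsMinVertex G w
    · have : (⟨w, h⟩ : Comp G) ≠ i := fun hi => hw (congrArg Subtype.val hi)
      simp [fill, h, this]
    · rw [fill_of_not _ h, fill_of_not _ h]
  · simp [fill_val]
  · simp [fill_val]

variable (A) in
/-- The inclusion of `A ⊗ (A⁺)^{⊗ (l(G)-1)}` into `A^{⊗ n}`. -/
def insertOnes (G : Graph n) : CTensor A G →ₗ[k] TPow n A :=
  tensorLift (M := fun v : Comp G => slot A v.1) (N := fun _ : Fin n => A.carrier) fill
    (sepLinear_fill G)

theorem insertOnes_tprod (G : Graph n) (a : ∀ v : Comp G, slot A v.1) :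
    insertOnes A G (PiTensorProduct.tprod k a) = PiTensorProduct.tprod k (fill a) :=
  tensorLift_tprod _ _ _

open Classical in
variable (n A) in
/-- The map `a e_G ↦ e_1(a_1) (e_{i_2}(a_2) - e_1(a_2)) ⋯ e_G`, where `i_2`, … are the smallest
vertices of the components of `G`. -/
def phi : CSpace n A →ₗ[k] ESpace n A :=
  DirectSum.toModule k (GraphH n) (ESpace n A) fun G => barCoord A G.1 ∘ₗ insertOnes A G.1

open Classical in
theorem phi_lof (G : GraphH n) (x : CTensor A G.1) :
    phi n A (DirectSum.lof k (GraphH n) (fun G => CTensor A G.1) G x) =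
      barCoord A G.1 (insertOnes A G.1 x) := by
  rw [phi, DirectSum.toModule_lof]; rfl

open Classical in
theorem cspace_ext {Z : Type*} [AddCommGroup Z] [Module k Z] {f g : CSpace n A →ₗ[k] Z}
    (h : ∀ (G : GraphH n) (a : ∀ v : Comp G.1, slot A v.1),
      f (DirectSum.lof k (GraphH n) (fun G => CTensor A G.1) G (PiTensorProduct.tprod k a)) =
        g (DirectSum.lof k (GraphH n) (fun G => CTensor A G.1) G (PiTensorProduct.tprod k a))) :
    f = g :=
  DirectSum.linearMap_ext k fun G => PiTensorProduct.ext (MultilinearMap.ext fun a => h G a)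

/-! ### Compatibility with `d'` -/

section Contraction

variable {G : Graph n} {e : Edge n} (he : e ∉ G) (hG' : InH (insert e G))

/-- The roots of `insert e G` are those of `G` other than the target of `e`, whose place receives
the entry 1; the other places outside the roots have entry 1 on both sides. -/
theorem fill_merge (a : ∀ v : Comp G, slot A v.1) (r : Comp G) (hr : r < compOf G e.tgt)
    (m : Fin 2) :
    fill (G := insert e G) (fun w => ⟨mergeEntry a r (compOf G e.tgt) m (oldComp he hG' w),
      mergeEntry_mem a (ne_zero_of_comp_lt hr) m (oldComp he hG' w)⟩) =
    mergeFun (fill a) r.1 e.tgt m := by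
  have ht : (compOf G e.tgt).1 = e.tgt := compOf_tgt he hG'
  have hft : fill a e.tgt = a (compOf G e.tgt) := by
    conv_lhs => rw [← ht]
    exact fill_val a _
  have hrt : r.1 < e.tgt := by
    rw [← ht]; exact hr
  funext v
  by_cases hv : IsMinVertex (insert e G) v
  · obtain ⟨hv1, hv2⟩ := (isMinVertex_insert_iff he hG' v).1 hv
    rw [ht] at hv2
    refine (fill_val _ ⟨v, hv⟩).trans ?_
    have ho : oldComp he hG' ⟨v, hv⟩ = ⟨v, hv1⟩ := rfl
    have e1 : (⟨v, hv1⟩ : Comp G) = r ↔ v = r.1 := Subtype.ext_iff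
    have e2 : (⟨v, hv1⟩ : Comp G) < compOf G e.tgt ↔ v < e.tgt :=
      (Iff.rfl : _ ↔ v < (compOf G e.tgt).1).trans (by rw [ht])
    have hav : (a (oldComp he hG' ⟨v, hv⟩) : A.carrier) = fill a v := (fill_val a ⟨v, hv1⟩).symm
    have e3 : r < (⟨v, hv1⟩ : Comp G) ↔ r.1 < v := Iff.rfl
    simp only [mergeEntry, mergeFun, hav, ho, e1, e2, e3, hv2, if_false, hft, fill_val]
  · rw [fill_of_not _ hv]
    by_cases hvt : v = e.tgt
    · subst hvt
      simp [mergeFun, hrt.ne']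
    · have hv1 : ¬ IsMinVertex G v := fun h => hv <|
        (isMinVertex_insert_iff he hG' v).2 ⟨h, by rwa [ht]⟩
      have hvr : v ≠ r.1 := fun h => hv1 (h ▸ r.2)
      simp [mergeFun, hvt, hvr, fill_of_not a hv1, ConnCDGA.sgn_pow_one]

theorem fill_cross (a : ∀ v : Comp G, slot A v.1) (hs : (compOf G e.src).1 ≠ 0) (m m' : Fin 2) :
    fill (G := insert e G)
      (fun w => ⟨crossEntry a (compOf G e.src) (compOf G e.tgt) m m' (oldComp he hG' w),
      crossEntry_mem a hs (ne_zero_of_comp_lt (compOf_src_lt he hG')) m m' (oldComp he hG' w)⟩) =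
    crossFun (fill a) (minVertex G e.src) e.tgt m m' := by
  have ht : (compOf G e.tgt).1 = e.tgt := compOf_tgt he hG'
  have hft : fill a e.tgt = a (compOf G e.tgt) := by
    conv_lhs => rw [← ht]
    exact fill_val a _
  have hfs : fill a (minVertex G e.src) = a (compOf G e.src) := fill_val a (compOf G e.src)
  have hf0 : fill a 0 = a (comp0 G) := fill_val a (comp0 G)
  have h0t : e.tgt ≠ 0 := tgt_ne_zero e
  funext v
  by_cases hv : IsMinVertex (insert e G) v
  · obtain ⟨hv1, hv2⟩ := (isMinVertex_insert_iff he hG' v).1 hv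
    rw [ht] at hv2
    refine (fill_val _ ⟨v, hv⟩).trans ?_
    have ho : oldComp he hG' ⟨v, hv⟩ = ⟨v, hv1⟩ := rfl
    have e0 : (⟨v, hv1⟩ : Comp G) = comp0 G ↔ v = 0 := Subtype.ext_iff
    have e1 : (⟨v, hv1⟩ : Comp G) = compOf G e.src ↔ v = minVertex G e.src := Subtype.ext_iff
    have e2 : (⟨v, hv1⟩ : Comp G) < compOf G e.tgt ↔ v < e.tgt :=
      (Iff.rfl : _ ↔ v < (compOf G e.tgt).1).trans (by rw [ht])
    have hav : (a (oldComp he hG' ⟨v, hv⟩) : A.carrier) = fill a v := (fill_val a ⟨v, hv1⟩).symm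
    have e3 : (⟨v, hv1⟩ : Comp G) < compOf G e.src ↔ v < minVertex G e.src := Iff.rfl
    simp only [crossEntry, crossFun, hav, ho, e0, e1, e2, e3, hv2, if_false, hft, hfs]
    by_cases h0 : v = 0
    · simp only [h0, if_true, hf0]
    · simp only [h0, if_false]
  · rw [fill_of_not _ hv]
    have hv0 : v ≠ 0 := by
      rintro rfl
      exact hv fun _ _ => Fin.zero_le _
    by_cases hvt : v = e.tgt
    · subst hvt
      simp [crossFun, hv0]
    · have hv1 : ¬ IsMinVertex G v := fun h => hv <|
        (isMinVertex_insert_iff he hG' v).2 ⟨h, by rwa [ht]⟩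
      have hvs : v ≠ minVertex G e.src := fun h => hv1 (h ▸ isMinVertex_minVertex G e.src)
      simp [crossFun, hvt, hvs, hv0, fill_of_not a hv1, ConnCDGA.sgn_pow_one]

theorem insertOnes_merge (a : ∀ v : Comp G, slot A v.1) (r : Comp G) (hr : r < compOf G e.tgt) :
    insertOnes A (insert e G) (merge he hG' r hr (PiTensorProduct.tprod k a)) =
      ∑ m : Fin 2, PiTensorProduct.tprod k (mergeFun (fill a) r.1 e.tgt m) := by
  rw [merge, LinearMap.sum_apply, map_sum]
  refine Finset.sum_congr rfl fun m _ => ?_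
  rw [tensorLift_tprod, insertOnes_tprod, fill_merge he hG' a r hr]

theorem insertOnes_cross (a : ∀ v : Comp G, slot A v.1) (hs : (compOf G e.src).1 ≠ 0) :
    insertOnes A (insert e G) (cross he hG' hs (PiTensorProduct.tprod k a)) =
      ∑ m : Fin 2, ∑ m' : Fin 2,
        PiTensorProduct.tprod k (crossFun (fill a) (minVertex G e.src) e.tgt m m') := by
  rw [cross, LinearMap.sum_apply, map_sum]
  refine Finset.sum_congr rfl fun m _ => ?_
  rw [LinearMap.sum_apply, map_sum]
  refine Finset.sum_congr rfl fun m' _ => ?_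
  rw [tensorLift_tprod, insertOnes_tprod, fill_cross he hG' a hs]

/-- The three maps in `alpha` are the three terms of `barCoord_insert`, computed on the roots alone.
-/
theorem barCoord_alpha (a : ∀ v : Comp G, slot A v.1) :
    barCoord A (insert e G) (insertOnes A (insert e G)
      (alpha A he hG' (PiTensorProduct.tprod k a))) =
    barCoord A (insert e G) (PiTensorProduct.tprod k (fill a)) := by
  have hs : minVertex G e.src ≠ 0 := compOf_src_ne_zero hG'
  rw [barCoord_insert hs (fill_mem_plus a (isMinVertex_minVertex G e.src) hs)
    (fill_mem_plus a (isMinVertex_tgt he hG'.1) (tgt_ne_zero e)), alpha, LinearMap.sub_apply,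
    LinearMap.sub_apply]
  simp only [map_sub, insertOnes_merge, insertOnes_cross, map_sum]
  rfl

end Contraction

/-- The two differentials are compared edge by edge. An admissible edge gives `alpha`. An edge that
leads out of the index set shares its target with another one, so that J kills it, or starts at the
first vertex, so that it kills the difference at its target. -/
theorem phi_cD₁ (x : CSpace n A) : phi n A (cD₁ n A x) = barD₁ n A (phi n A x) := by
  classical
  have : phi n A ∘ₗ cD₁ n A = barD₁ n A ∘ₗ phi n A := by
    refine cspace_ext fun G a => ?_
    rw [LinearMap.comp_apply, LinearMap.comp_apply, phi_lof, insertOnes_tprod, barD₁_eq_sum,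
      LinearMap.sum_apply, cD₁, DirectSum.toModule_lof, LinearMap.sum_apply, map_sum]
    refine Finset.sum_congr rfl fun e _ => ?_
    by_cases he : e ∈ G.1
    · rw [barGen_barCoord_of_mem he, dif_neg fun h => h.1 he, LinearMap.zero_apply, map_zero]
    · rw [barGen_barCoord he]
      by_cases hG' : InH (insert e G.1)
      · rw [dif_pos ⟨he, hG'⟩, LinearMap.smul_apply, map_smul, LinearMap.comp_apply, phi_lof,
          barCoord_alpha]
      · rw [dif_neg fun h => hG' h.2, LinearMap.zero_apply, map_zero]
        by_cases hN : NoSharedTarget (insert e G.1)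
        · have hsrc : e.src = 0 := by
            by_contra hsrc
            refine hG' ⟨hN, fun f hf => ?_⟩
            rcases Finset.mem_insert.1 hf with rfl | hf
            · exact ⟨hsrc, tgt_ne_zero f⟩
            · exact G.2.2 f hf
          rw [barCoord_insert_eq_zero (by rw [hsrc, minVertex_zero])
            (fill_mem_plus a (isMinVertex_tgt he hN) (tgt_ne_zero e)), smul_zero]
        · rw [barCoord_eq_zero hN, smul_zero]
  exact LinearMap.congr_fun this x

/-! ### Compatibility with `d''` -/

open Classical in
-- The places filled with 1 contribute no terms since d(1) = 0, and they create no signs.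
theorem insertOnes_tensorD (G : Graph n) (x : CTensor A G) :
    insertOnes A G (tensorD (fun v : Comp G => slotSgn A v.1) (fun v : Comp G => slotD A v.1) x) =
      tdiff n A (insertOnes A G x) := by
  have : insertOnes A G ∘ₗ
      tensorD (fun v : Comp G => slotSgn A v.1) (fun v : Comp G => slotD A v.1) =
      tdiff n A ∘ₗ insertOnes A G := by
    refine PiTensorProduct.ext (MultilinearMap.ext fun a => ?_)
    simp only [LinearMap.compMultilinearMap_apply, LinearMap.comp_apply]
    rw [insertOnes_tprod, tensorD, tdiff, tensorD, LinearMap.sum_apply, LinearMap.sum_apply,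
      map_sum, ← Finset.sum_filter_add_sum_filter_not Finset.univ (fun v => IsMinVertex G v),
      Finset.sum_eq_zero (s := Finset.univ.filter fun v => ¬ IsMinVertex G v), add_zero,
      Finset.sum_subtype _ (p := fun v => IsMinVertex G v) (by simp)]
    · refine Finset.sum_congr rfl fun u _ => ?_
      rw [PiTensorProduct.map_tprod, PiTensorProduct.map_tprod, insertOnes_tprod]
      congr 1
      funext v
      by_cases hv : IsMinVertex G v
      · have e1 : (⟨v, hv⟩ : Comp G) < u ↔ v < u.1 := Iff.rfl
        have e2 : (⟨v, hv⟩ : Comp G) = u ↔ v = u.1 := Subtype.ext_iff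
        rw [show fill a v = a ⟨v, hv⟩ from fill_val a ⟨v, hv⟩]
        refine (fill_val _ ⟨v, hv⟩).trans ?_
        simp only [e1, e2]
        split_ifs <;> rfl
      · have hvu : v ≠ u.1 := fun h => hv (h ▸ u.2)
        rw [fill_of_not _ hv, fill_of_not _ hv, if_neg hvu]
        split_ifs
        · rw [ConnCDGA.sgn_one]
        · rfl
    · intro u hu
      rw [PiTensorProduct.map_tprod]
      exact MultilinearMap.map_coord_zero _ u (by
        simp [fill_of_not a (Finset.mem_filter.1 hu).2, ConnCDGA.d_one])
  exact LinearMap.congr_fun this x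

theorem phi_cD₂ (x : CSpace n A) : phi n A (cD₂ n A x) = barD₂ n A (phi n A x) := by
  classical
  have : phi n A ∘ₗ cD₂ n A = barD₂ n A ∘ₗ phi n A := by
    refine cspace_ext fun G a => ?_
    rw [LinearMap.comp_apply, LinearMap.comp_apply, phi_lof, cD₂, DirectSum.toModule_lof,
      LinearMap.smul_apply, map_smul, LinearMap.comp_apply, phi_lof, insertOnes_tensorD,
      barD₂_barCoord]
  exact LinearMap.congr_fun this x

/-! ### Compatibility with the bigradings -/

theorem augAt_mem_deg {v : Fin n} {m : ℕ} {a : A.carrier} (ha : a ∈ A.deg m) :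
    augAt A v a ∈ A.deg m := by
  unfold augAt
  split_ifs
  · exact zero_mem _
  · rw [ConnCDGA.aug_of_mem ha]
    split_ifs
    · exact zero_mem _
    · exact ha

theorem coord_mem_tensorDeg {x : Fin n → A.carrier} {deg : Fin n → ℕ}
    (hx : ∀ v, x v ∈ A.deg (deg v)) :
    coord n A (PiTensorProduct.tprod k x) ∈ tensorDeg n A (∑ v, deg v) := by
  have key : ∀ (l : List (Fin n)) (q : ℕ) (y : TPow n A), y ∈ tensorDeg n A q →
      opProd l (fun v => (tensorAction n A).D v (x v)) y ∈ tensorDeg n A (q + (l.map deg).sum) := by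
    intro l
    induction l with
    | nil => exact fun q y hy => hy
    | cons v l ih =>
      intro q y hy
      rw [opProd_cons, List.map_cons, List.sum_cons, ← add_assoc]
      refine ih _ _ ?_
      rw [RAction.D_apply]
      exact (sub_mem (rmul_mem_tensorDeg v (hx v) hy)
        (rmul_mem_tensorDeg 0 (augAt_mem_deg (hx v)) hy))
  have h1 : tone n A ∈ tensorDeg n A 0 := by
    have := tprod_mem_tensorDeg (A := A) (n := n) (x := fun _ => 1) (deg := fun _ => 0)
      fun _ => ConnCDGA.one_mem_deg (A := A)
    simpa [tone] using this
  rw [coord_apply, ordMap_tprod, Fin.sum_univ_def]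
  have := key (List.finRange n) 0 _ h1
  rwa [zero_add] at this

theorem phi_mem_ePiece (pq : ℕ × ℕ) (x : CSpace n A) (hx : x ∈ cPiece n A pq) :
    phi n A x ∈ ePiece n A pq := by
  classical
  have : cPiece n A pq ≤ (ePiece n A pq).comap (phi n A) := by
    refine Submodule.span_le.2 ?_
    rintro _ ⟨G, a, deg, hG, ha, hdeg, rfl⟩
    rw [SetLike.mem_coe, Submodule.mem_comap, phi_lof, insertOnes_tprod, barCoord,
      LinearMap.comp_apply, barMon_apply]
    obtain ⟨p, q⟩ := pq
    simp only at hG hdeg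
    subst hG
    let deg' : Fin n → ℕ := fun v => if h : IsMinVertex G.1 v then deg ⟨v, h⟩ else 0
    have hsum : ∑ v, deg' v = q := by
      rw [← hdeg, ← Finset.sum_filter_add_sum_filter_not Finset.univ
        (fun v => IsMinVertex G.1 v),
        Finset.sum_eq_zero (s := Finset.univ.filter fun v => ¬ IsMinVertex G.1 v), add_zero,
        Finset.sum_subtype _ (p := fun v => IsMinVertex G.1 v) (by simp)]
      · exact Finset.sum_congr rfl fun u _ => dif_pos u.2
      · exact fun u hu => dif_neg (Finset.mem_filter.1 hu).2
    refine barMk_mem_ePiece ?_ (mon_mem_exteriorPower k G.1)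
    rw [← hsum]
    refine coord_mem_tensorDeg fun v => ?_
    by_cases h : IsMinVertex G.1 v
    · simp only [deg', dif_pos h]
      rw [show fill a v = a ⟨v, h⟩ from fill_val a ⟨v, h⟩]
      exact ha ⟨v, h⟩
    · simp only [deg', dif_neg h]
      rw [fill_of_not a h]
      exact ConnCDGA.one_mem_deg
  exact this hx

theorem slot_le_span (v : Fin n) (a : slot A v) :
    a ∈ Submodule.span k {b : slot A v | ∃ i, (b : A.carrier) ∈ A.deg i} := by
  set N := Submodule.span k {b : slot A v | ∃ i, (b : A.carrier) ∈ A.deg i}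
  have : slot A v ≤ N.map (slot A v).subtype := by
    by_cases hv : v = 0
    · intro a _
      induction a using ConnCDGA.induction_homogeneous with
      | hom i a ha =>
        exact ⟨⟨a, hv ▸ zero_slot_mem a⟩, Submodule.subset_span ⟨i, ha⟩, rfl⟩
      | add a b ha hb =>
        exact add_mem (ha (hv ▸ zero_slot_mem a)) (hb (hv ▸ zero_slot_mem b))
    · refine (slot_of_ne (A := A) hv).le.trans (iSup_le fun i a ha => ?_)
      have has : a ∈ slot A v := by rw [slot_of_ne hv]; exact ConnCDGA.mem_plus ha
      exact ⟨⟨a, has⟩, Submodule.subset_span ⟨i + 1, ha⟩, rfl⟩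
  obtain ⟨b, hb, hba⟩ := this a.2
  have : b = a := Subtype.ext hba
  exact this ▸ hb

theorem iSup_cPiece : ⨆ pq, cPiece n A pq = ⊤ := by
  classical
  refine top_le_iff.1 fun x _ => ?_
  induction x using DirectSum.induction_on with
  | zero => exact zero_mem _
  | add x y hx hy => exact add_mem (hx trivial) (hy trivial)
  | of G x =>
    change DirectSum.lof k (GraphH n) (fun G => CTensor A G.1) G x ∈ _
    have hx : x ∈ Submodule.span k (Set.range (PiTensorProduct.tprod k
        (s := fun v : Comp G.1 => slot A v.1))) := by
      rw [PiTensorProduct.span_tprod_eq_top]; trivial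
    refine (Submodule.span_le (p := (⨆ pq, cPiece n A pq).comap
      (DirectSum.lof k (GraphH n) (fun G => CTensor A G.1) G))).2 ?_ hx
    rintro _ ⟨a, rfl⟩
    refine tprod_mem_of_span (s := fun v : Comp G.1 => {b : slot A v.1 | ∃ i,
      (b : A.carrier) ∈ A.deg i}) (fun a ha => ?_) a fun v => slot_le_span v.1 (a v)
    choose deg hdeg using ha
    rw [Submodule.mem_comap]
    exact Submodule.mem_iSup_of_mem (p := fun pq => cPiece n A pq) (G.1.card, ∑ v, deg v)
      (Submodule.subset_span ⟨G, a, deg, rfl, hdeg, rfl, rfl⟩)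

/-! ### Injectivity -/

theorem exists_linear_one : ∃ ε : A.carrier →ₗ[k] k, ε 1 = 1 := by
  have := A.nontrivial
  obtain ⟨ε, hε⟩ := LinearMap.exists_leftInverse_of_injective
    (LinearMap.toSpanSingleton k A.carrier 1)
    (LinearMap.ker_toSpanSingleton k one_ne_zero)
  exact ⟨ε, by simpa using LinearMap.congr_fun hε 1⟩

/-- A left inverse applies a functional with value 1 at the unit to the places outside the roots,
and a linear retraction onto the slot at each root. -/
theorem insertOnes_injective (G : Graph n) : Function.Injective (insertOnes A G) := by
  classical
  obtain ⟨ε, hε⟩ := exists_linear_one (A := A)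
  have hr : ∀ v : Comp G, ∃ r : A.carrier →ₗ[k] slot A v.1, r ∘ₗ (slot A v.1).subtype =
      LinearMap.id := fun v => LinearMap.exists_leftInverse_of_injective _ (Submodule.ker_subtype _)
  choose r hr using hr
  -- For multilinearity of this left inverse: the entry at `i` affects only the tensor if `i` is a
  -- root, and only the scalar otherwise.
  have hprod : ∀ (x : Fin n → A.carrier) (i : Fin n) (z : A.carrier),
      (∏ v ∈ Finset.univ.filter fun v => ¬ IsMinVertex G v, ε (Function.update x i z v)) •
        PiTensorProduct.tprod k (fun v : Comp G => r v (Function.update x i z v.1)) =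
      if h : IsMinVertex G i then
        (∏ v ∈ Finset.univ.filter fun v => ¬ IsMinVertex G v, ε (x v)) •
          PiTensorProduct.tprod k (Function.update (fun v : Comp G => r v (x v.1)) ⟨i, h⟩
            (r ⟨i, h⟩ z))
      else (ε z * ∏ v ∈ (Finset.univ.filter fun v => ¬ IsMinVertex G v) \ {i}, ε (x v)) •
        PiTensorProduct.tprod k (fun v : Comp G => r v (x v.1)) := by
    intro x i z
    split_ifs with h
    · congr 1
      · refine Finset.prod_congr rfl fun v hv => ?_
        rw [Function.update_of_ne]
        rintro rfl
        exact (Finset.mem_filter.1 hv).2 h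
      · congr 1
        funext v
        by_cases hvi : v = ⟨i, h⟩
        · subst hvi; simp
        · rw [Function.update_of_ne hvi, Function.update_of_ne fun h' => hvi (Subtype.ext h')]
    · congr 1
      · have hi : i ∈ Finset.univ.filter fun v => ¬ IsMinVertex G v := by simp [h]
        rw [← Finset.prod_update_of_mem hi]
        refine Finset.prod_congr rfl fun v _ => ?_
        exact Function.apply_update (fun _ => ε) x i z v
      · congr 1
        funext v
        rw [Function.update_of_ne]
        rintro rfl
        exact h v.2
  let L : MultilinearMap k (fun _ : Fin n => A.carrier) (CTensor A G) := MultilinearMap.mk'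
    (fun x => (∏ v ∈ Finset.univ.filter fun v => ¬ IsMinVertex G v, ε (x v)) •
      PiTensorProduct.tprod k fun v : Comp G => r v (x v.1))
    (fun x i y z => by
      simp only [hprod]
      split_ifs
      · rw [map_add, MultilinearMap.map_update_add, smul_add]
      · rw [map_add, add_mul, add_smul])
    (fun x i c z => by
      simp only [hprod]
      split_ifs
      · rw [map_smul, MultilinearMap.map_update_smul, smul_comm]
      · rw [map_smul, smul_eq_mul, mul_assoc, mul_smul])
  have hL : PiTensorProduct.lift L ∘ₗ insertOnes A G = LinearMap.id := by
    refine PiTensorProduct.ext (MultilinearMap.ext fun a => ?_)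
    simp only [LinearMap.compMultilinearMap_apply, LinearMap.comp_apply, LinearMap.id_apply]
    rw [insertOnes_tprod, PiTensorProduct.lift.tprod]
    change (∏ v ∈ Finset.univ.filter fun v => ¬ IsMinVertex G v, ε (fill a v)) •
      PiTensorProduct.tprod k (fun v : Comp G => r v (fill a v.1)) = _
    rw [Finset.prod_eq_one fun v hv => by rw [fill_of_not a (Finset.mem_filter.1 hv).2, hε],
      one_smul]
    congr 1
    funext v
    rw [fill_val]
    exact LinearMap.congr_fun (hr v) (a v)
  exact Function.LeftInverse.injective (g := PiTensorProduct.lift L)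
    fun x => LinearMap.congr_fun hL x

/-- The projection to the summand of `G` recovers `coord` of the filled component at `G`; `coord`
and the filling are injective. -/
theorem phi_injective : Function.Injective (phi n A) := by
  classical
  have key : ∀ (G : GraphH n) (x : CSpace n A), barCoeff A G.2.1 (phi n A x) =
      coord n A (insertOnes A G.1
        (DirectSum.component k (GraphH n) (fun G => CTensor A G.1) G x)) := by
    intro G x
    have : barCoeff A G.2.1 ∘ₗ phi n A = coord n A ∘ₗ insertOnes A G.1 ∘ₗ
        DirectSum.component k (GraphH n) (fun G => CTensor A G.1) G := by
      refine cspace_ext fun H a => ?_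
      simp only [LinearMap.comp_apply]
      rw [phi_lof, insertOnes_tprod]
      by_cases h : H = G
      · subst h
        rw [DirectSum.component.lof_self, insertOnes_tprod,
          barCoeff_barCoord _ fun v hv => fill_of_not a hv]
      · rw [barCoeff_barCoord_of_ne _ fun h' => h (Subtype.ext h'.symm), DirectSum.component.of,
          dif_neg h, map_zero, map_zero]
    exact LinearMap.congr_fun this x
  intro x y hxy
  refine DirectSum.ext_component k fun G => ?_
  have := (key G x).symm.trans ((congrArg _ hxy).trans (key G y))
  refine insertOnes_injective G.1 ?_
  rw [← invCoord_coord (insertOnes A G.1 _), this, invCoord_coord]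

variable (n A) in
/-- The morphism of bicomplexes from `C(n,A)` to `Ē(n,A)`. -/
def phiHom : PreBicomplex.Hom (C n A) (Ebar n A) where
  toLin := phi n A
  map_piece := phi_mem_ePiece
  comm₁ := phi_cD₁
  comm₂ := phi_cD₂

theorem C_isBicomplex : (C n A).IsBicomplex :=
  PreBicomplex.IsBicomplex.of_injective (phiHom n A) phi_injective Ebar_isBicomplex iSup_cPiece

/-! ### Naturality -/

open Classical in
/-- The map on the underlying spaces of `C(n,A)` and `C(n,B)` induced by `f : A → B`. -/
def cMap {B : ConnCDGA.{u} k} (f : A.Hom B) : CSpace n A →ₗ[k] CSpace n B := C.map n f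

open Classical in
theorem cMap_lof {B : ConnCDGA.{u} k} (f : A.Hom B) (G : GraphH n)
    (a : ∀ v : Comp G.1, slot A v.1) :
    cMap f (DirectSum.lof k (GraphH n) (fun G => CTensor A G.1) G (PiTensorProduct.tprod k a)) =
      DirectSum.lof k (GraphH n) (fun G => CTensor B G.1) G (PiTensorProduct.tprod k fun v =>
        (⟨f.toAlgHom (a v), slot_mem (fun _ => f.mem_plus) (a v).2⟩ : slot B v.1)) := by
  refine (DirectSum.lmap_lof _ _ _).trans (congrArg _ ?_)
  exact PiTensorProduct.map_tprod _ _

theorem eMap_D {B : ConnCDGA.{u} k} (f : A.Hom B) (v : Fin n) (a : A.carrier)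
    (y : ESpace n A) : eMap f ((barAction n A).D v a y) =
      (barAction n B).D v (f.toAlgHom a) (eMap f y) := by
  have : f.toAlgHom (augAt A v a) = augAt B v (f.toAlgHom a) := by
    unfold augAt
    split_ifs
    · simp
    · exact f.map_aug a
  rw [RAction.D_apply, RAction.D_apply, map_sub, eMap_R, eMap_R, this]

/-- The image under `phi` is an ordered product of operators `D` applied to e_G, and morphisms
intertwine these operators because they commute with the augmentation projections. -/
theorem phi_natural {B : ConnCDGA.{u} k} (f : A.Hom B) :
    phi n B ∘ₗ cMap f = eMap f ∘ₗ phi n A := by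
  classical
  refine cspace_ext fun G a => ?_
  rw [LinearMap.comp_apply, LinearMap.comp_apply, phi_lof, insertOnes_tprod, cMap_lof, phi_lof,
    insertOnes_tprod, barCoord_eq, barCoord_eq, ordMap_tprod,
    ordMap_tprod]
  have h1 : eMap f (barMon A G.1 (tone n A)) = barMon B G.1 (tone n B) := by
    rw [barMon_apply, eMap_mk, tone, PiTensorProduct.map_tprod, barMon_apply, tone]
    simp
  have h2 : ∀ v, f.toAlgHom (fill a v) = fill (A := B) (G := G.1)
      (fun v => ⟨f.toAlgHom (a v), slot_mem (fun _ => f.mem_plus) (a v).2⟩) v := by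
    intro v
    by_cases h : IsMinVertex G.1 v <;> simp [fill, h]
  rw [← h1]
  refine (map_opProd (eMap f) (fun v _ y => ?_) _).symm
  rw [eMap_D, h2]

end Morphism

end SmallComplex

namespace SmallComplex

/-! ## The quasi-isomorphism -/

section Filtration

variable {k : Type v} [Field k] {n : ℕ} {A : ConnCDGA.{u} k}

theorem NoSharedTarget.isMinVertex_insert_iff {G : Graph n} {e : Edge n}
    (h : NoSharedTarget (insert e G)) (v : Fin n) :
    IsMinVertex (insert e G) v ↔ IsMinVertex G v ∧ v ≠ e.tgt := by
  rw [isMinVertex_iff h, isMinVertex_iff h.of_insert]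
  simp only [Finset.mem_insert, forall_eq_or_imp]
  exact ⟨fun h => ⟨h.2, h.1.symm⟩, fun h => ⟨h.2.symm, h.1⟩⟩

theorem NoSharedTarget.insert {G : Graph n} {e : Edge n} (h : NoSharedTarget G)
    (he : IsMinVertex G e.tgt) : NoSharedTarget (insert e G) := by
  rw [isMinVertex_iff h] at he
  intro a ha b hb hab
  rcases Finset.mem_insert.1 ha with ha' | ha' <;> rcases Finset.mem_insert.1 hb with hb' | hb'
  · rw [ha', hb']
  · exact absurd (ha' ▸ hab.symm) (he b hb')
  · exact absurd (hb' ▸ hab) (he a ha')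
  · exact h a ha' b hb' hab

theorem sgn_pow_label (m : ℕ) (a : A.carrier) :
    (a = 1 → (A.sgn ^ m) a = 1) ∧ (a ∈ A.plus → (A.sgn ^ m) a ∈ A.plus) :=
  ⟨fun h => by rw [h, ConnCDGA.sgn_pow_one], fun h => ConnCDGA.sgn_pow_mem_plus m h⟩

theorem mergeFun_label {x : Fin n → A.carrier} {r t : Fin n} {m : Fin 2} {v : Fin n}
    (hvr : v ≠ r) (hvt : v ≠ t) :
    (x v = 1 → mergeFun x r t m v = 1) ∧ (x v ∈ A.plus → mergeFun x r t m v ∈ A.plus) := by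
  simp only [mergeFun, hvr, hvt, if_false]
  split_ifs
  · exact sgn_pow_label _ _
  · exact ⟨id, id⟩

theorem mergeFun_tgt {x : Fin n → A.carrier} {r t : Fin n} {m : Fin 2} (h : r < t) :
    mergeFun x r t m t = 1 := by
  simp [mergeFun, h.ne']

variable (n A) in
/-- The total differential of `Ē(n,A)`. -/
def barD : ESpace n A →ₗ[k] ESpace n A := barD₁ n A + barD₂ n A

theorem barD_eq_sum : barD n A = ∑ e : Edge n, barGen A e + barD₂ n A := by
  rw [barD, barD₁_eq_sum]

theorem barD_barD (y : ESpace n A) : barD n A (barD n A y) = 0 := Ebar_isBicomplex.d_d y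

variable (A) in
/-- The span of the tensors with the entry `1` at the vertices that are not the smallest ones of
their components. -/
def rootTensors (G : Graph n) : Submodule k (TPow n A) :=
  Submodule.span k {z | ∃ x : Fin n → A.carrier, (∀ v, ¬ IsMinVertex G v → x v = 1) ∧
    z = PiTensorProduct.tprod k x}

theorem tone_mem_rootTensors (G : Graph n) : tone n A ∈ rootTensors A G :=
  Submodule.subset_span ⟨fun _ => 1, fun _ _ => rfl, rfl⟩

theorem rmul_mem_rootTensors {G : Graph n} {v : Fin n} (hv : IsMinVertex G v)
    (a : A.carrier) {z : TPow n A} (hz : z ∈ rootTensors A G) : rmul v a z ∈ rootTensors A G := by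
  induction a using ConnCDGA.induction_homogeneous with
  | add a b ha hb => rw [map_add, LinearMap.add_apply]; exact add_mem ha hb
  | hom i a ha =>
    have : rootTensors A G ≤ (rootTensors A G).comap (rmul v a) := by
      refine Submodule.span_le.2 ?_
      rintro _ ⟨x, hx, rfl⟩
      rw [SetLike.mem_coe, Submodule.mem_comap, rmul_of_mem v ha, rightMul_tprod]
      refine Submodule.subset_span ⟨_, fun w hw => ?_, rfl⟩
      have hwv : w ≠ v := fun h => hw (h ▸ hv)
      rw [if_neg hwv, hx w hw, ConnCDGA.sgn_pow_one, ite_self]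
    exact this hz

variable [NeZero n]

/-- The tensor `⊗ x_v` has, in the summand of the graph `G`, the entry `1` at the vertices that are
not the smallest ones of their components, and at the others, except for the first vertex, an entry
in `A⁺` or, for the vertices in `S`, the entry `1`. The edges from the first vertex go to `S`. -/
structure Labelled (S : Finset (Fin n)) (G : Graph n) (x : Fin n → A.carrier) : Prop where
  noSharedTarget : NoSharedTarget G
  root : ∀ v, v ≠ 0 → IsMinVertex G v → x v ∈ A.plus ∨ (x v = 1 ∧ v ∈ S)
  nonroot : ∀ v, ¬ IsMinVertex G v → x v = 1
  edge : ∀ e ∈ G, e.src = 0 → e.tgt ∈ S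

variable (A) in
/-- The subspace of the summand of a graph `G` that is spanned by the labelled tensors. -/
def graphStage (S : Finset (Fin n)) (G : Graph n) : Submodule k (ESpace n A) :=
  Submodule.span k {y | ∃ x : Fin n → A.carrier, Labelled S G x ∧
    y = barCoord A G (PiTensorProduct.tprod k x)}

variable (A) in
/-- The subspace of `Ē(n,A)` that is spanned by the labelled tensors. -/
def stage (S : Finset (Fin n)) : Submodule k (ESpace n A) := ⨆ G : Graph n, graphStage A S G

variable {S : Finset (Fin n)} {G : Graph n} {x : Fin n → A.carrier}

theorem Labelled.mem (h : Labelled S G x) :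
    barCoord A G (PiTensorProduct.tprod k x) ∈ graphStage A S G :=
  Submodule.subset_span ⟨x, h, rfl⟩

theorem graphStage_le_stage : graphStage A S G ≤ stage A S := le_iSup (graphStage A S) G

theorem Labelled.mono {S' : Finset (Fin n)} (hS : S ⊆ S') (h : Labelled S G x) :
    Labelled S' G x where
  noSharedTarget := h.noSharedTarget
  root v hv hv' := (h.root v hv hv').imp_right fun h => ⟨h.1, hS h.2⟩
  nonroot := h.nonroot
  edge e he he' := hS (h.edge e he he')

theorem graphStage_le_iff {N : Submodule k (ESpace n A)} : graphStage A S G ≤ N ↔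
    ∀ x : Fin n → A.carrier, Labelled S G x → barCoord A G (PiTensorProduct.tprod k x) ∈ N := by
  rw [graphStage, Submodule.span_le]
  exact ⟨fun h x hx => h ⟨x, hx, rfl⟩, fun h _ ⟨x, hx, hy⟩ => hy ▸ h x hx⟩

theorem stage_mono {S' : Finset (Fin n)} (hS : S ⊆ S') : stage A S ≤ stage A S' :=
  iSup_mono fun _ => graphStage_le_iff.2 fun _ h => (h.mono hS).mem

/-! ### Stability under the differentials -/

/-- The new edge turns its target into a nonroot, which requires the entry 1 there. Any other root
keeps its kind of label or acquires an entry in A⁺. -/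
theorem Labelled.insert (h : Labelled S G x) {e : Edge n} (hN : NoSharedTarget (insert e G))
    (he : e.src = 0 → e.tgt ∈ S) {y : Fin n → A.carrier} (hyt : y e.tgt = 1)
    (hy : ∀ v, v ≠ 0 → v ≠ e.tgt → (IsMinVertex G v ∧ y v ∈ A.plus) ∨
      ((x v = 1 → y v = 1) ∧ (x v ∈ A.plus → y v ∈ A.plus))) :
    Labelled S (insert e G) y where
  noSharedTarget := hN
  root v hv hv' := by
    obtain ⟨h1, h2⟩ := (hN.isMinVertex_insert_iff v).1 hv'
    rcases hy v hv h2 with h3 | ⟨h3, h4⟩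
    · exact Or.inl h3.2
    · exact (h.root v hv h1).imp h4 fun h => ⟨h3 h.1, h.2⟩
  nonroot v hv := by
    by_cases hvt : v = e.tgt
    · rw [hvt, hyt]
    · have h1 : ¬ IsMinVertex G v := fun h => hv ((hN.isMinVertex_insert_iff v).2 ⟨h, hvt⟩)
      have hv0 : v ≠ 0 := by
        rintro rfl
        exact h1 fun _ _ => Fin.zero_le _
      rcases hy v hv0 hvt with h3 | ⟨h3, -⟩
      · exact absurd h3.1 h1
      · exact h3 (h.nonroot v h1)
  edge f hf hf' := by
    rcases Finset.mem_insert.1 hf with rfl | hf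
    · exact he hf'
    · exact h.edge f hf hf'

/-- The target of the new edge is a root of `G`. If its entry is 1, then it lies in `S`, and the
edge may be added as it is, even from the first vertex. If its entry is in A⁺, that factor is
contracted with the one at the root of the source. The conclusion names the graph, not only the
stage, because `barD_sub_barGen_mem` has to follow which terms contain a given edge. -/
theorem barGen_labelled (h : Labelled S G x) (e : Edge n) :
    barGen A e (barCoord A G (PiTensorProduct.tprod k x)) ∈ graphStage A S (insert e G) := by
  by_cases he : e ∈ G
  · rw [barGen_barCoord_of_mem he]
    exact zero_mem _
  rw [barGen_barCoord he]
  refine Submodule.smul_mem _ _ ?_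
  by_cases hN : NoSharedTarget (insert e G)
  swap
  · rw [barCoord_eq_zero hN]
    exact zero_mem _
  have hroot := isMinVertex_tgt he hN
  rcases h.root e.tgt (tgt_ne_zero e) hroot with hxt | ⟨hxt, htS⟩
  swap
  · exact (h.insert hN (fun _ => htS) hxt fun v _ _ => Or.inr ⟨id, id⟩).mem
  -- Joining the component of the first vertex kills an entry in A⁺, so no edge to a vertex outside
  -- `S` arises.
  by_cases hs : minVertex G e.src = 0
  · rw [barCoord_insert_eq_zero hs hxt]
    exact zero_mem _
  have hsrc : e.src = 0 → e.tgt ∈ S := fun h0 => absurd (by rw [h0, minVertex_zero]) hs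
  have hst := minVertex_src_lt (G := G) (e := e)
  have hsr := isMinVertex_minVertex G e.src
  have h0t : 0 < e.tgt := Fin.pos_iff_ne_zero.2 (tgt_ne_zero e)
  -- An entry in A⁺ at the root of the source gives the three terms of α_{ij}; an entry 1 is
  -- replaced by the factor from the target.
  rcases h.root _ hs hsr with hxs | ⟨hxs, -⟩
  · rw [barCoord_insert hs hxs hxt]
    refine sub_mem (sub_mem (Submodule.sum_mem _ fun m _ => ?_)
      (Submodule.sum_mem _ fun m _ => Submodule.sum_mem _ fun m' _ => ?_))
      (Submodule.sum_mem _ fun m _ => ?_)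
    · refine (h.insert hN hsrc (mergeFun_tgt hst) fun v _ hvt => ?_).mem
      by_cases hvs : v = minVertex G e.src
      · subst hvs
        refine Or.inl ⟨hsr, ?_⟩
        rw [mergeFun, if_pos rfl]
        exact ConnCDGA.mul_mem_plus hxs (ConnCDGA.par_mem_plus _ hxt)
      · exact Or.inr (mergeFun_label hvs hvt)
    · refine (h.insert hN hsrc (by simp [crossFun, tgt_ne_zero e]) fun v hv0 hvt => ?_).mem
      by_cases hvs : v = minVertex G e.src
      · subst hvs
        refine Or.inl ⟨hsr, ?_⟩
        simp only [crossFun, hv0, hvt, lt_irrefl, if_false, if_true]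
        exact ConnCDGA.par_mem_plus _ hxt
      · refine Or.inr ?_
        simp only [crossFun, hv0, hvt, hvs, if_false]
        split_ifs
        · exact sgn_pow_label _ _
        · exact sgn_pow_label _ _
        · exact ⟨id, id⟩
    · exact (h.insert hN hsrc (mergeFun_tgt h0t) fun v hv0 hvt =>
        Or.inr (mergeFun_label hv0 hvt)).mem
  · rw [barCoord_insert_one hs hxs]
    refine Submodule.sum_mem _ fun m _ => ?_
    refine (h.insert hN hsrc (mergeFun_tgt hst) fun v _ hvt => ?_).mem
    by_cases hvs : v = minVertex G e.src
    · subst hvs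
      refine Or.inl ⟨hsr, ?_⟩
      rw [mergeFun, if_pos rfl, hxs, one_mul]
      exact ConnCDGA.par_mem_plus _ hxt
    · exact Or.inr (mergeFun_label hvs hvt)

/-- The differential kills an entry 1 and preserves A⁺, so the labels survive. -/
theorem barD₂_labelled (h : Labelled S G x) :
    barD₂ n A (barCoord A G (PiTensorProduct.tprod k x)) ∈ graphStage A S G := by
  rw [barD₂_barCoord, tdiff, tensorD, LinearMap.sum_apply, map_sum]
  refine Submodule.smul_mem _ _ (Submodule.sum_mem _ fun u _ => ?_)
  rw [PiTensorProduct.map_tprod]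
  by_cases hu : x u = 1
  · rw [MultilinearMap.map_coord_zero _ u (by simp [hu, ConnCDGA.d_one]), map_zero]
    exact zero_mem _
  refine Labelled.mem ⟨h.noSharedTarget, fun v hv hv' => ?_, fun v hv => ?_, h.edge⟩
  · rcases lt_trichotomy v u with hvu | rfl | hvu
    · rw [if_pos hvu]
      exact (h.root v hv hv').imp (fun h => ConnCDGA.sgn_mem_plus h)
        fun h => ⟨by rw [h.1, ConnCDGA.sgn_one], h.2⟩
    · rw [if_neg (lt_irrefl _), if_pos rfl]
      exact Or.inl ((h.root v hv hv').elim (fun h => ConnCDGA.d_mem_plus h)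
        fun h => absurd h.1 hu)
    · rw [if_neg hvu.not_gt, if_neg hvu.ne']
      exact h.root v hv hv'
  · have h1 := h.nonroot v hv
    have hvu : v ≠ u := fun hvu => hu (hvu ▸ h1)
    rw [if_neg hvu, h1]
    split_ifs
    · exact ConnCDGA.sgn_one
    · rfl

theorem barD_mem_stage {y : ESpace n A} (hy : y ∈ stage A S) : barD n A y ∈ stage A S := by
  have : stage A S ≤ (stage A S).comap (barD n A) := by
    refine iSup_le fun G => graphStage_le_iff.2 fun x hx => ?_
    rw [Submodule.mem_comap, barD_eq_sum, LinearMap.add_apply, LinearMap.sum_apply]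
    exact add_mem (Submodule.sum_mem _ fun e _ => graphStage_le_stage (barGen_labelled hx e))
      (graphStage_le_stage (barD₂_labelled hx))
  exact this hy

/-! ### The image of `C(n,A)` and the whole space -/

/-- For S = ∅ the entry 1 is excluded at the roots and so are edges from the first vertex, which
leaves exactly the data indexing C(n,A). -/
theorem range_phi : LinearMap.range (phi n A) = stage A ∅ := by
  classical
  refine le_antisymm ?_ (iSup_le fun G => graphStage_le_iff.2 fun x hx => ?_)
  · rintro _ ⟨y, rfl⟩
    induction y using DirectSum.induction_on with
    | zero => rw [map_zero]; exact zero_mem _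
    | add y z hy hz => rw [map_add]; exact add_mem hy hz
    | of G y =>
      change phi n A (DirectSum.lof k (GraphH n) (fun G => CTensor A G.1) G y) ∈ _
      rw [phi_lof]
      have hy : y ∈ Submodule.span k (Set.range (PiTensorProduct.tprod k
          (s := fun v : Comp G.1 => slot A v.1))) := by
        rw [PiTensorProduct.span_tprod_eq_top]; trivial
      refine (Submodule.span_le (p := (stage A ∅).comap
        (barCoord A G.1 ∘ₗ insertOnes A G.1))).2 ?_ hy
      rintro _ ⟨a, rfl⟩
      rw [SetLike.mem_coe, Submodule.mem_comap, LinearMap.comp_apply, insertOnes_tprod]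
      exact graphStage_le_stage (Labelled.mem ⟨G.2.1,
        fun v hv hv' => Or.inl (fill_mem_plus a hv' hv),
        fun v hv => fill_of_not a hv, fun e he he' => absurd he' (G.2.2 e he).1⟩)
  · have hG : InH G := ⟨hx.noSharedTarget, fun e he =>
      ⟨fun h => absurd (hx.edge e he h) (Finset.notMem_empty _), tgt_ne_zero e⟩⟩
    have hslot : ∀ v : Comp G, x v.1 ∈ slot A v.1 := by
      intro v
      by_cases hv : v.1 = 0
      · rw [hv]; exact zero_slot_mem _
      · rw [slot_of_ne hv]
        exact (hx.root v.1 hv v.2).resolve_right fun h => Finset.notMem_empty _ h.2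
    refine ⟨DirectSum.lof k (GraphH n) (fun G => CTensor A G.1) ⟨G, hG⟩
      (PiTensorProduct.tprod k fun v => ⟨x v.1, hslot v⟩), ?_⟩
    rw [phi_lof, insertOnes_tprod]
    congr 2
    funext v
    by_cases hv : IsMinVertex G v
    · exact fill_val (fun v : Comp G => (⟨x v.1, hslot v⟩ : slot A v.1)) ⟨v, hv⟩
    · rw [fill_of_not _ hv, hx.nonroot v hv]

theorem isMinVertex_zero (G : Graph n) : IsMinVertex G 0 := fun _ _ => Fin.zero_le _

theorem rootMap_mem_rootTensors (z : TPow n A) : rootMap A G z ∈ rootTensors A G := by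
  have hz : z ∈ Submodule.span k (Set.range (PiTensorProduct.tprod k
      (s := fun _ : Fin n => A.carrier))) := by
    rw [PiTensorProduct.span_tprod_eq_top]; trivial
  refine (Submodule.span_le (p := (rootTensors A G).comap (rootMap A G))).2 ?_ hz
  rintro _ ⟨x, rfl⟩
  rw [SetLike.mem_coe, Submodule.mem_comap, rootMap, LinearMap.flip_apply, ordMap_tprod]
  exact opProd_mem (fun v _ y hy => rmul_mem_rootTensors (isMinVertex_minVertex G v) _ hy)
    (tone_mem_rootTensors G)

theorem invCoord_mem_rootTensors {z : TPow n A} (hz : z ∈ rootTensors A G) :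
    invCoord n A z ∈ rootTensors A G := by
  refine (Submodule.span_le (p := (rootTensors A G).comap (invCoord n A))).2 ?_ hz
  rintro _ ⟨x, hx, rfl⟩
  rw [SetLike.mem_coe, Submodule.mem_comap, invCoord, LinearMap.flip_apply, ordMap_tprod]
  refine opProd_mem (fun v _ y hy => ?_) (tone_mem_rootTensors G)
  by_cases hv : IsMinVertex G v
  · rw [invOp_apply]
    exact add_mem (rmul_mem_rootTensors hv _ hy)
      (rmul_mem_rootTensors (isMinVertex_zero G) _ hy)
  · rw [hx v hv, invOp_one]
    exact hy

/-- Each entry at a root is a scalar plus an element of A⁺, and both are admissible labels when `S`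
contains all vertices but the first. -/
theorem barCoord_rootTensors (hN : NoSharedTarget G) (hS : ∀ v, v ≠ 0 → v ∈ S) {z : TPow n A}
    (hz : z ∈ rootTensors A G) : barCoord A G z ∈ graphStage A S G := by
  refine (Submodule.span_le (p := (graphStage A S G).comap (barCoord A G))).2 ?_ hz
  rintro _ ⟨x, hx, rfl⟩
  refine tprod_mem_of_span (s := fun v => {a : A.carrier |
    (v ≠ 0 → IsMinVertex G v → a ∈ A.plus ∨ (a = 1 ∧ v ∈ S)) ∧ (¬ IsMinVertex G v → a = 1)})
    (fun y hy => ?_) x fun v => ?_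
  · exact Labelled.mem ⟨hN, fun v => (hy v).1, fun v => (hy v).2, fun e _ _ => hS _ (tgt_ne_zero e)⟩
  · by_cases hv : IsMinVertex G v
    · obtain ⟨c, hc⟩ := ConnCDGA.exists_eq_add_aug (x v)
      rw [hc]
      exact add_mem (Submodule.smul_mem _ _ (Submodule.subset_span
          ⟨fun h0 _ => Or.inr ⟨rfl, hS v h0⟩, fun _ => rfl⟩))
        (Submodule.subset_span ⟨fun _ _ => Or.inl (ConnCDGA.aug_mem_plus _), fun h => absurd hv h⟩)
    · exact Submodule.subset_span ⟨fun _ h => absurd h hv, hx v⟩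

/-- Any class is brought to the roots by `rootMap`, and `invCoord` then rewrites it in the new
coordinates without leaving the roots. -/
theorem stage_eq_top (hS : ∀ v, v ≠ 0 → v ∈ S) : stage A S = ⊤ := by
  refine top_le_iff.1 ?_
  rw [← span_barMon]
  refine iSup_le fun G => ?_
  rintro _ ⟨z, rfl⟩
  by_cases hN : NoSharedTarget G
  · rw [← barMon_rootMap, ← coord_invCoord (rootMap A G z)]
    exact graphStage_le_stage (barCoord_rootTensors hN hS
      (invCoord_mem_rootTensors (rootMap_mem_rootTensors z)))
  · rw [barMon_eq_zero hN]
    exact zero_mem _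

/-! ### One step of the filtration -/

section Step

variable {j : Fin n} (hj : j ≠ 0)

/-- The edge from the first vertex to the vertex `j`. -/
def zeroEdge : Edge n := ⟨(0, j), Fin.pos_iff_ne_zero.2 hj⟩

theorem zeroEdge_eq {e : Edge n} (h0 : e.src = 0) (h1 : e.tgt = j) : e = zeroEdge hj :=
  Subtype.ext (Prod.ext h0 h1)

variable (A S j) in
/-- The span of the labelled tensors with `x_j = 1`, where `j` is the smallest vertex of its
component. -/
def unitStage : Submodule k (ESpace n A) :=
  Submodule.span k {y | ∃ (G : Graph n) (x : Fin n → A.carrier), Labelled (insert j S) G x ∧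
    IsMinVertex G j ∧ x j = 1 ∧ y = barCoord A G (PiTensorProduct.tprod k x)}

theorem zeroEdge_notMem (hN : NoSharedTarget G) (h : IsMinVertex G j) : zeroEdge hj ∉ G :=
  fun h' => (isMinVertex_iff hN j).1 h _ h' rfl

/-- For a graph without the edge (1,j), the only new freedom is the entry 1 at the root `j`. -/
theorem graphStage_insert_le (hG : zeroEdge hj ∉ G) :
    graphStage A (insert j S) G ≤ stage A S ⊔ unitStage A S j := by
  refine graphStage_le_iff.2 fun x hx => ?_
  by_cases h : IsMinVertex G j ∧ x j = 1
  · exact Submodule.mem_sup_right (Submodule.subset_span ⟨G, x, hx, h.1, h.2, rfl⟩)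
  · refine Submodule.mem_sup_left (graphStage_le_stage (Labelled.mem
      ⟨hx.noSharedTarget, fun v hv hv' => ?_, hx.nonroot, fun e he he' => ?_⟩))
    · refine (hx.root v hv hv').imp_right fun h1 => ⟨h1.1, ?_⟩
      refine Finset.mem_of_mem_insert_of_ne h1.2 ?_
      rintro rfl
      exact h ⟨hv', h1.1⟩
    · refine Finset.mem_of_mem_insert_of_ne (hx.edge e he he') fun h1 => hG ?_
      rwa [← zeroEdge_eq hj he' h1]

/-- If the graph contains (1,j), then `j` is no root and has the entry 1. Deleting the edge makes
`j` a root with that same entry, which gives an element of `unitStage`. -/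
theorem stage_insert_le : stage A (insert j S) ≤
    stage A S ⊔ unitStage A S j ⊔ (unitStage A S j).map (barGen A (zeroEdge hj)) := by
  refine iSup_le fun G => ?_
  by_cases hG : zeroEdge hj ∈ G
  swap
  · exact (graphStage_insert_le hj hG).trans le_sup_left
  refine le_trans (graphStage_le_iff.2 fun x hx => ?_) le_sup_right
  have hins : insert (zeroEdge hj) (G.erase (zeroEdge hj)) = G := Finset.insert_erase hG
  have hnot : zeroEdge hj ∉ G.erase (zeroEdge hj) := Finset.notMem_erase _ _
  have hN : NoSharedTarget (insert (zeroEdge hj) (G.erase (zeroEdge hj))) :=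
    hins.symm ▸ hx.noSharedTarget
  have hroot : IsMinVertex (G.erase (zeroEdge hj)) j := isMinVertex_tgt hnot hN
  have hiff : ∀ v, IsMinVertex G v ↔ IsMinVertex (G.erase (zeroEdge hj)) v ∧ v ≠ j := by
    intro v
    have := hN.isMinVertex_insert_iff v
    rwa [hins] at this
  have hxj : x j = 1 := hx.nonroot j fun h => ((hiff j).1 h).2 rfl
  have hy : barCoord A (G.erase (zeroEdge hj)) (PiTensorProduct.tprod k x) ∈ unitStage A S j := by
    refine Submodule.subset_span ⟨_, x, ⟨hN.of_insert, fun v hv hv' => ?_, fun v hv => ?_,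
      fun e he => hx.edge e (Finset.mem_of_mem_erase he)⟩, hroot, hxj, rfl⟩
    · by_cases hvj : v = j
      · exact Or.inr ⟨hvj ▸ hxj, hvj ▸ Finset.mem_insert_self j S⟩
      · exact hx.root v hv ((hiff v).2 ⟨hv', hvj⟩)
    · exact hx.nonroot v fun h => hv ((hiff v).1 h).1
  refine ⟨edgeSign k (G.erase (zeroEdge hj)) (zeroEdge hj) • barCoord A (G.erase (zeroEdge hj))
    (PiTensorProduct.tprod k x), Submodule.smul_mem _ _ hy, ?_⟩
  rw [map_smul, barGen_barCoord hnot, smul_smul, edgeSign_mul_self, one_smul, hins]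

/-- All terms of the differential other than the multiplication by e_{1j} stay with graphs that do
not contain (1,j). -/
theorem barD_sub_barGen_mem {y : ESpace n A} (hy : y ∈ unitStage A S j) :
    barD n A y - barGen A (zeroEdge hj) y ∈ stage A S ⊔ unitStage A S j := by
  have : unitStage A S j ≤ (stage A S ⊔ unitStage A S j).comap
      (barD n A - barGen A (zeroEdge hj)) := by
    refine Submodule.span_le.2 ?_
    rintro _ ⟨G, x, hx, hGj, -, rfl⟩
    have hG := zeroEdge_notMem hj hx.noSharedTarget hGj
    rw [SetLike.mem_coe, Submodule.mem_comap, barD_eq_sum,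
      ← Finset.add_sum_erase _ _ (Finset.mem_univ (zeroEdge hj)), add_assoc, add_sub_cancel_left,
      LinearMap.add_apply, LinearMap.sum_apply]
    refine add_mem (Submodule.sum_mem _ fun e he => ?_)
      (graphStage_insert_le hj hG (barD₂_labelled hx))
    refine graphStage_insert_le hj ?_ (barGen_labelled hx e)
    rw [Finset.mem_insert, not_or]
    exact ⟨(Finset.ne_of_mem_erase he).symm, hG⟩
  exact this hy

open Classical in
variable (A) in
/-- A left inverse of the multiplication by `e_{1j}` on `unitStage`. -/
def unitRetract : ESpace n A →ₗ[k] ESpace n A :=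
  ∑ G : Graph n, if h : zeroEdge hj ∉ G ∧ NoSharedTarget (insert (zeroEdge hj) G) then
    edgeSign k G (zeroEdge hj) • (barMon A G ∘ₗ barCoeff A h.2) else 0

theorem unitRetract_barCoord (hG : zeroEdge hj ∉ G) (z : TPow n A) :
    unitRetract A hj (barCoord A G z) = 0 := by
  rw [unitRetract, LinearMap.sum_apply]
  refine Finset.sum_eq_zero fun H _ => ?_
  split_ifs with h
  · rw [LinearMap.smul_apply, LinearMap.comp_apply, barCoeff_barCoord_of_ne, map_zero, smul_zero]
    rintro rfl
    exact hG (Finset.mem_insert_self _ _)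
  · rfl

/-- No graph in sight contains (1,j): for the stage because `j` is not in `S`, for `unitStage`
because `j` is a root. -/
theorem unitRetract_eq_zero (hjS : j ∉ S) {y : ESpace n A}
    (hy : y ∈ stage A S ⊔ unitStage A S j) : unitRetract A hj y = 0 := by
  have : stage A S ⊔ unitStage A S j ≤ LinearMap.ker (unitRetract A hj) := by
    refine sup_le (iSup_le fun G => graphStage_le_iff.2 fun x hx => ?_) (Submodule.span_le.2 ?_)
    · exact unitRetract_barCoord hj (fun h => hjS (hx.edge _ h rfl)) _
    · rintro _ ⟨G, x, hx, hGj, -, rfl⟩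
      exact unitRetract_barCoord hj (zeroEdge_notMem hj hx.noSharedTarget hGj) _
  exact this hy

theorem unitRetract_barGen {y : ESpace n A} (hy : y ∈ unitStage A S j) :
    unitRetract A hj (barGen A (zeroEdge hj) y) = y := by
  have : unitStage A S j ≤ LinearMap.eqLocus (unitRetract A hj ∘ₗ barGen A (zeroEdge hj))
      LinearMap.id := by
    refine Submodule.span_le.2 ?_
    rintro _ ⟨G, x, hx, hGj, hxj, rfl⟩
    have hG := zeroEdge_notMem hj hx.noSharedTarget hGj
    have hN : NoSharedTarget (insert (zeroEdge hj) G) := hx.noSharedTarget.insert hGj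
    rw [SetLike.mem_coe, LinearMap.mem_eqLocus, LinearMap.comp_apply, LinearMap.id_apply,
      barGen_barCoord hG, map_smul, unitRetract, LinearMap.sum_apply, Finset.sum_eq_single G]
    · rw [dif_pos ⟨hG, hN⟩, LinearMap.smul_apply, LinearMap.comp_apply, barCoeff_barCoord,
        smul_smul, edgeSign_mul_self, one_smul]
      · rfl
      · intro v hv
        -- In the enlarged graph `j` is no longer a root; the coefficient is recovered because its
        -- entry is 1.
        by_cases hvj : v = j
        · rw [hvj, hxj]
        · exact hx.nonroot v fun h => hv ((hN.isMinVertex_insert_iff v).2 ⟨h, hvj⟩)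
    · intro H _ hHG
      split_ifs with h
      · rw [LinearMap.smul_apply, LinearMap.comp_apply, barCoeff_barCoord_of_ne, map_zero,
          smul_zero]
        intro h'
        refine hHG ?_
        rw [← Finset.erase_insert h.1, h', Finset.erase_insert hG]
      · rfl
    · simp
  exact this hy

theorem cohomologyIso_stage_insert (hj : j ≠ 0) (hjS : j ∉ S) :
    CohomologyIso (barD n A) (stage A S) (stage A (insert j S)) := by
  refine CohomologyIso.of_cone barD_barD (Y := unitStage A S j) (barGen A (zeroEdge hj))
    (fun w hw => barD_mem_stage hw) (stage_insert_le hj)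
    (fun y hy => barD_sub_barGen_mem hj hy) fun y hy h => ?_
  rw [← unitRetract_barGen hj hy]
  exact unitRetract_eq_zero hj hjS h

end Step

theorem cohomologyIso_stage (hS : (0 : Fin n) ∉ S) :
    CohomologyIso (barD n A) (stage A ∅) (stage A S) := by
  induction S using Finset.induction_on with
  | empty => exact CohomologyIso.refl _
  | insert j S hjS ih =>
    rw [Finset.mem_insert, not_or] at hS
    exact CohomologyIso.trans barD_barD (stage_mono (Finset.empty_subset S)) (ih hS.2)
      (cohomologyIso_stage_insert (Ne.symm hS.1) hjS)

theorem phiHom_isQuasiIso : (phiHom n A).IsQuasiIso := by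
  refine PreBicomplex.Hom.isQuasiIso_of_range _ Ebar_isBicomplex.d_d phi_injective ?_
  -- The filtration runs up to the set of all vertices except the first, whose slot is the whole of
  -- `A` from the start.
  have h := cohomologyIso_stage (A := A) (S := Finset.univ.erase (0 : Fin n)) (by simp)
  rw [stage_eq_top (S := Finset.univ.erase 0) fun v hv => by simpa using hv, ← range_phi] at h
  exact h

end Filtration

end SmallComplex

end

theorem proposition3 {k : Type v} [Field k] (n : ℕ) [NeZero n] :
    (∀ A : ConnCDGA.{u} k, (SmallComplex.C n A).IsBicomplex ∧ (SmallComplex.Ebar n A).IsBicomplex) ∧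
    ∃ φ : ∀ A : ConnCDGA.{u} k,
        PreBicomplex.Hom (SmallComplex.C n A) (SmallComplex.Ebar n A),
      (∀ A : ConnCDGA.{u} k, (φ A).IsQuasiIso) ∧
      ∀ (A B : ConnCDGA.{u} k) (f : A.Hom B),
        (φ B).toLin ∘ₗ SmallComplex.C.map n f = SmallComplex.Ebar.map n f ∘ₗ (φ A).toLin :=
  ⟨fun _ => ⟨SmallComplex.C_isBicomplex, SmallComplex.Ebar_isBicomplex⟩,
    fun A => SmallComplex.phiHom n A, fun _ => SmallComplex.phiHom_isQuasiIso,
    fun _ _ f => SmallComplex.phi_natural f⟩
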